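/- Let $\Gamma$ be a discrete group. A Hilbert $\Gamma$-module is a complex Hilbert space with a unitary $\Gamma$-action which admits a $\Gamma$-equivariant isometric embedding into a free module $\ell^2(\Gamma)\otimes K$ for some Hilbert space $K$. $\dim_\Gamma$ of a closed $\Gamma$-invariant subspace is the $\Gamma$-trace of its orthogonal projection. $\mathscr B_\Gamma$ denotes the bounded $\Gamma$-equivariant operators, $\mathscr K_\Gamma$ the norm closure of those whose range has a closure of finite $\Gamma$-dimension, $\Pi_\Gamma$ is the quotient map modulo $\mathscr K_\Gamma$, and an operator in $\mathscr B_\Gamma$ is $\Gamma$-Fredholm if it is invertible modulo $\mathscr K_\Gamma$. For orthogonal projections $P,P'\in\mathscr B_\Gamma(\mathscr H)$ such that $PP':\operatorname{ran}P'\to\operatorname{ran}P$ is $\Gamma$-Fredholm (a $\Gamma$-Fredholm pair) put $\operatorname{Ind}_\Gamma(P|P')=\dim_\Gamma(\ker (PP')\cap\operatorname{ran}P')-\dim_\Gamma(\ker (PP')^*\cap\operatorname{ran}P)$. Let $t_1<t_2$, $I=[t_1,t_2]$, let $\{\mathscr H(t)\}_{t\in I}$ be Hilbert $\Gamma$-modules,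 and for each $t\in I$ let $S_t$ be a $\Gamma$-equivariant self-adjoint operator in $\mathscr H(t)$ with dense domain $\mathscr D(t)$ that is $\Gamma$-Fredholm as an operator $\mathscr D(t)\to\mathscr H(t)$, where $\mathscr D(t)$ carries the graph inner product. The topology of the family is given by a trivialisation: unitary $\Gamma$-isomorphisms $T_t:\mathscr H(t)\to\mathscr H(t_1)$ with $T_t\mathscr D(t)=\mathscr D(t_1)$. An admissible evolution is a family of unitary $\Gamma$-isomorphisms $Q(\tau_2,\tau_1):\mathscr H(\tau_1)\to\mathscr H(\tau_2)$, $\tau_1,\tau_2\in I$, with $Q(\tau_1,\tau_2)=Q(\tau_2,\tau_1)^{-1}$ and $Q(\tau_2,\tau_1)\mathscr D(\tau_1)=\mathscr D(\tau_2)$, such that * $Q$ is continuous in both time entries: $(\tau_2,\tau_1)\mapsto T_{\tau_2}Q(\tau_2,\tau_1)T_{\tau_1}^{-1}$ is continuous for the operator norm of $\mathscr B(\mathscr D(t_1),\mathscr H(t_1))$; * the evolved operators $\hat S_t=Q(t_1,t)S_tQ(t,t_1)$ with domain $\mathscr D(t_1)$ depend continuously on $t\in I$ for the operator norm of $\mathscr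 B(\mathscr D(t_1),\mathscr H(t_1))$. Write $\hat P_{\ge0}(t)=\chi_{[0,\infty)}(\hat S_t)$. A subdivision $t_1=\tau_0<\dots<\tau_N=t_2$ is called fine for $\hat S$ if $\|\Pi_\Gamma(\hat P_{\ge0}(t))-\Pi_\Gamma(\hat P_{\ge0}(t'))\|<1$ for all $j$ and all $t,t'\in[\tau_{j-1},\tau_j]$. Then the $\Gamma$-spectral flow $$\operatorname{sf}_\Gamma\{S_t\}_{t\in I}:=\sum_{j=1}^N\operatorname{Ind}_\Gamma\bigl(\hat P_{\ge0}(\tau_{j-1})\,\big|\,\hat P_{\ge0}(\tau_j)\bigr)$$ is well defined and does not depend on the choice of the evolution: there is a real number $r$ such that for every admissible evolution $Q$, fine subdivisions for the evolved operators exist, and for every one of them consecutive projections $\hat P_{\ge0}(\tau_{j-1}),\hat P_{\ge0}(\tau_j)$ form a $\Gamma$-Fredholm pair and the sum above equals $r$. -/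

import Mathlib

open scoped ENNReal InnerProductSpace Topology

universe u v

noncomputable section

/-- A (projective) Hilbert `Γ`-module over the discrete group `Γ`: a complex Hilbert space with a
unitary left action `ρ` of `Γ`, together with a `Γ`-equivariant isometric embedding `J` into a free
Hilbert `Γ`-module `ℓ²(Γ) ⊗ ℓ²(ι) = ℓ²(Γ × ι)`, on which `Γ` acts by left translation of the first
variable. It is free if `J` can be taken onto. -/
structure HilbertModule (Γ : Type v) [Group Γ] where
  /-- the underlying Hilbert space -/
  carrier : Type u
  [normedAddCommGroup : NormedAddCommGroup carrier]
  [innerProductSpace : InnerProductSpace ℂ carrier]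
  [completeSpace : CompleteSpace carrier]
  /-- the unitary action of `Γ` -/
  ρ : Γ →* (carrier ≃ₗᵢ[ℂ] carrier)
  /-- the index set of an orthonormal basis of the multiplicity space -/
  ι : Type u
  /-- the embedding into a free Hilbert `Γ`-module -/
  J : carrier →ₗᵢ[ℂ] lp (fun _ : Γ × ι => ℂ) 2
  equivariant : ∀ (γ : Γ) (x : carrier) (g : Γ) (i : ι), J (ρ γ x) (g, i) = J x (γ⁻¹ * g, i)

namespace HilbertModule

variable {Γ : Type v} [Group Γ]

instance : CoeSort (HilbertModule.{u} Γ) (Type u) := ⟨HilbertModule.carrier⟩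

attribute [instance] HilbertModule.normedAddCommGroup HilbertModule.innerProductSpace
  HilbertModule.completeSpace

/-- A `Γ`-invariant closed subspace of a Hilbert `Γ`-module, as a Hilbert `Γ`-module. -/
abbrev restrict (H : HilbertModule.{u} Γ) (V : Submodule ℂ H) (hc : IsClosed (V : Set H))
    (hV : ∀ (γ : Γ) (x : H), x ∈ V → H.ρ γ x ∈ V) : HilbertModule.{u} Γ :=
  { carrier := V
    normedAddCommGroup := inferInstance
    innerProductSpace := inferInstance
    completeSpace := hc.completeSpace_coe
    ρ :=
      { toFun := fun γ =>
          { toFun := fun x => ⟨H.ρ γ x, hV γ x x.2⟩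
            invFun := fun x => ⟨H.ρ γ⁻¹ x, hV γ⁻¹ x x.2⟩
            map_add' := fun x y => by ext; simp
            map_smul' := fun c x => by ext; simp
            left_inv := fun x => by ext; simp
            right_inv := fun x => by ext; simp
            norm_map' := fun x => by
              change ‖H.ρ γ (x : H)‖ = ‖(x : H)‖
              simp }
        map_one' := by ext x; simp
        map_mul' := fun γ γ' => by ext x; simp }
    ι := H.ι
    J := H.J.comp V.subtypeₗᵢ
    equivariant := fun γ x g i => H.equivariant γ x g i }

/-- Gluing two families along `ι ⊕ κ`. -/
def sumCoord {Γ : Type v} {ι κ : Type u} (f : Γ × ι → ℂ) (g : Γ × κ → ℂ) : Γ × (ι ⊕ κ) → ℂ :=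
  fun p => Sum.elim (fun i => f (p.1, i)) (fun k => g (p.1, k)) p.2

theorem hasSum_sumCoord {Γ : Type v} {ι κ : Type u} (f : lp (fun _ : Γ × ι => ℂ) 2)
    (g : lp (fun _ : Γ × κ => ℂ) 2) :
    HasSum (fun p => ‖sumCoord (fun q => f q) (fun q => g q) p‖ ^ (2 : ℝ≥0∞).toReal)
      (‖f‖ ^ (2 : ℝ≥0∞).toReal + ‖g‖ ^ (2 : ℝ≥0∞).toReal) := by
  have hf := lp.hasSum_norm (p := 2) (by simp) f
  have hg := lp.hasSum_norm (p := 2) (by simp) g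
  rw [← (Equiv.prodSumDistrib Γ ι κ).symm.hasSum_iff]
  exact HasSum.sum (f := (fun p => ‖sumCoord (fun q => f q) (fun q => g q) p‖ ^
    (2 : ℝ≥0∞).toReal) ∘ (Equiv.prodSumDistrib Γ ι κ).symm) hf hg

/-- The orthogonal direct sum of two Hilbert `Γ`-modules. -/
abbrev prod (H K : HilbertModule.{u} Γ) : HilbertModule.{u} Γ :=
  { carrier := WithLp 2 (H × K)
    normedAddCommGroup := inferInstance
    innerProductSpace := inferInstance
    completeSpace := inferInstance
    ρ :=
      { toFun := fun γ =>
          { toFun := fun x => WithLp.toLp 2 (H.ρ γ x.fst, K.ρ γ x.snd)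
            invFun := fun x => WithLp.toLp 2 (H.ρ γ⁻¹ x.fst, K.ρ γ⁻¹ x.snd)
            map_add' := fun x y => by simp [← WithLp.toLp_add]
            map_smul' := fun c x => by simp [← WithLp.toLp_smul]
            left_inv := fun x => by simp; rfl
            right_inv := fun x => by simp; rfl
            norm_map' := fun x => by
              rw [← sq_eq_sq₀ (norm_nonneg _) (norm_nonneg _), WithLp.prod_norm_sq_eq_of_L2,
                WithLp.prod_norm_sq_eq_of_L2]
              change ‖H.ρ γ x.fst‖ ^ 2 + ‖K.ρ γ x.snd‖ ^ 2 = _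
              simp }
        map_one' := by ext x; simp; rfl
        map_mul' := fun γ γ' => by ext x; simp; rfl }
    ι := H.ι ⊕ K.ι
    J :=
      { toFun := fun x => ⟨sumCoord (fun q => H.J x.fst q) (fun q => K.J x.snd q),
          memℓp_gen (hasSum_sumCoord (H.J x.fst) (K.J x.snd)).summable⟩
        map_add' := fun x y => by
          ext ⟨g, i | i⟩
          · exact congrFun (congrArg Subtype.val (H.J.map_add x.fst y.fst)) (g, i)
          · exact congrFun (congrArg Subtype.val (K.J.map_add x.snd y.snd)) (g, i)
        map_smul' := fun c x => by
          ext ⟨g, i | i⟩ <;> simp [sumCoord]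
        norm_map' := fun x => by
          rw [← sq_eq_sq₀ (norm_nonneg _) (norm_nonneg _)]
          have h := (lp.hasSum_norm (p := 2) (by simp)
            (⟨sumCoord (fun q => H.J x.fst q) (fun q => K.J x.snd q),
              memℓp_gen (hasSum_sumCoord (H.J x.fst) (K.J x.snd)).summable⟩ :
              lp (fun _ : Γ × (H.ι ⊕ K.ι) => ℂ) 2)).unique
              (hasSum_sumCoord (H.J x.fst) (K.J x.snd))
          rw [WithLp.prod_norm_sq_eq_of_L2]
          simpa using h }
    equivariant := fun γ x g i => by
      rcases i with i | i
      · exact H.equivariant γ x.fst g i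
      · exact K.equivariant γ x.snd g i }

/-- A `Γ`-equivariant bounded operator, i.e. an element of `B_Γ(H, K)`. -/
def IsEquivariant {H K : HilbertModule.{u} Γ} (A : H →L[ℂ] K) : Prop :=
  ∀ (γ : Γ) (x : H), A (H.ρ γ x) = K.ρ γ (A x)

open Classical in
/-- The `Γ`-dimension of (the closure of) a `Γ`-invariant subspace `V`, i.e. the `Γ`-trace of the
orthogonal projection onto it: with `e = 1 ∈ Γ` and `δ_{(e,i)}` the standard basis vectors,
`dim_Γ V = ∑ᵢ ⟪P δ_{(e,i)}, δ_{(e,i)}⟫ = ∑ᵢ ‖P δ_{(e,i)}‖²`, where `P = J P_V J†` is the orthogonal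
projection of the free module onto `J V`. -/
def gammaDim (H : HilbertModule.{u} Γ) (V : Submodule ℂ H) : ℝ≥0∞ :=
  ∑' i : H.ι, ENNReal.ofReal
    (‖V.topologicalClosure.starProjection
      (H.J.toContinuousLinearMap.adjoint (lp.single 2 ((1 : Γ), i) (1 : ℂ)))‖ ^ 2)

/-- The set `K_Γ(H, K)` of `Γ`-compact operators: the norm closure of the `Γ`-equivariant bounded
operators whose range has finite `Γ`-dimension. -/
def gammaCompact (H K : HilbertModule.{u} Γ) : Set (H →L[ℂ] K) :=
  closure {F | IsEquivariant F ∧ K.gammaDim F.range ≠ ⊤}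

/-- A bounded operator is `Γ`-Fredholm if it is `Γ`-equivariant and invertible modulo `Γ`-compact
operators. -/
def IsGammaFredholm {H K : HilbertModule.{u} Γ} (A : H →L[ℂ] K) : Prop :=
  IsEquivariant A ∧ ∃ B : K →L[ℂ] H, IsEquivariant B ∧
    B ∘L A - ContinuousLinearMap.id ℂ H ∈ gammaCompact H H ∧
    A ∘L B - ContinuousLinearMap.id ℂ K ∈ gammaCompact K K

/-- The quotient norm of the class of `A` in the `Γ`-Calkin algebra `B_Γ(H) / K_Γ(H)`. -/
def calkinNorm {H : HilbertModule.{u} Γ} (A : H →L[ℂ] H) : ℝ :=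
  Metric.infDist A (gammaCompact H H)

/-- `(P, Q)` is a `Γ`-Fredholm pair of orthogonal projections in `B_Γ(H)`: the operator
`PQ : ran Q → ran P` is invertible modulo `Γ`-compact operators. Operators `ran P → ran Q` are
identified with operators `B` on `H` such that `B = Q B P`, so that the identities of `ran Q` and
`ran P` become `Q` and `P`. -/
def IsFredholmPair {H : HilbertModule.{u} Γ} (P Q : H →L[ℂ] H) : Prop :=
  IsEquivariant P ∧ IsEquivariant Q ∧ IsStarProjection P ∧ IsStarProjection Q ∧
    ∃ B : H →L[ℂ] H, IsEquivariant B ∧ B = Q * B * P ∧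
      B * (P * Q) - Q ∈ gammaCompact H H ∧ (P * Q) * B - P ∈ gammaCompact H H

/-- The relative index `Ind_Γ(P | Q)` of a `Γ`-Fredholm pair, i.e. the `Γ`-index of
`A = PQ : ran Q → ran P`: `dim_Γ (ker A ∩ ran Q) - dim_Γ (ker A† ∩ ran P)`. -/
def relIndex {H : HilbertModule.{u} Γ} (P Q : H →L[ℂ] H) : ℝ :=
  (H.gammaDim ((P * Q).ker ⊓ Q.range)).toReal -
    (H.gammaDim ((P * Q).adjoint.ker ⊓ P.range)).toReal

/-! ### Unbounded operators -/

/-- The graph of an unbounded operator, inside the Hilbert space direct sum `H ⊕ H`. -/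
def graphSubmodule {H : HilbertModule.{u} Γ} (S : H →ₗ.[ℂ] H) : Submodule ℂ (H.prod H) :=
  S.graph.comap (WithLp.linearEquiv 2 ℂ (H × H)).toLinearMap

/-- A (not necessarily bounded) operator commutes with the action of `Γ`: its domain is
`Γ`-invariant and `S (γ x) = γ (S x)` on it. -/
def IsEquivariantPMap {H : HilbertModule.{u} Γ} (S : H →ₗ.[ℂ] H) : Prop :=
  ∀ (γ : Γ) (x : S.domain), ∃ h : H.ρ γ x ∈ S.domain, S ⟨H.ρ γ x, h⟩ = H.ρ γ (S x)

theorem isClosed_graphSubmodule {H : HilbertModule.{u} Γ} {S : H →ₗ.[ℂ] H} (hS : S.IsClosed) :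
    IsClosed (graphSubmodule S : Set (H.prod H)) :=
  IsClosed.preimage (WithLp.prod_continuous_ofLp 2 H H) hS

theorem graphSubmodule_invariant {H : HilbertModule.{u} Γ} {S : H →ₗ.[ℂ] H}
    (hS : IsEquivariantPMap S) (γ : Γ) (x : H.prod H) (hx : x ∈ graphSubmodule S) :
    (H.prod H).ρ γ x ∈ graphSubmodule S := by
  obtain ⟨y, hy1, hy2⟩ := (LinearPMap.mem_graph_iff S).1 hx
  obtain ⟨h, hh⟩ := hS γ y
  refine (LinearPMap.mem_graph_iff S).2 ⟨⟨_, h⟩, ?_, ?_⟩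
  · exact congrArg (H.ρ γ) hy1
  · exact hh.trans (congrArg (H.ρ γ) hy2)

/-- The domain of a closed `Γ`-equivariant operator `S` with the graph inner product
`⟪x, y⟫ + ⟪S x, S y⟫`, as a Hilbert `Γ`-module; a vector `x` of the domain is represented by the
point `(x, S x)` of the graph. -/
def domainModule {H : HilbertModule.{u} Γ} (S : H →ₗ.[ℂ] H) (hc : S.IsClosed)
    (hS : IsEquivariantPMap S) : HilbertModule.{u} Γ :=
  (H.prod H).restrict (graphSubmodule S) (isClosed_graphSubmodule hc) (graphSubmodule_invariant hS)

/-- The operator `S`, as the bounded operator `x ↦ S x` from its domain, with the graph inner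
product, to `H`. -/
def ofDomain {H : HilbertModule.{u} Γ} (S : H →ₗ.[ℂ] H) (hc : S.IsClosed)
    (hS : IsEquivariantPMap S) : domainModule S hc hS →L[ℂ] H :=
  (WithLp.sndL 2 ℂ H H) ∘L (graphSubmodule S).subtypeL

/-- `S` is a densely defined self-adjoint `Γ`-Fredholm operator in the Hilbert `Γ`-module `H`:
it commutes with `Γ`, and it is `Γ`-Fredholm as a bounded operator from its domain to `H`. -/
def IsSelfAdjointGammaFredholm {H : HilbertModule.{u} Γ} (S : H →ₗ.[ℂ] H) : Prop :=
  Dense (S.domain : Set H) ∧ ∃ (hsa : IsSelfAdjoint S) (hS : IsEquivariantPMap S),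
    IsGammaFredholm (ofDomain S hsa.isClosed hS)

/-- The bounded operator `S (1 + S²)⁻¹`, for a self-adjoint operator `S`: the lower left block of
the orthogonal projection of `H ⊕ H` onto the graph of `S`, which sends `(x, 0)` to
`((1 + S²)⁻¹ x, S (1 + S²)⁻¹ x)`. -/
def gapTransform {H : HilbertModule.{u} Γ} (S : H →ₗ.[ℂ] H) : H →L[ℂ] H :=
  (WithLp.sndL 2 ℂ H H) ∘L (graphSubmodule S).topologicalClosure.starProjection ∘L
    (WithLp.prodContinuousLinearEquiv 2 ℂ H H).symm.toContinuousLinearMap ∘L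
      (ContinuousLinearMap.inl ℂ H H)

/-- The spectral projection `P_{≥ 0} = χ_{[0, ∞)}(S)` of a self-adjoint operator `S`. As
`λ` and `λ / (1 + λ²)` have the same sign, it equals `χ_{[0, ∞)}(S (1 + S²)⁻¹)`, which is the
orthogonal projection onto the kernel of the negative part of the bounded self-adjoint operator
`S (1 + S²)⁻¹`. -/
def nonnegProjection {H : HilbertModule.{u} Γ} (S : H →ₗ.[ℂ] H) : H →L[ℂ] H :=
  ((gapTransform S)⁻ : H →L[ℂ] H).ker.topologicalClosure.starProjection

/-! ### The spectral flow of a path of operators in a fixed Hilbert `Γ`-module -/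

/-- A subdivision `t₁ = τ₀ < τ₁ < ⋯ < τ_N = t₂` that is fine enough for the path of operators `S`:
within each `[τ_{j-1}, τ_j]` the projections `P_{≥ 0}(t)` differ by less than `1` in the `Γ`-Calkin
algebra. -/
structure IsFineSubdivision {t₁ t₂ : ℝ} {H : HilbertModule.{u} Γ}
    (S : Set.Icc t₁ t₂ → H →ₗ.[ℂ] H) (N : ℕ) (τ : Fin (N + 1) → Set.Icc t₁ t₂) : Prop where
  strictMono : StrictMono τ
  first : (τ 0 : ℝ) = t₁
  last : (τ (Fin.last N) : ℝ) = t₂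
  fine : ∀ j : Fin N, ∀ t ∈ Set.Icc (τ j.castSucc) (τ j.succ),
    ∀ t' ∈ Set.Icc (τ j.castSucc) (τ j.succ),
      calkinNorm (nonnegProjection (S t) - nonnegProjection (S t')) < 1

/-- The path `S` has `Γ`-spectral flow `r`: fine enough subdivisions exist, and for each of them the
projections at consecutive points are `Γ`-Fredholm pairs whose relative indices sum up to `r`. -/
def HasSpectralFlow {t₁ t₂ : ℝ} {H : HilbertModule.{u} Γ}
    (S : Set.Icc t₁ t₂ → H →ₗ.[ℂ] H) (r : ℝ) : Prop :=
  (∃ (N : ℕ) (τ : Fin (N + 1) → Set.Icc t₁ t₂), IsFineSubdivision S N τ) ∧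
  ∀ (N : ℕ) (τ : Fin (N + 1) → Set.Icc t₁ t₂), IsFineSubdivision S N τ →
    (∀ j : Fin N, IsFredholmPair (nonnegProjection (S (τ j.castSucc)))
      (nonnegProjection (S (τ j.succ)))) ∧
    ∑ j : Fin N, relIndex (nonnegProjection (S (τ j.castSucc)))
      (nonnegProjection (S (τ j.succ))) = r

/-! ### Variable Hilbert `Γ`-modules -/

/-- A family `F` of linear maps `D → H`, where `D` is the domain of the closed operator `S₀` with
the graph norm `‖x‖ + ‖S₀ x‖`, is continuous for the operator norm of maps `D → H`. -/
def ContinuousOnDomain {X : Type*} [TopologicalSpace X] {H : HilbertModule.{u} Γ}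
    (S₀ : H →ₗ.[ℂ] H) (F : X → S₀.domain →ₗ[ℂ] H) : Prop :=
  ∀ x₀ : X, ∀ ε > (0 : ℝ), ∀ᶠ x in 𝓝 x₀, ∀ v : S₀.domain,
    ‖F x v - F x₀ v‖ ≤ ε * (‖(v : H)‖ + ‖S₀ v‖)

/-- A unitary `Γ`-isomorphism `H → K` that maps the domain of `S` onto the domain of `S'`. -/
structure DomainIso {H K : HilbertModule.{u} Γ} (S : H →ₗ.[ℂ] H) (S' : K →ₗ.[ℂ] K) where
  /-- the unitary isomorphism -/
  toIso : H ≃ₗᵢ[ℂ] K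
  equivariant : ∀ (γ : Γ) (x : H), toIso (H.ρ γ x) = K.ρ γ (toIso x)
  mem_domain : ∀ x : H, toIso x ∈ S'.domain ↔ x ∈ S.domain

/-- The operator `Q⁻¹ S' Q` with domain `D(S)`, for a `Γ`-isomorphism `Q` that maps `D(S)` onto
`D(S')`. -/
def DomainIso.pullback {H K : HilbertModule.{u} Γ} {S : H →ₗ.[ℂ] H} {S' : K →ₗ.[ℂ] K}
    (Q : DomainIso S S') : H →ₗ.[ℂ] H where
  domain := S.domain
  toFun := Q.toIso.symm.toLinearEquiv.toLinearMap ∘ₗ S'.toFun ∘ₗ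
    (Q.toIso.toLinearEquiv.toLinearMap.restrict fun x hx => (Q.mem_domain x).2 hx)

section Variable

variable {t₁ t₂ : ℝ} {H : Set.Icc t₁ t₂ → HilbertModule.{u} Γ}

/-- A family of evolution operators for the family `S`: unitary `Γ`-isomorphisms
`Q(τ₂, τ₁) : H(τ₁) → H(τ₂)` that map `D(τ₁)` onto `D(τ₂)`, with `Q(τ₁, τ₂) = Q(τ₂, τ₁)⁻¹`. -/
structure Evolution (S : ∀ t, H t →ₗ.[ℂ] H t) where
  /-- the operator `Q(τ₂, τ₁)` -/
  Q : ∀ τ₂ τ₁ : Set.Icc t₁ t₂, DomainIso (S τ₁) (S τ₂)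
  symm : ∀ τ₂ τ₁, (Q τ₁ τ₂).toIso = (Q τ₂ τ₁).toIso.symm

/-- The map `T_{τ₂} Q(τ₂, τ₁) T_{τ₁}⁻¹` on `D(b)`: the operator `Q(τ₂, τ₁)`, read in the
trivialisation `T` of the family `H` with model fibre `H b`. -/
def Evolution.inTrivialisation {S : ∀ t, H t →ₗ.[ℂ] H t} (E : Evolution S) {b : Set.Icc t₁ t₂}
    (T : ∀ t, DomainIso (S t) (S b)) (p : Set.Icc t₁ t₂ × Set.Icc t₁ t₂) :
    (S b).domain →ₗ[ℂ] H b :=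
  ((T p.2).toIso.symm.trans ((E.Q p.1 p.2).toIso.trans
    (T p.1).toIso)).toLinearEquiv.toLinearMap ∘ₗ (S b).domain.subtype

/-- The evolved operator `Ŝ_t = Q(b, t) S_t Q(t, b)` in `H(b)`, with domain `D(b)`. -/
def Evolution.evolved {S : ∀ t, H t →ₗ.[ℂ] H t} (E : Evolution S) (b t : Set.Icc t₁ t₂) :
    H b →ₗ.[ℂ] H b :=
  (E.Q t b).pullback

end Variable

end HilbertModule

end

noncomputable section

namespace HilbertModule

/-! ### Quadratic forms, spectral projections and a Lyapunov estimate. -/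

section Hilbert

variable {E : Type*} [NormedAddCommGroup E] [InnerProductSpace ℂ E] [CompleteSpace E]

/-! Write `P_t` for the nonnegative spectral projection of the evolved operator. Its class modulo
Γ-compact operators depends continuously on `t` (`Evolution.isCalkinPath`), and the relative index
is additive, `Ind(P|R) = Ind(P|Q) + Ind(Q|R)`, if `P`, `Q` have Calkin distance below 1 and `R` is
close enough to `Q` (`relIndex_add`). So there is a function `F` of `t` whose local increments are
relative indices (`IsCalkinPath.exists_isIndexPrimitive`). On a fine subdivision every summand is an
increment of `F`, and the sum telescopes to `F(t₂) - F(t₁)`.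

Two evolutions differ by the unitaries `w_t = Q(t,b)⁻¹ Q'(t,b)`: the second evolved operator is the
first one conjugated by `w_t`. It suffices that one `F` serves both, i.e. that the local indices
agree (`Evolution.eventually_relIndex_eq`). Insert `w_t* P_{t₀} w_t` between `P'_{t₀} = w_{t₀}*
P_{t₀} w_{t₀}` and `P'_t = w_t* P_t w_t`. The second half of the way has index `Ind(P_{t₀}|P_t)` by
unitary invariance. The first half has norm length below 1, hence index 0. This last point is
delicate, because `w_t` is continuous only as a map from the domain
(`norm_conj_nonnegProjection_sub_le`).

Both continuity statements split the spectrum at a neighbourhood of 0 with spectral projection `e`.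
Away from 0, positive spectral vectors of `S` and negative ones of a relatively ε-close `S'` are
nearly orthogonal: their compression `X` solves a Sylvester equation `aX + Xb = aZ` with `a, b ≥ 0`
whose right side is small relative to `a` on the left and to `b` on the right, and this forces `‖X‖
≤ ε/2` (`norm_le_of_sylvester`). Near 0, `e` is Γ-compact by the Fredholm property, which settles
continuity in the Calkin algebra; and `ran e` lies in the domain with `S e` bounded, which settles
the conjugation by `w_t`.

The index theory rests on the trace formula `Ind A = Tr(Q - BA) - Tr(P - AB)` for a parametrix `B`
modulo trace class (`IsParametrix.cornerIndex_eq`). It does not need closed range, and it reduces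
additivity, stability and unitary invariance to cyclicity of the Γ-trace. -/

theorem nonneg_of_forall_re_inner_nonneg {A : E →L[ℂ] E} (hA : IsSelfAdjoint A)
    (h : ∀ x, 0 ≤ (⟪A x, x⟫_ℂ).re) : 0 ≤ A :=
  (ContinuousLinearMap.nonneg_iff_isPositive A).2
    ((ContinuousLinearMap.isPositive_def').2 ⟨hA, h⟩)

theorem re_inner_nonneg_of_nonneg {A : E →L[ℂ] E} (hA : 0 ≤ A) (x : E) :
    0 ≤ (⟪A x, x⟫_ℂ).re :=
  ((ContinuousLinearMap.nonneg_iff_isPositive A).1 hA).re_inner_nonneg_left x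

theorem inner_apply_comm {A : E →L[ℂ] E} (hA : IsSelfAdjoint A) (x y : E) :
    ⟪A x, y⟫_ℂ = ⟪x, A y⟫_ℂ :=
  hA.isSymmetric x y

/-- With `B = √A` the form is `‖B x‖²` and `‖A‖ = ‖B‖²`. This turns smallness of a nonnegative form
at a vector into smallness of the image vector. -/
theorem norm_sq_apply_le_of_nonneg {A : E →L[ℂ] E} (hA : 0 ≤ A) (x : E) :
    ‖A x‖ ^ 2 ≤ ‖A‖ * (⟪A x, x⟫_ℂ).re := by
  set B := CFC.sqrt A with hB
  have hBs : IsSelfAdjoint B := (CFC.sqrt_nonneg A).isSelfAdjoint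
  have hBB : B * B = A := CFC.sqrt_mul_sqrt_self A hA
  have h1 : ∀ y, A y = B (B y) := fun y => by rw [← hBB]; rfl
  have h2 : ‖A‖ = ‖B‖ * ‖B‖ := by
    rw [← hBB]
    conv_lhs => rw [← hBs.star_eq]
    rw [hBs.star_eq, ← CStarRing.norm_star_mul_self (x := B), hBs.star_eq]
  have h3 : (⟪A x, x⟫_ℂ).re = ‖B x‖ ^ 2 := by
    rw [h1, inner_apply_comm hBs, ← inner_self_eq_norm_sq (𝕜 := ℂ)]; rfl
  rw [h3, h2, h1]
  have := B.le_opNorm (B x)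
  calc ‖B (B x)‖ ^ 2 ≤ (‖B‖ * ‖B x‖) ^ 2 := by gcongr
    _ = _ := by ring

theorem apply_eq_zero_of_re_inner_eq_zero {A : E →L[ℂ] E} (hA : 0 ≤ A) {x : E}
    (h : (⟪A x, x⟫_ℂ).re = 0) : A x = 0 := by
  have := norm_sq_apply_le_of_nonneg hA x
  rw [h, mul_zero] at this
  simpa using le_antisymm this (sq_nonneg _)

/-- A self-adjoint operator whose quadratic form takes a positive value has a positive approximate
eigenvalue. -/
theorem exists_approx_eigenvector {M : E →L[ℂ] E} (hM : IsSelfAdjoint M) {v₀ : E}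
    (hv₀ : 0 < (⟪M v₀, v₀⟫_ℂ).re) :
    ∃ m : ℝ, 0 < m ∧ ∀ κ > (0 : ℝ), ∃ v : E, ‖v‖ = 1 ∧ ‖M v - (m : ℂ) • v‖ ≤ κ := by
  set s : Set ℝ := {r | ∃ v : E, ‖v‖ = 1 ∧ (⟪M v, v⟫_ℂ).re = r} with hs
  have hbdd : BddAbove s := by
    refine ⟨‖M‖, ?_⟩
    rintro r ⟨v, hv, rfl⟩
    calc (⟪M v, v⟫_ℂ).re ≤ ‖⟪M v, v⟫_ℂ‖ := Complex.re_le_norm _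
      _ ≤ ‖M v‖ * ‖v‖ := norm_inner_le_norm _ _
      _ ≤ ‖M‖ := by simpa [hv] using M.le_opNorm v
  have hscale : ∀ v : E, (⟪M v, v⟫_ℂ).re ≤ sSup s * ‖v‖ ^ 2 := by
    intro v
    rcases eq_or_ne v 0 with rfl | hv
    · simp
    have hn : (0 : ℝ) < ‖v‖ := norm_pos_iff.2 hv
    have h1 : (⟪M (((‖v‖⁻¹ : ℝ) : ℂ) • v), ((‖v‖⁻¹ : ℝ) : ℂ) • v⟫_ℂ).re ≤ sSup s := by
      refine le_csSup hbdd ⟨_, ?_, rfl⟩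
      rw [norm_smul, Complex.norm_real, norm_inv, norm_norm, inv_mul_cancel₀ hn.ne']
    rw [map_smul, inner_smul_left, inner_smul_right, Complex.conj_ofReal, ← mul_assoc,
      ← Complex.ofReal_mul, Complex.re_ofReal_mul] at h1
    have h2 := mul_le_mul_of_nonneg_right h1 (sq_nonneg ‖v‖)
    have h3 : ‖v‖⁻¹ * ‖v‖⁻¹ * (⟪M v, v⟫_ℂ).re * ‖v‖ ^ 2 = (⟪M v, v⟫_ℂ).re := by
      field_simp
    rwa [h3] at h2
  have hv0 : v₀ ≠ 0 := by rintro rfl; simp at hv₀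
  have hm : 0 < sSup s := by
    have h := hv₀.trans_le (hscale v₀)
    exact pos_of_mul_pos_left h (sq_nonneg _)
  have hne : s.Nonempty := by
    refine ⟨_, ((‖v₀‖⁻¹ : ℝ) : ℂ) • v₀, ?_, rfl⟩
    rw [norm_smul, Complex.norm_real, norm_inv, norm_norm, inv_mul_cancel₀ (norm_ne_zero_iff.2 hv0)]
  refine ⟨sSup s, hm, fun κ hκ => ?_⟩
  -- The eigenvalue is the top of the numerical range, so `N ≥ 0`; at a unit vector nearly attaining
  -- the supremum the form of `N` is small, hence so is `N v`.
  set N : E →L[ℂ] E := ((sSup s : ℝ) : ℂ) • (1 : E →L[ℂ] E) - M with hN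
  have hNs : IsSelfAdjoint N :=
    (IsSelfAdjoint.smul (by simp [isSelfAdjoint_iff]) (IsSelfAdjoint.one _)).sub hM
  have hNform : ∀ v, (⟪N v, v⟫_ℂ).re = sSup s * ‖v‖ ^ 2 - (⟪M v, v⟫_ℂ).re := by
    intro v
    have : N v = ((sSup s : ℝ) : ℂ) • v - M v := rfl
    rw [this, inner_sub_left, inner_smul_left, Complex.conj_ofReal, Complex.sub_re,
      Complex.re_ofReal_mul]
    congr 2
    exact inner_self_eq_norm_sq (𝕜 := ℂ) v
  have hNpos : 0 ≤ N := nonneg_of_forall_re_inner_nonneg hNs fun v => by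
    rw [hNform]; linarith [hscale v]
  obtain ⟨r, ⟨v, hv, rfl⟩, hr⟩ := exists_lt_of_lt_csSup hne
    (show sSup s - κ ^ 2 / (‖N‖ + 1) < sSup s by
      have : 0 < κ ^ 2 / (‖N‖ + 1) := by positivity
      linarith)
  refine ⟨v, hv, ?_⟩
  have h1 := norm_sq_apply_le_of_nonneg hNpos v
  rw [hNform, hv] at h1
  have h2 : ‖N‖ * (sSup s * 1 ^ 2 - (⟪M v, v⟫_ℂ).re) ≤ κ ^ 2 := by
    calc _ ≤ ‖N‖ * (κ ^ 2 / (‖N‖ + 1)) := by gcongr; linarith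
      _ = κ ^ 2 * (‖N‖ / (‖N‖ + 1)) := by ring
      _ ≤ κ ^ 2 * 1 := by
        gcongr
        rw [div_le_one (by positivity)]; linarith
      _ = κ ^ 2 := mul_one _
  have h3 : ‖M v - ((sSup s : ℝ) : ℂ) • v‖ = ‖N v‖ := by
    rw [← norm_neg]; congr 1; simp [hN]
  rw [h3]
  exact le_of_sq_le_sq (h1.trans h2) hκ.le

/-- If `W ≥ 0` and `Z` is symmetric for the form of `W`, then `W Z ≤ ‖Z‖ W`. -/
theorem re_inner_mul_le {W Z : E →L[ℂ] E} (hW : 0 ≤ W) (hWZ : IsSelfAdjoint (W * Z)) {ε : ℝ}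
    (hZ : ‖Z‖ ≤ ε) (v : E) : (⟪W (Z v), v⟫_ℂ).re ≤ ε * (⟪W v, v⟫_ℂ).re := by
  have hε : 0 ≤ ε := (norm_nonneg _).trans hZ
  have hWs : IsSelfAdjoint W := hW.isSelfAdjoint
  -- Otherwise `W Z - ε W` has an approximate eigenvector `u` with eigenvalue `m > 0`, so `W Z u` is
  -- close to `ε W u + m u`. But `W Z = Z* W` gives `‖W Z u‖ ≤ ε ‖W u‖`, while the cross term in `‖ε
  -- W u + m u‖²` is nonnegative; this bounds `m²` by a multiple of `κ`.
  by_contra! hlt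
  set M : E →L[ℂ] E := W * Z - (ε : ℂ) • W with hMdef
  have hM : IsSelfAdjoint M := hWZ.sub (IsSelfAdjoint.smul (by simp [isSelfAdjoint_iff]) hWs)
  have hv : 0 < (⟪M v, v⟫_ℂ).re := by
    have : M v = W (Z v) - (ε : ℂ) • W v := rfl
    rw [this, inner_sub_left, inner_smul_left, Complex.conj_ofReal, Complex.sub_re,
      Complex.re_ofReal_mul]
    linarith
  obtain ⟨m, hm, hex⟩ := exists_approx_eigenvector hM hv
  set κ : ℝ := min 1 (m ^ 2 / (2 * (2 * ε * ‖W‖ + 1))) with hκ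
  have hκpos : 0 < κ := lt_min one_pos (by positivity)
  obtain ⟨u, hu, hle⟩ := hex κ hκpos
  have hWZu : ‖W (Z u)‖ ≤ ε * ‖W u‖ := by
    have h1 : W (Z u) = (star Z) (W u) := by
      have : W * Z = star Z * W := by
        rw [← hWZ.star_eq, star_mul, hWs.star_eq]
      exact congrArg (fun A : E →L[ℂ] E => A u) this
    rw [h1]
    calc _ ≤ ‖star Z‖ * ‖W u‖ := (star Z).le_opNorm _
      _ ≤ _ := by rw [norm_star]; gcongr
  have hsum : ‖(ε : ℂ) • W u + (m : ℂ) • u‖ ≤ ε * ‖W u‖ + κ := by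
    have : (ε : ℂ) • W u + (m : ℂ) • u = W (Z u) - (M u - (m : ℂ) • u) := by
      change _ = W (Z u) - (W (Z u) - (ε : ℂ) • W u - (m : ℂ) • u)
      abel
    rw [this]
    exact (norm_sub_le _ _).trans (add_le_add hWZu hle)
  have hsq : ‖(ε : ℂ) • W u + (m : ℂ) • u‖ ^ 2 =
      ε ^ 2 * ‖W u‖ ^ 2 + 2 * (ε * (m * (⟪W u, u⟫_ℂ).re)) + m ^ 2 := by
    rw [norm_add_sq (𝕜 := ℂ), norm_smul, norm_smul, Complex.norm_real, Complex.norm_real, hu,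
      inner_smul_left, inner_smul_right, Complex.conj_ofReal]
    simp only [RCLike.re_to_complex, Complex.re_ofReal_mul, Real.norm_eq_abs]
    rw [abs_of_nonneg hε, abs_of_pos hm]; ring
  have hWu : ‖W u‖ ≤ ‖W‖ := by simpa [hu] using W.le_opNorm u
  have hpos : 0 ≤ ε * (m * (⟪W u, u⟫_ℂ).re) :=
    mul_nonneg hε (mul_nonneg hm.le (re_inner_nonneg_of_nonneg hW u))
  have h1 : ε ^ 2 * ‖W u‖ ^ 2 + m ^ 2 ≤ (ε * ‖W u‖ + κ) ^ 2 := by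
    have := pow_le_pow_left₀ (norm_nonneg _) hsum 2
    linarith
  have hκ1 : κ ≤ 1 := min_le_left _ _
  have h2 : m ^ 2 ≤ κ * (2 * ε * ‖W‖ + 1) := by
    have h3 : ε * ‖W u‖ ≤ ε * ‖W‖ := by gcongr
    nlinarith
  have h4 : κ * (2 * ε * ‖W‖ + 1) ≤ m ^ 2 / 2 := by
    calc _ ≤ m ^ 2 / (2 * (2 * ε * ‖W‖ + 1)) * (2 * ε * ‖W‖ + 1) := by
          gcongr; exact min_le_right _ _
      _ = m ^ 2 / 2 := by field_simp
  nlinarith [sq_pos_of_pos hm]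

/-- The spectral projection of a bounded self-adjoint operator for `[0, ∞)`. -/
def spectralProj (X : E →L[ℂ] E) : E →L[ℂ] E :=
  (X⁻ : E →L[ℂ] E).ker.topologicalClosure.starProjection

theorem isStarProjection_spectralProj (X : E →L[ℂ] E) : IsStarProjection (spectralProj X) :=
  isStarProjection_starProjection

theorem topologicalClosure_ker (N : E →L[ℂ] E) : N.ker.topologicalClosure = N.ker :=
  N.isClosed_ker.submodule_topologicalClosure_eq

/-- As `N` is self-adjoint, `Y*` commutes with `N` as well. So `Y` and `Y*` both preserve `ker N`,
and the subspace is reducing. -/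
theorem commute_starProjection_ker {N Y : E →L[ℂ] E} (hN : IsSelfAdjoint N) (h : Commute Y N) :
    Commute Y N.ker.topologicalClosure.starProjection := by
  have hmem : ∀ {Y : E →L[ℂ] E}, Commute Y N → ∀ x ∈ N.ker.topologicalClosure,
      Y x ∈ N.ker.topologicalClosure := by
    intro Y h x hx
    rw [topologicalClosure_ker] at hx ⊢
    have hx' : N x = 0 := hx
    have : N (Y x) = Y (N x) := congrArg (fun A : E →L[ℂ] E => A x) h.eq.symm
    rw [hx', map_zero] at this
    exact this
  have h' : Commute (star Y) N := by
    have := h.star_star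
    rwa [hN.star_eq] at this
  ext x
  change Y (N.ker.topologicalClosure.starProjection x) =
    N.ker.topologicalClosure.starProjection (Y x)
  refine (Submodule.eq_starProjection_of_mem_of_inner_eq_zero
    (hmem h _ (Submodule.starProjection_apply_mem _ _)) fun w hw => ?_).symm
  rw [← map_sub]
  have h1 : ⟪Y (x - N.ker.topologicalClosure.starProjection x), w⟫_ℂ =
      ⟪x - N.ker.topologicalClosure.starProjection x, star Y w⟫_ℂ := by
    rw [ContinuousLinearMap.star_eq_adjoint, ContinuousLinearMap.adjoint_inner_right]
  rw [h1]
  exact Submodule.starProjection_inner_eq_zero _ _ (hmem h' w hw)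

theorem commute_spectralProj {X Y : E →L[ℂ] E} (h : Commute Y X) :
    Commute Y (spectralProj X) :=
  commute_starProjection_ker (CFC.negPart_nonneg X).isSelfAdjoint
    (Commute.cfcₙ_real h.symm _).symm

theorem re_inner_nonneg_spectralProj {X : E →L[ℂ] E} (hX : IsSelfAdjoint X) {x : E}
    (hx : spectralProj X x = x) : 0 ≤ (⟪X x, x⟫_ℂ).re := by
  have h1 : (X⁻ : E →L[ℂ] E) x = 0 := by
    have : x ∈ (X⁻ : E →L[ℂ] E).ker.topologicalClosure := by
      rw [← hx]; exact Submodule.starProjection_apply_mem _ _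
    rwa [topologicalClosure_ker] at this
  have h2 : X x = (X⁺ : E →L[ℂ] E) x := by
    conv_lhs => rw [← CFC.posPart_sub_negPart X hX]
    simp [h1]
  rw [h2]
  exact re_inner_nonneg_of_nonneg (CFC.posPart_nonneg X) x

/-- Since `X⁻ X⁺ = 0`, the range of `X⁺` lies in `ker X⁻`, to which `x` is orthogonal; hence `‖X⁺
x‖² = ⟪x, X⁺ X⁺ x⟫ = 0`. -/
theorem re_inner_nonpos_spectralProj {X : E →L[ℂ] E} (hX : IsSelfAdjoint X) {x : E}
    (hx : spectralProj X x = 0) : (⟪X x, x⟫_ℂ).re ≤ 0 := by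
  set N : E →L[ℂ] E := X⁻ with hN
  set Q : E →L[ℂ] E := X⁺ with hQ
  have hNs : IsSelfAdjoint N := (CFC.negPart_nonneg X).isSelfAdjoint
  have hQs : IsSelfAdjoint Q := (CFC.posPart_nonneg X).isSelfAdjoint
  have horth : ∀ w ∈ N.ker, ⟪x, w⟫_ℂ = 0 := by
    intro w hw
    have h0 : N.ker.topologicalClosure.starProjection x = 0 := hx
    have := Submodule.starProjection_inner_eq_zero (K := N.ker.topologicalClosure) x w
      (N.ker.le_topologicalClosure hw)
    rwa [h0, sub_zero] at this
  have h1 : Q x = 0 := by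
    have hQQ : N (Q (Q x)) = 0 := by
      have : N * Q = 0 := CFC.negPart_mul_posPart X
      exact congrArg (fun A : E →L[ℂ] E => A (Q x)) this
    have h2 : ⟪Q x, Q x⟫_ℂ = 0 := by
      rw [inner_apply_comm hQs]; exact horth _ hQQ
    exact inner_self_eq_zero.1 h2
  have h2 : X x = -N x := by
    conv_lhs => rw [← CFC.posPart_sub_negPart X hX]
    change Q x - N x = _
    rw [h1, zero_sub]
  rw [h2, inner_neg_left, Complex.neg_re]
  linarith [re_inner_nonneg_of_nonneg (CFC.negPart_nonneg X) x]

/-- Lyapunov-type estimate: if `W X + X W ≤ ε W` for some `W ≥ 0` which is injective on the range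
of `X`, then `X ≤ ε / 2`. -/
theorem re_inner_le_of_lyapunov {W X : E →L[ℂ] E} (hW : 0 ≤ W) (hX : IsSelfAdjoint X) {ε : ℝ}
    (hε : 0 ≤ ε) (h : ∀ v, 2 * (⟪W (X v), v⟫_ℂ).re ≤ ε * (⟪W v, v⟫_ℂ).re)
    (hinj : ∀ v, W (X v) = 0 → X v = 0) {ε' : ℝ} (hε' : ε / 2 < ε') (v : E) :
    (⟪X v, v⟫_ℂ).re ≤ ε' * ‖v‖ ^ 2 := by
  have hWs : IsSelfAdjoint W := hW.isSelfAdjoint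
  set Y : E →L[ℂ] E := (ε' : ℂ) • (1 : E →L[ℂ] E) - X with hY
  have hYs : IsSelfAdjoint Y :=
    (IsSelfAdjoint.smul (by simp [isSelfAdjoint_iff]) (IsSelfAdjoint.one _)).sub hX
  have hYform : ∀ v, (⟪Y v, v⟫_ℂ).re = ε' * ‖v‖ ^ 2 - (⟪X v, v⟫_ℂ).re := by
    intro v
    have : Y v = (ε' : ℂ) • v - X v := rfl
    rw [this, inner_sub_left, inner_smul_left, Complex.conj_ofReal, Complex.sub_re,
      Complex.re_ofReal_mul]
    congr 2
    exact inner_self_eq_norm_sq (𝕜 := ℂ) v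
  set p := spectralProj Y with hp
  have hps : IsStarProjection p := isStarProjection_spectralProj Y
  have hpX : Commute X p := commute_spectralProj (by
    rw [hY]; exact (((Commute.one_right X).smul_right _).sub_right (Commute.refl X)))
  have hpp : ∀ x, p (p x) = p x := fun x =>
    congrArg (fun A : E →L[ℂ] E => A x) hps.isIdempotentElem
  -- `ran e` is the spectral subspace where `X > ε'`. The form of `W` will be shown to vanish on it;
  -- injectivity of `W` on `ran X` then makes the subspace trivial.
  set e : E →L[ℂ] E := 1 - p with he
  have hes : IsSelfAdjoint e := (IsSelfAdjoint.one _).sub hps.isSelfAdjoint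
  have hpe : ∀ x, p (e x) = 0 := fun x => by simp [he, hpp]
  have hee : ∀ x, e (e x) = e x := fun x => by
    change e x - p (e x) = _
    rw [hpe, sub_zero]
  have heX : ∀ x, X (e x) = e (X x) := fun x => by
    have : X (p x) = p (X x) := congrArg (fun A : E →L[ℂ] E => A x) hpX.eq
    simp [he, this]
  have hXe : ∀ x, ε' * ‖e x‖ ^ 2 ≤ (⟪X (e x), e x⟫_ℂ).re := fun x => by
    have := re_inner_nonpos_spectralProj hYs (hpe x)
    rw [hYform] at this; linarith
  set w : E →L[ℂ] E := e * W * e with hw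
  have hws : IsSelfAdjoint w := by
    rw [isSelfAdjoint_iff, hw, star_mul, star_mul, hes.star_eq, hWs.star_eq, mul_assoc]
  have hwform : ∀ x, (⟪w x, x⟫_ℂ).re = (⟪W (e x), e x⟫_ℂ).re := fun x => by
    have : w x = e (W (e x)) := rfl
    rw [this, inner_apply_comm hes]
  have hwzero : ∀ x, (⟪W (e x), e x⟫_ℂ).re = 0 := by
    intro x
    by_contra hne
    have hpos : 0 < (⟪w x, x⟫_ℂ).re := by
      rw [hwform]
      exact lt_of_le_of_ne (re_inner_nonneg_of_nonneg hW _) (Ne.symm hne)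
    obtain ⟨m, hm, hex⟩ := exists_approx_eigenvector hws hpos
    set η : ℝ := ε' - ε / 2 with hη
    have hηpos : 0 < η := sub_pos.2 hε'
    set c : ℝ := ‖X‖ + ε / 2 with hc
    have hcpos : 0 ≤ c := by positivity
    -- The first bound forces `‖e q‖ ≥ 1/2`; the second makes `c κ ≤ m η / 8`, below the lower bound
    -- `m η / 4` for `m ⟪y, q⟫`.
    set κ : ℝ := min (m / 2) (m * η / (8 * (c + 1))) with hκ
    have hκpos : 0 < κ := lt_min (by positivity) (by positivity)
    obtain ⟨q, hq, hqle⟩ := hex κ hκpos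
    -- The Lyapunov hypothesis at `e q` says `⟪y, w q⟫ ≤ 0`. Replacing `w q` by the nearby `m q`
    -- gives instead about `m ⟪y, q⟫ ≥ m η ‖e q‖²`, a contradiction.
    set y : E := X (e q) - ((ε / 2 : ℝ) : ℂ) • e q with hy
    have hey : e y = y := by
      rw [hy, map_sub, map_smul, ← heX, hee]
    have heq : ‖e q‖ ≤ 1 := by
      have h1 : ‖e q‖ ^ 2 ≤ ‖e q‖ * ‖q‖ := by
        have h2 : ‖e q‖ ^ 2 = (⟪e q, q⟫_ℂ).re := by
          rw [← hee q, inner_apply_comm hes, hee, ← inner_self_eq_norm_sq (𝕜 := ℂ)]; rfl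
        rw [h2]
        exact (Complex.re_le_norm _).trans (norm_inner_le_norm _ _)
      rw [hq, mul_one] at h1
      by_contra! h3
      nlinarith
    have hynorm : ‖y‖ ≤ c := by
      calc ‖y‖ ≤ ‖X (e q)‖ + ‖((ε / 2 : ℝ) : ℂ) • e q‖ := norm_sub_le _ _
        _ ≤ ‖X‖ * ‖e q‖ + (ε / 2) * ‖e q‖ := by
          rw [norm_smul, Complex.norm_real, Real.norm_of_nonneg (by positivity)]
          gcongr
          exact X.le_opNorm _
        _ ≤ ‖X‖ * 1 + (ε / 2) * 1 := by gcongr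
        _ = c := by rw [hc]; ring
    have hyform : η * ‖e q‖ ^ 2 ≤ (⟪y, e q⟫_ℂ).re := by
      rw [hy, inner_sub_left, inner_smul_left, Complex.conj_ofReal, Complex.sub_re,
        Complex.re_ofReal_mul]
      have h1 := hXe q
      have h2 : (⟪e q, e q⟫_ℂ).re = ‖e q‖ ^ 2 := inner_self_eq_norm_sq (𝕜 := ℂ) _
      rw [h2, hη]; linarith
    have hylow : (⟪y, W (e q)⟫_ℂ).re ≤ 0 := by
      have h1 : (⟪W (X (e q)), e q⟫_ℂ).re = (⟪X (e q), W (e q)⟫_ℂ).re := by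
        rw [inner_apply_comm hWs]
      have h2 : (⟪e q, W (e q)⟫_ℂ).re = (⟪W (e q), e q⟫_ℂ).re := by
        rw [inner_apply_comm hWs]
      rw [hy, inner_sub_left, inner_smul_left, Complex.conj_ofReal, Complex.sub_re,
        Complex.re_ofReal_mul, h2, ← h1]
      linarith [h (e q)]
    have hwq : (⟪y, w q⟫_ℂ).re ≤ 0 := by
      have : w q = e (W (e q)) := rfl
      rw [this, ← inner_apply_comm hes, hey]; exact hylow
    have hyq : (⟪y, q⟫_ℂ).re = (⟪y, e q⟫_ℂ).re := by
      rw [← inner_apply_comm hes, hey]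
    have h1 : m * (⟪y, q⟫_ℂ).re ≤ c * κ := by
      have h2 : (⟪y, w q - (m : ℂ) • q⟫_ℂ).re = (⟪y, w q⟫_ℂ).re - m * (⟪y, q⟫_ℂ).re := by
        rw [inner_sub_right, inner_smul_right, Complex.sub_re, Complex.re_ofReal_mul]
      have h3 : |(⟪y, w q - (m : ℂ) • q⟫_ℂ).re| ≤ c * κ :=
        (Complex.abs_re_le_norm _).trans ((norm_inner_le_norm _ _).trans
          (mul_le_mul hynorm hqle (norm_nonneg _) hcpos))
      have := (abs_le.1 h3).1
      linarith
    have heqlow : 1 / 2 ≤ ‖e q‖ := by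
      have h2 : ‖(m : ℂ) • (q - e q)‖ ≤ κ := by
        have h3 : (m : ℂ) • (q - e q) = (e (w q - (m : ℂ) • q)) - (w q - (m : ℂ) • q) := by
          have : e (w q) = w q := hee _
          rw [map_sub, map_smul, this, smul_sub]; abel
        have h4 : ∀ z, ‖e z - z‖ ≤ ‖z‖ := by
          intro z
          have h5 : e z - z = -p z := by simp [he]
          rw [h5, norm_neg]
          exact Submodule.norm_starProjection_apply_le _ _
        rw [h3]; exact (h4 _).trans hqle
      rw [norm_smul, Complex.norm_real, Real.norm_of_nonneg hm.le] at h2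
      have h3 : m * ‖q - e q‖ ≤ m / 2 := h2.trans (min_le_left _ _)
      have h4 : ‖q - e q‖ ≤ 1 / 2 := by
        by_contra! h5
        nlinarith
      have h5 := norm_sub_norm_le q (e q)
      rw [hq] at h5; linarith
    have h5 : c * κ ≤ m * η / 8 := by
      calc c * κ ≤ c * (m * η / (8 * (c + 1))) := by gcongr; exact min_le_right _ _
        _ = (m * η / 8) * (c / (c + 1)) := by field_simp
        _ ≤ (m * η / 8) * 1 := by
          gcongr
          rw [div_le_one (by positivity)]; linarith
        _ = _ := mul_one _
    rw [hyq] at h1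
    have h6 : η * (1 / 4) ≤ (⟪y, e q⟫_ℂ).re := by
      refine le_trans ?_ hyform
      gcongr
      nlinarith
    have h7 : m * (η * (1 / 4)) ≤ m * (⟪y, e q⟫_ℂ).re := by gcongr
    have : 0 < m * η := mul_pos hm hηpos
    linarith
  have hezero : ∀ x, e x = 0 := by
    intro x
    -- `X` preserves `ran e`, where `W` vanishes; so `X (e x) = 0`, against `X > ε' > 0` on `ran e`.
    have h1 : W (X (e x)) = 0 := by
      rw [heX]
      exact apply_eq_zero_of_re_inner_eq_zero hW (hwzero _)
    have h2 := hXe x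
    rw [hinj _ h1, inner_zero_left, Complex.zero_re] at h2
    have h3 : 0 < ε' := by linarith
    have h4 : ‖e x‖ ^ 2 ≤ 0 := by
      by_contra! h5
      nlinarith
    simpa using le_antisymm h4 (sq_nonneg _)
  have hpv : p v = v := by
    have := hezero v
    change v - p v = 0 at this
    exact (sub_eq_zero.1 this).symm
  have := re_inner_nonneg_spectralProj hYs hpv
  rw [hYform] at this
  linarith

end Hilbert

/-! ### The norm bound for Sylvester equations, by 2 × 2 blocks. -/

section Block

variable {E : Type*} [NormedAddCommGroup E] [InnerProductSpace ℂ E]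

/-- The operator `(x, y) ↦ (a x + b y, c x + d y)` on the Hilbert sum `E ⊕ E`. -/
def blockOp (a b c d : E →L[ℂ] E) : WithLp 2 (E × E) →L[ℂ] WithLp 2 (E × E) :=
  (WithLp.prodContinuousLinearEquiv 2 ℂ E E).symm.toContinuousLinearMap ∘L
    ((a ∘L ContinuousLinearMap.fst ℂ E E + b ∘L ContinuousLinearMap.snd ℂ E E).prod
      (c ∘L ContinuousLinearMap.fst ℂ E E + d ∘L ContinuousLinearMap.snd ℂ E E)) ∘L
    (WithLp.prodContinuousLinearEquiv 2 ℂ E E).toContinuousLinearMap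

theorem blockOp_fst (a b c d : E →L[ℂ] E) (x : WithLp 2 (E × E)) :
    (blockOp a b c d x).fst = a x.fst + b x.snd := rfl

theorem blockOp_snd (a b c d : E →L[ℂ] E) (x : WithLp 2 (E × E)) :
    (blockOp a b c d x).snd = c x.fst + d x.snd := rfl

theorem inner_withLp (x y : WithLp 2 (E × E)) :
    ⟪x, y⟫_ℂ = ⟪x.fst, y.fst⟫_ℂ + ⟪x.snd, y.snd⟫_ℂ := rfl

theorem withLp_ext {x y : WithLp 2 (E × E)} (h₁ : x.fst = y.fst) (h₂ : x.snd = y.snd) : x = y :=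
  WithLp.ofLp_injective 2 (Prod.ext h₁ h₂)

theorem norm_blockOp_offDiag_le {b c : E →L[ℂ] E} {ε : ℝ} (hb : ‖b‖ ≤ ε) (hc : ‖c‖ ≤ ε) :
    ‖blockOp 0 b c 0‖ ≤ ε := by
  have hε : 0 ≤ ε := (norm_nonneg _).trans hb
  refine ContinuousLinearMap.opNorm_le_bound _ hε fun x => ?_
  refine le_of_sq_le_sq ?_ (by positivity)
  rw [WithLp.prod_norm_sq_eq_of_L2, mul_pow, WithLp.prod_norm_sq_eq_of_L2, blockOp_fst,
    blockOp_snd]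
  have h1 : ‖b x.snd‖ ≤ ε * ‖x.snd‖ := (b.le_opNorm _).trans (by gcongr)
  have h2 : ‖c x.fst‖ ≤ ε * ‖x.fst‖ := (c.le_opNorm _).trans (by gcongr)
  have h3 := pow_le_pow_left₀ (norm_nonneg _) h1 2
  have h4 := pow_le_pow_left₀ (norm_nonneg _) h2 2
  simp only [zero_apply, zero_add, add_zero]
  linarith

variable [CompleteSpace E]

theorem isSelfAdjoint_blockOp {a b c d : E →L[ℂ] E} (ha : star a = a) (hb : star b = c)
    (hd : star d = d) : IsSelfAdjoint (blockOp a b c d) := by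
  rw [ContinuousLinearMap.isSelfAdjoint_iff_isSymmetric]
  intro x y
  change ⟪blockOp a b c d x, y⟫_ℂ = ⟪x, blockOp a b c d y⟫_ℂ
  subst hb
  rw [inner_withLp, inner_withLp, blockOp_fst, blockOp_snd, blockOp_fst, blockOp_snd]
  simp only [inner_add_left, inner_add_right]
  rw [ContinuousLinearMap.star_eq_adjoint, ContinuousLinearMap.adjoint_inner_left,
    ContinuousLinearMap.adjoint_inner_right, inner_apply_comm ha, inner_apply_comm hd]
  ring

theorem blockOp_diag_nonneg {a d : E →L[ℂ] E} (ha : 0 ≤ a) (hd : 0 ≤ d) :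
    0 ≤ blockOp a 0 0 d := by
  refine nonneg_of_forall_re_inner_nonneg
    (isSelfAdjoint_blockOp ha.isSelfAdjoint (star_zero _) hd.isSelfAdjoint) fun x => ?_
  rw [inner_withLp, blockOp_fst, blockOp_snd]
  simpa using add_nonneg (re_inner_nonneg_of_nonneg ha x.fst) (re_inner_nonneg_of_nonneg hd x.snd)

/-- The norm of the solution `X` of a Sylvester equation `a X + X b = N` with `a, b ≥ 0`, whose
right-hand side is bounded relatively to `a` and to `b`. -/
theorem norm_le_of_sylvester {a b X Z Z' : E →L[ℂ] E} (ha : 0 ≤ a) (hb : 0 ≤ b) {ε : ℝ}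
    (h : a * X + X * b = a * Z) (h' : star (a * Z) = b * Z') (hZ : ‖Z‖ ≤ ε) (hZ' : ‖Z'‖ ≤ ε)
    (hinj : ∀ v, a (X v) = 0 → X v = 0) (hinj' : ∀ v, b (star X v) = 0 → star X v = 0) :
    ‖X‖ ≤ ε / 2 := by
  have hε : 0 ≤ ε := (norm_nonneg _).trans hZ
  refine le_of_forall_gt_imp_ge_of_dense fun ε' hε' => ?_
  -- The equation becomes a Lyapunov equation for the self-adjoint off-diagonal `T`, with weight `W
  -- = diag(a, b)`. Self-adjointness of `W Y` is the hypothesis that the right side factors through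
  -- `a` and, after taking adjoints, through `b`.
  set W := blockOp a 0 0 b with hWdef
  have hW : 0 ≤ W := blockOp_diag_nonneg ha hb
  set T := blockOp 0 X (star X) 0 with hTdef
  have hT : IsSelfAdjoint T := isSelfAdjoint_blockOp (star_zero _) rfl (star_zero _)
  set Y := blockOp 0 Z Z' 0 with hYdef
  have hWY : W * Y = blockOp 0 (a * Z) (b * Z') 0 := by
    ext1 x
    refine withLp_ext ?_ ?_
    · change a (0 + Z x.snd) + 0 = 0 + a (Z x.snd)
      simp
    · change 0 + b (Z' x.fst + 0) = b (Z' x.fst) + 0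
      simp
  have hWYs : IsSelfAdjoint (W * Y) := by
    rw [hWY]; exact isSelfAdjoint_blockOp (star_zero _) h' (star_zero _)
  have hlax := re_inner_mul_le hW hWYs (norm_blockOp_offDiag_le hZ hZ')
  have hform : ∀ v, 2 * (⟪W (T v), v⟫_ℂ).re = (⟪W (Y v), v⟫_ℂ).re := by
    intro v
    have h1 : (⟪W (T v), v⟫_ℂ).re = (⟪a (X v.snd), v.fst⟫_ℂ).re + (⟪X (b v.snd), v.fst⟫_ℂ).re := by
      have hTf : (T v).fst = X v.snd := by rw [hTdef, blockOp_fst]; simp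
      have hTs : (T v).snd = star X v.fst := by rw [hTdef, blockOp_snd]; simp
      have hWf : (W (T v)).fst = a (X v.snd) := by rw [hWdef, blockOp_fst, hTf]; simp
      have hWs : (W (T v)).snd = b (star X v.fst) := by rw [hWdef, blockOp_snd, hTs]; simp
      rw [inner_withLp, hWf, hWs, Complex.add_re]
      congr 1
      rw [inner_apply_comm hb.isSelfAdjoint, ContinuousLinearMap.star_eq_adjoint,
        ContinuousLinearMap.adjoint_inner_left, ← inner_conj_symm, Complex.conj_re]
    have h2 : (⟪W (Y v), v⟫_ℂ).re = 2 * (⟪a (Z v.snd), v.fst⟫_ℂ).re := by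
      have : W (Y v) = blockOp 0 (a * Z) (b * Z') 0 v :=
        congrArg (fun A : WithLp 2 (E × E) →L[ℂ] WithLp 2 (E × E) => A v) hWY
      rw [this, inner_withLp, blockOp_fst, blockOp_snd]
      simp only [zero_apply, zero_add, add_zero, Complex.add_re]
      rw [← h', ContinuousLinearMap.star_eq_adjoint, ContinuousLinearMap.adjoint_inner_left,
        ← inner_conj_symm v.fst, Complex.conj_re]
      change (⟪a (Z v.snd), v.fst⟫_ℂ).re + (⟪a (Z v.snd), v.fst⟫_ℂ).re = _
      ring
    have h3 : a (X v.snd) + X (b v.snd) = a (Z v.snd) :=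
      congrArg (fun A : E →L[ℂ] E => A v.snd) h
    rw [h1, h2, ← h3, inner_add_left, Complex.add_re]
  have key := re_inner_le_of_lyapunov hW hT hε
    (fun v => (hform v).trans_le (hlax v)) (fun v hv => by
      have h1 : a (X v.snd) = 0 := by
        have := congrArg WithLp.fst hv
        rw [blockOp_fst, blockOp_fst] at this
        simpa using this
      have h2 : b (star X v.fst) = 0 := by
        have := congrArg WithLp.snd hv
        rw [blockOp_snd, blockOp_snd] at this
        simpa using this
      refine withLp_ext ?_ ?_
      · rw [blockOp_fst]; simpa using hinj _ h1
      · rw [blockOp_snd]; simpa using hinj' _ h2) hε'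
  have hε'0 : 0 < ε' := by linarith
  refine ContinuousLinearMap.opNorm_le_bound _ hε'0.le fun v => ?_
  rcases eq_or_ne (X v) 0 with h0 | h0
  · rw [h0, norm_zero]; positivity
  have hn : 0 < ‖X v‖ := norm_pos_iff.2 h0
  -- Test vector `(c X v, v)` with components of equal norm, so that the upper bound for the form of
  -- `T` becomes a bound for `‖X v‖`.
  set c : ℝ := ‖v‖ / ‖X v‖ with hc
  have h1 := key (WithLp.toLp 2 ((c : ℂ) • X v, v))
  rw [WithLp.prod_norm_sq_eq_of_L2, inner_withLp, blockOp_fst, blockOp_snd] at h1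
  simp only [zero_apply, zero_add, add_zero, Complex.add_re] at h1
  rw [ContinuousLinearMap.star_eq_adjoint, ContinuousLinearMap.adjoint_inner_left] at h1
  change (⟪X v, (c : ℂ) • X v⟫_ℂ).re + (⟪(c : ℂ) • X v, X v⟫_ℂ).re ≤
    ε' * (‖(c : ℂ) • X v‖ ^ 2 + ‖v‖ ^ 2) at h1
  rw [inner_smul_right, inner_smul_left, Complex.conj_ofReal, Complex.re_ofReal_mul, norm_smul,
    Complex.norm_real, Real.norm_of_nonneg (by positivity)] at h1
  have h2 : (⟪X v, X v⟫_ℂ).re = ‖X v‖ ^ 2 := inner_self_eq_norm_sq (𝕜 := ℂ) _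
  rw [h2] at h1
  have h3 : c * ‖X v‖ = ‖v‖ := by rw [hc]; field_simp
  have h4 : c * ‖X v‖ ^ 2 = ‖v‖ * ‖X v‖ := by rw [← h3]; ring
  rw [h3, h4] at h1
  rcases eq_or_ne v 0 with rfl | hv
  · simp
  have hv' : 0 < ‖v‖ := norm_pos_iff.2 hv
  nlinarith

end Block

variable {Γ : Type v} [Group Γ]

/-! ### The algebra of equivariant operators. -/

section Equivariant

variable {H K L : HilbertModule.{u} Γ}

theorem inner_ρ_left (γ : Γ) (x y : H) : ⟪H.ρ γ x, y⟫_ℂ = ⟪x, H.ρ γ⁻¹ y⟫_ℂ := by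
  have h : y = H.ρ γ (H.ρ γ⁻¹ y) := by
    have : H.ρ γ (H.ρ γ⁻¹ y) = (H.ρ γ * H.ρ γ⁻¹) y := rfl
    rw [this, ← map_mul, mul_inv_cancel, map_one]; rfl
  conv_lhs => rw [h]
  exact (H.ρ γ).inner_map_map _ _

theorem IsEquivariant.comp {A : K →L[ℂ] L} {B : H →L[ℂ] K} (hA : IsEquivariant A)
    (hB : IsEquivariant B) : IsEquivariant (A ∘L B) := fun γ x => by
  change A (B _) = L.ρ γ (A (B x))
  rw [hB, hA]

theorem IsEquivariant.mul {A B : H →L[ℂ] H} (hA : IsEquivariant A)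
    (hB : IsEquivariant B) : IsEquivariant (A * B) := IsEquivariant.comp hA hB

theorem IsEquivariant.add {A B : H →L[ℂ] K} (hA : IsEquivariant A) (hB : IsEquivariant B) :
    IsEquivariant (A + B) := fun γ x => by
  change A _ + B _ = K.ρ γ (A x + B x)
  rw [hB, hA, map_add]

theorem IsEquivariant.smul {A : H →L[ℂ] K} (hA : IsEquivariant A) (c : ℂ) :
    IsEquivariant (c • A) := fun γ x => by
  change c • A _ = K.ρ γ (c • A x)
  rw [hA, map_smul]

theorem IsEquivariant.neg {A : H →L[ℂ] K} (hA : IsEquivariant A) : IsEquivariant (-A) := by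
  simpa using hA.smul (-1)

theorem IsEquivariant.sub {A B : H →L[ℂ] K} (hA : IsEquivariant A) (hB : IsEquivariant B) :
    IsEquivariant (A - B) := by
  rw [sub_eq_add_neg]; exact hA.add hB.neg

theorem isEquivariant_one : IsEquivariant (1 : H →L[ℂ] H) := fun _ _ => rfl

theorem isEquivariant_zero : IsEquivariant (0 : H →L[ℂ] K) := fun γ x => by simp

theorem IsEquivariant.adjoint {A : H →L[ℂ] K} (hA : IsEquivariant A) :
    IsEquivariant A.adjoint := fun γ y => by
  refine ext_inner_right ℂ fun x => ?_
  rw [ContinuousLinearMap.adjoint_inner_left, inner_ρ_left, ← hA, inner_ρ_left,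
    ContinuousLinearMap.adjoint_inner_left]

theorem IsEquivariant.star {A : H →L[ℂ] H} (hA : IsEquivariant A) : IsEquivariant (star A) :=
  hA.adjoint

/-- The action of `γ`, as a bounded operator. -/
def ρL (H : HilbertModule.{u} Γ) (γ : Γ) : H →L[ℂ] H :=
  (H.ρ γ).toContinuousLinearEquiv.toContinuousLinearMap

theorem isEquivariant_iff_commute {A : H →L[ℂ] H} :
    IsEquivariant A ↔ ∀ γ, Commute (H.ρL γ) A := by
  refine ⟨fun h γ => ?_, fun h γ x => ?_⟩
  · ext x; exact (h γ x).symm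
  · exact (congrArg (fun B : H →L[ℂ] H => B x) (h γ).eq).symm

theorem isClosed_isEquivariant : IsClosed {A : H →L[ℂ] K | IsEquivariant A} := by
  simp only [IsEquivariant, Set.ofPred_forall]
  refine isClosed_iInter fun γ => isClosed_iInter fun x => isClosed_eq ?_ ?_
  · exact (ContinuousLinearMap.apply ℂ K (H.ρ γ x)).continuous
  · exact (K.ρ γ).continuous.comp (ContinuousLinearMap.apply ℂ K x).continuous

theorem isEquivariant_starProjection {V : Submodule ℂ H} [V.HasOrthogonalProjection]
    (hV : ∀ (γ : Γ) (x : H), x ∈ V → H.ρ γ x ∈ V) : IsEquivariant V.starProjection := by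
  intro γ x
  refine Submodule.eq_starProjection_of_mem_of_inner_eq_zero
    (hV _ _ (Submodule.starProjection_apply_mem _ _)) fun w hw => ?_
  rw [← map_sub, inner_ρ_left]
  exact Submodule.starProjection_inner_eq_zero _ _ (hV _ _ hw)

theorem topologicalClosure_invariant {V : Submodule ℂ H}
    (hV : ∀ (γ : Γ) (x : H), x ∈ V → H.ρ γ x ∈ V) (γ : Γ) (x : H)
    (hx : x ∈ V.topologicalClosure) : H.ρ γ x ∈ V.topologicalClosure :=
  map_mem_closure (H.ρ γ).continuous hx (hV γ)

theorem isEquivariant_spectralProj {X : H →L[ℂ] H} (hX : IsEquivariant X) :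
    IsEquivariant (spectralProj X) :=
  isEquivariant_iff_commute.2 fun γ => commute_spectralProj (isEquivariant_iff_commute.1 hX γ)

end Equivariant

/-! ### Γ-Hilbert–Schmidt operators and Γ-compactness. -/

section HilbertSchmidt

variable {H K L : HilbertModule.{u} Γ}

open Classical in
/-- The vector `J† δ_{(1, i)}`. -/
def basisVec (H : HilbertModule.{u} Γ) (i : H.ι) : H :=
  H.J.toContinuousLinearMap.adjoint (lp.single 2 ((1 : Γ), i) (1 : ℂ))

open Classical in
theorem inner_basisVec (i : H.ι) (x : H) : ⟪H.basisVec i, x⟫_ℂ = H.J x (1, i) := by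
  rw [basisVec, ContinuousLinearMap.adjoint_inner_left, lp.inner_single_left]
  simp

theorem J_apply (x : H) (g : Γ) (i : H.ι) : H.J x (g, i) = ⟪H.basisVec i, H.ρ g⁻¹ x⟫_ℂ := by
  rw [inner_basisVec, H.equivariant]
  simp

theorem ofReal_norm_sq (x : H) :
    ENNReal.ofReal (‖x‖ ^ 2) = ∑' p : Γ × H.ι, ENNReal.ofReal (‖H.J x p‖ ^ 2) := by
  have h := lp.hasSum_norm (p := 2) (by simp) (H.J x)
  simp only [ENNReal.toReal_ofNat, Real.rpow_ofNat, LinearIsometry.norm_map] at h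
  rw [← h.tsum_eq, ENNReal.ofReal_tsum_of_nonneg (fun _ => sq_nonneg _) h.summable]

theorem gammaDim_eq (V : Submodule ℂ H) : H.gammaDim V =
    ∑' i : H.ι, ENNReal.ofReal (‖V.topologicalClosure.starProjection (H.basisVec i)‖ ^ 2) := rfl

/-- Expand in coordinates: by equivariance, the `(g, j)` coordinate of `A` at the `i`-th basis
vector has the modulus of the `(g⁻¹, i)` coordinate of `A*` at the `j`-th. Reindexing by inversion
on `Γ` and exchanging sums gives the identity. All cyclicity of the trace comes from here. -/
theorem tsum_ofReal_norm_sq_adjoint {A : H →L[ℂ] K} (hA : IsEquivariant A) :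
    ∑' i : H.ι, ENNReal.ofReal (‖A (H.basisVec i)‖ ^ 2) =
      ∑' j : K.ι, ENNReal.ofReal (‖A.adjoint (K.basisVec j)‖ ^ 2) := by
  have hcoord : ∀ i g j, ‖K.J (A (H.basisVec i)) (g, j)‖ =
      ‖H.J (A.adjoint (K.basisVec j)) (g⁻¹, i)‖ := by
    intro i g j
    rw [J_apply, J_apply, inv_inv, ← hA, ← ContinuousLinearMap.adjoint_inner_left,
      ← norm_inner_symm, inner_ρ_left, inv_inv, ← norm_inner_symm]
  set f : H.ι → Γ → K.ι → ℝ≥0∞ := fun i g j =>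
    ENNReal.ofReal (‖H.J (A.adjoint (K.basisVec j)) (g, i)‖ ^ 2) with hf
  have h1 : ∀ i, ENNReal.ofReal (‖A (H.basisVec i)‖ ^ 2) = ∑' g, ∑' j, f i g⁻¹ j := fun i => by
    rw [ofReal_norm_sq, ENNReal.tsum_prod']
    exact tsum_congr fun g => tsum_congr fun j => by rw [hcoord]
  have h2 : ∀ j, ENNReal.ofReal (‖A.adjoint (K.basisVec j)‖ ^ 2) = ∑' g, ∑' i, f i g j :=
    fun j => by rw [ofReal_norm_sq, ENNReal.tsum_prod']
  have h3 : ∀ i, ∑' g, ∑' j, f i g⁻¹ j = ∑' g, ∑' j, f i g j := fun i =>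
    (Equiv.inv Γ).tsum_eq (fun g => ∑' j, f i g j)
  simp only [h1, h2, h3]
  calc ∑' i, ∑' g, ∑' j, f i g j = ∑' i, ∑' j, ∑' g, f i g j :=
        tsum_congr fun i => ENNReal.tsum_comm
    _ = ∑' j, ∑' i, ∑' g, f i g j := ENNReal.tsum_comm
    _ = ∑' j, ∑' g, ∑' i, f i g j := tsum_congr fun j => ENNReal.tsum_comm

/-- `Γ`-Hilbert–Schmidt operators. -/
def IsHilbertSchmidt (A : H →L[ℂ] K) : Prop :=
  IsEquivariant A ∧ Summable fun i => ‖A (H.basisVec i)‖ ^ 2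

theorem tsum_ofReal_ne_top_iff {ι : Type*} {f : ι → ℝ} (hf : ∀ i, 0 ≤ f i) :
    ∑' i, ENNReal.ofReal (f i) ≠ ⊤ ↔ Summable f := by
  refine ⟨fun h => ?_, fun h => ?_⟩
  · have := ENNReal.summable_toReal h
    simpa only [ENNReal.toReal_ofReal (hf _)] using this
  · rw [← ENNReal.ofReal_tsum_of_nonneg hf h]
    exact ENNReal.ofReal_ne_top

theorem isHilbertSchmidt_iff {A : H →L[ℂ] K} : IsHilbertSchmidt A ↔
    IsEquivariant A ∧ ∑' i : H.ι, ENNReal.ofReal (‖A (H.basisVec i)‖ ^ 2) ≠ ⊤ := by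
  rw [IsHilbertSchmidt, tsum_ofReal_ne_top_iff fun _ => sq_nonneg _]

theorem IsHilbertSchmidt.adjoint {A : H →L[ℂ] K} (hA : IsHilbertSchmidt A) :
    IsHilbertSchmidt A.adjoint := by
  rw [isHilbertSchmidt_iff] at hA ⊢
  rw [← tsum_ofReal_norm_sq_adjoint hA.1]
  exact ⟨hA.1.adjoint, hA.2⟩

theorem tsum_norm_sq_adjoint {A : H →L[ℂ] K} (hA : IsEquivariant A) :
    ∑' i : H.ι, ‖A (H.basisVec i)‖ ^ 2 = ∑' j : K.ι, ‖A.adjoint (K.basisVec j)‖ ^ 2 := by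
  have h := congrArg ENNReal.toReal (tsum_ofReal_norm_sq_adjoint hA)
  rw [ENNReal.tsum_toReal_eq fun _ => ENNReal.ofReal_ne_top,
    ENNReal.tsum_toReal_eq fun _ => ENNReal.ofReal_ne_top] at h
  simpa only [ENNReal.toReal_ofReal (sq_nonneg _)] using h

theorem IsHilbertSchmidt.comp_left {A : H →L[ℂ] K} (hA : IsHilbertSchmidt A) {B : K →L[ℂ] L}
    (hB : IsEquivariant B) : IsHilbertSchmidt (B ∘L A) := by
  refine ⟨hB.comp hA.1, Summable.of_nonneg_of_le (fun _ => sq_nonneg _) (fun i => ?_)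
    (hA.2.mul_left (‖B‖ ^ 2))⟩
  rw [← mul_pow]
  exact pow_le_pow_left₀ (norm_nonneg _) (B.le_opNorm _) 2

theorem IsHilbertSchmidt.comp_right {A : K →L[ℂ] L} (hA : IsHilbertSchmidt A) {B : H →L[ℂ] K}
    (hB : IsEquivariant B) : IsHilbertSchmidt (A ∘L B) := by
  have := (hA.adjoint.comp_left hB.adjoint).adjoint
  rwa [ContinuousLinearMap.adjoint_comp, ContinuousLinearMap.adjoint_adjoint,
    ContinuousLinearMap.adjoint_adjoint] at this

theorem IsHilbertSchmidt.add {A B : H →L[ℂ] K} (hA : IsHilbertSchmidt A)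
    (hB : IsHilbertSchmidt B) : IsHilbertSchmidt (A + B) := by
  refine ⟨hA.1.add hB.1, Summable.of_nonneg_of_le (fun _ => sq_nonneg _) (fun i => ?_)
    ((hA.2.add hB.2).mul_left 2)⟩
  have h1 : ‖(A + B) (H.basisVec i)‖ ≤ ‖A (H.basisVec i)‖ + ‖B (H.basisVec i)‖ := norm_add_le _ _
  have h2 := pow_le_pow_left₀ (norm_nonneg _) h1 2
  nlinarith [sq_nonneg (‖A (H.basisVec i)‖ - ‖B (H.basisVec i)‖)]

theorem IsHilbertSchmidt.smul {A : H →L[ℂ] K} (hA : IsHilbertSchmidt A) (c : ℂ) :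
    IsHilbertSchmidt (c • A) := by
  refine ⟨hA.1.smul c, ?_⟩
  have : ∀ i, ‖(c • A) (H.basisVec i)‖ ^ 2 = ‖c‖ ^ 2 * ‖A (H.basisVec i)‖ ^ 2 := fun i => by
    rw [← mul_pow, ← norm_smul]; rfl
  simp only [this]
  exact hA.2.mul_left _

theorem isHilbertSchmidt_zero : IsHilbertSchmidt (0 : H →L[ℂ] K) :=
  ⟨isEquivariant_zero, by simp⟩

theorem IsHilbertSchmidt.summable_inner {A B : H →L[ℂ] K} (hA : IsHilbertSchmidt A)
    (hB : IsHilbertSchmidt B) :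
    Summable fun i => ‖A (H.basisVec i)‖ * ‖B (H.basisVec i)‖ := by
  refine Summable.of_nonneg_of_le (fun i => by positivity) (fun i => ?_) (hA.2.add hB.2)
  nlinarith [sq_nonneg (‖A (H.basisVec i)‖ - ‖B (H.basisVec i)‖),
    sq_nonneg (‖A (H.basisVec i)‖), sq_nonneg (‖B (H.basisVec i)‖)]

theorem tsum_inner_eq {A B : H →L[ℂ] K} (hA : IsHilbertSchmidt A) (hB : IsHilbertSchmidt B) :
    ∑' i, ⟪A (H.basisVec i), B (H.basisVec i)⟫_ℂ =
      (((∑' i, ‖(A + B) (H.basisVec i)‖ ^ 2 : ℝ) : ℂ) -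
        ((∑' i, ‖(A + (-1 : ℂ) • B) (H.basisVec i)‖ ^ 2 : ℝ) : ℂ) +
        (((∑' i, ‖(A + (-Complex.I) • B) (H.basisVec i)‖ ^ 2 : ℝ) : ℂ) -
          ((∑' i, ‖(A + Complex.I • B) (H.basisVec i)‖ ^ 2 : ℝ) : ℂ)) * Complex.I) / 4 := by
  have h1 := Complex.hasSum_ofReal.2 (hA.add hB).2.hasSum
  have h2 := Complex.hasSum_ofReal.2 (hA.add (hB.smul (-1))).2.hasSum
  have h3 := Complex.hasSum_ofReal.2 (hA.add (hB.smul (-Complex.I))).2.hasSum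
  have h4 := Complex.hasSum_ofReal.2 (hA.add (hB.smul Complex.I)).2.hasSum
  have h := (((h1.sub h2).add ((h3.sub h4).mul_right Complex.I)).div_const 4).tsum_eq
  rw [← h]
  refine tsum_congr fun i => ?_
  rw [inner_eq_sum_norm_sq_div_four]
  simp [sub_eq_add_neg]

/-- Polarization of the equality of Hilbert–Schmidt norms of an operator and its adjoint; unit
scalars are pulled out to match the four terms. -/
theorem tsum_inner_adjoint {A B : H →L[ℂ] K} (hA : IsHilbertSchmidt A)
    (hB : IsHilbertSchmidt B) :
    ∑' i, ⟪A (H.basisVec i), B (H.basisVec i)⟫_ℂ =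
      ∑' j, ⟪B.adjoint (K.basisVec j), A.adjoint (K.basisVec j)⟫_ℂ := by
  rw [tsum_inner_eq hA hB, tsum_inner_eq hB.adjoint hA.adjoint]
  rw [tsum_norm_sq_adjoint (hA.add hB).1, tsum_norm_sq_adjoint (hA.add (hB.smul (-1))).1,
    tsum_norm_sq_adjoint (hA.add (hB.smul (-Complex.I))).1,
    tsum_norm_sq_adjoint (hA.add (hB.smul Complex.I)).1]
  have e1 : ∀ j, ‖(A + B).adjoint (K.basisVec j)‖ =
      ‖(B.adjoint + A.adjoint) (K.basisVec j)‖ := fun j => by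
    rw [map_add, add_comm]
  have e2 : ∀ j, ‖(A + (-1 : ℂ) • B).adjoint (K.basisVec j)‖ =
      ‖(B.adjoint + (-1 : ℂ) • A.adjoint) (K.basisVec j)‖ := fun j => by
    rw [← norm_neg]
    congr 1
    simp
  have e3 : ∀ j, ‖(A + (-Complex.I) • B).adjoint (K.basisVec j)‖ =
      ‖(B.adjoint + (-Complex.I) • A.adjoint) (K.basisVec j)‖ := fun j => by
    have : (A + (-Complex.I) • B).adjoint (K.basisVec j) =
        Complex.I • (B.adjoint + (-Complex.I) • A.adjoint) (K.basisVec j) := by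
      rw [map_add, map_smulₛₗ]
      simp [smul_smul, add_comm]
    rw [this, norm_smul, Complex.norm_I, one_mul]
  have e4 : ∀ j, ‖(A + Complex.I • B).adjoint (K.basisVec j)‖ =
      ‖(B.adjoint + Complex.I • A.adjoint) (K.basisVec j)‖ := fun j => by
    have : (A + Complex.I • B).adjoint (K.basisVec j) =
        (-Complex.I) • (B.adjoint + Complex.I • A.adjoint) (K.basisVec j) := by
      rw [map_add, map_smulₛₗ]
      simp [smul_smul, add_comm]
    rw [this, norm_smul, norm_neg, Complex.norm_I, one_mul]
  simp only [e1, e2, e3, e4]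

/-- The projection onto the closed range serves as `e`: its squared Hilbert–Schmidt norm is by
definition the Γ-dimension of the range. -/
theorem isHilbertSchmidt_of_gammaDim_range_ne_top {F : H →L[ℂ] K} (hF : IsEquivariant F)
    (h : K.gammaDim F.range ≠ ⊤) :
    ∃ e : K →L[ℂ] K, IsHilbertSchmidt e ∧ F = e ∘L F := by
  have hinv : ∀ (γ : Γ) (x : K), x ∈ F.range → K.ρ γ x ∈ F.range := by
    rintro γ _ ⟨y, rfl⟩
    exact ⟨H.ρ γ y, hF γ y⟩
  refine ⟨F.range.topologicalClosure.starProjection, isHilbertSchmidt_iff.2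
    ⟨isEquivariant_starProjection (topologicalClosure_invariant hinv), h⟩, ?_⟩
  ext x
  exact (Submodule.starProjection_eq_self_iff.2
    (F.range.le_topologicalClosure ⟨x, rfl⟩)).symm

theorem gammaDim_ne_top_of_starProjection {V : Submodule ℂ H}
    (hV : ∀ (γ : Γ) (x : H), x ∈ V → H.ρ γ x ∈ V) {e : H →L[ℂ] H} (he : IsHilbertSchmidt e)
    (h : ∀ x ∈ V, e x = x) : H.gammaDim V ≠ ⊤ := by
  set f := V.topologicalClosure.starProjection with hf
  have hfe : e ∘L f = f := by
    ext x
    have : V.topologicalClosure ≤ (e - 1).ker := by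
      refine V.topologicalClosure_minimal (fun y hy => ?_) (e - 1).isClosed_ker
      change e y - y = 0
      rw [h y hy, sub_self]
    have h1 : e (f x) - f x = 0 := this (Submodule.starProjection_apply_mem _ x)
    exact sub_eq_zero.1 h1
  have hfE : IsEquivariant f := isEquivariant_starProjection (topologicalClosure_invariant hV)
  have := he.comp_right hfE
  rw [hfe] at this
  exact (isHilbertSchmidt_iff.1 this).2

/-- This description makes it evident that Γ-compact operators form a linear space, stable under
adjoints and under multiplication by equivariant operators. For the nontrivial inclusion, a
Hilbert–Schmidt `X` is approximated by `e X`, where `e` is a spectral projection of `X X*` away from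
0. -/
theorem gammaCompact_eq_closure : gammaCompact H H = closure {A | IsHilbertSchmidt A} := by
  refine Set.Subset.antisymm (closure_mono ?_) (closure_minimal ?_ isClosed_closure)
  · rintro F ⟨hF, hdim⟩
    obtain ⟨e, he, h⟩ := isHilbertSchmidt_of_gammaDim_range_ne_top hF hdim
    rw [h]
    exact he.comp_right hF
  · intro X hX
    refine Metric.mem_closure_iff.2 fun ε hε => ?_
    set s : ℝ := ε ^ 2 / 4 with hs
    have hspos : 0 < s := by positivity
    set M : H →L[ℂ] H := X * star X - (s : ℂ) • (1 : H →L[ℂ] H) with hM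
    have hMs : IsSelfAdjoint M := (IsSelfAdjoint.mul_star_self X).sub
      (IsSelfAdjoint.smul (by simp [isSelfAdjoint_iff]) (IsSelfAdjoint.one _))
    have hform : ∀ v, (⟪M v, v⟫_ℂ).re = ‖star X v‖ ^ 2 - s * ‖v‖ ^ 2 := by
      intro v
      have h1 : M v = X (star X v) - (s : ℂ) • v := rfl
      have h2 : (⟪X (star X v), v⟫_ℂ).re = ‖star X v‖ ^ 2 := by
        rw [← ContinuousLinearMap.adjoint_inner_right, ← ContinuousLinearMap.star_eq_adjoint]
        exact inner_self_eq_norm_sq (𝕜 := ℂ) _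
      have h3 : (⟪v, v⟫_ℂ).re = ‖v‖ ^ 2 := inner_self_eq_norm_sq (𝕜 := ℂ) _
      rw [h1, inner_sub_left, inner_smul_left, Complex.conj_ofReal, Complex.sub_re,
        Complex.re_ofReal_mul, h2, h3]
    -- On `ran e` one has `s ‖v‖² ≤ ‖X* v‖²`, so `e` inherits the Hilbert–Schmidt property from `X*
    -- e`. On its complement `‖X* v‖² ≤ s ‖v‖²`, and `s = ε²/4` gives `‖X - e X‖ ≤ ε/2`.
    set e := spectralProj M with he
    have hestar : IsStarProjection e := isStarProjection_spectralProj M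
    have hee : ∀ x, e (e x) = e x := fun x =>
      congrArg (fun A : H →L[ℂ] H => A x) hestar.isIdempotentElem
    have hME : IsEquivariant M := (hX.1.mul hX.1.star).sub (isEquivariant_one.smul _)
    have heE : IsEquivariant e := isEquivariant_spectralProj hME
    have heHS : IsHilbertSchmidt e := by
      refine ⟨heE, Summable.of_nonneg_of_le (fun _ => sq_nonneg _) (fun i => ?_)
        ((hX.adjoint.comp_right heE).2.mul_left s⁻¹)⟩
      have h1 := re_inner_nonneg_spectralProj hMs (hee (H.basisVec i))
      rw [hform] at h1
      rw [inv_mul_eq_div, le_div_iff₀ hspos]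
      change _ ≤ ‖star X (e (H.basisVec i))‖ ^ 2
      linarith
    refine ⟨e * X, ⟨heE.mul hX.1, gammaDim_ne_top_of_starProjection ?_ heHS ?_⟩, ?_⟩
    · rintro γ _ ⟨y, rfl⟩
      exact ⟨H.ρ γ y, (heE.mul hX.1) γ y⟩
    · rintro _ ⟨y, rfl⟩
      exact hee (X y)
    · rw [dist_eq_norm]
      have h1 : X - e * X = (1 - e) * X := by rw [sub_mul, one_mul]
      rw [h1, ← norm_star, star_mul, star_sub, star_one, hestar.isSelfAdjoint.star_eq]
      refine lt_of_le_of_lt (ContinuousLinearMap.opNorm_le_bound _ (by positivity : 0 ≤ ε / 2)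
        fun v => ?_) (by linarith)
      have h2 : e (v - e v) = 0 := by rw [map_sub, hee, sub_self]
      have h3 := re_inner_nonpos_spectralProj hMs h2
      rw [hform] at h3
      have h4 : ‖v - e v‖ ≤ ‖v‖ := by
        have : v - e v = (M⁻ : H →L[ℂ] H).ker.topologicalClosureᗮ.starProjection v := by
          rw [Submodule.starProjection_orthogonal_val]; rfl
        rw [this]
        exact Submodule.norm_starProjection_apply_le _ _
      refine le_of_sq_le_sq ?_ (by positivity)
      change ‖star X (v - e v)‖ ^ 2 ≤ _
      have h5 : ‖v - e v‖ ^ 2 ≤ ‖v‖ ^ 2 := pow_le_pow_left₀ (norm_nonneg _) h4 2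
      rw [mul_pow]
      have h6 : s * ‖v - e v‖ ^ 2 ≤ s * ‖v‖ ^ 2 := by gcongr
      have h7 : (ε / 2) ^ 2 = s := by rw [hs]; ring
      rw [h7]
      linarith

end HilbertSchmidt

/-! ### Inverses of coercive operators. -/

section Inverse

variable {E : Type*} [NormedAddCommGroup E] [InnerProductSpace ℂ E] [CompleteSpace E]

theorem exists_inverse_of_coercive {M : E →L[ℂ] E} (hM : IsSelfAdjoint M) {c : ℝ} (hc : 0 < c)
    (h : ∀ x, c * ‖x‖ ^ 2 ≤ (⟪M x, x⟫_ℂ).re) :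
    ∃ D : E →L[ℂ] E, D * M = 1 ∧ M * D = 1 ∧ IsSelfAdjoint D ∧ ‖D‖ ≤ c⁻¹ := by
  have hu : IsUnit M := ContinuousLinearMap.isUnit_of_forall_le_norm_inner_map M
    (c := ⟨c, hc.le⟩) (by exact_mod_cast hc) fun x => by
      refine le_trans ?_ ((h x).trans (Complex.re_le_norm _))
      change ‖x‖ ^ 2 * c ≤ c * ‖x‖ ^ 2
      rw [mul_comm]
  obtain ⟨D, hMD, hDM⟩ := isUnit_iff_exists.1 hu
  refine ⟨D, hDM, hMD, ?_, ?_⟩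
  · have h1 : star D * M = 1 := by
      have := congrArg star hMD
      rwa [star_mul, hM.star_eq, star_one] at this
    rw [isSelfAdjoint_iff]
    exact left_inv_eq_right_inv h1 hMD
  · refine ContinuousLinearMap.opNorm_le_bound _ (inv_nonneg.2 hc.le) fun x => ?_
    have h1 : M (D x) = x := congrArg (fun A : E →L[ℂ] E => A x) hMD
    have h2 := (h (D x)).trans ((Complex.re_le_norm _).trans (norm_inner_le_norm _ _))
    rw [h1] at h2
    rcases eq_or_lt_of_le (norm_nonneg (D x)) with h0 | h0
    · rw [← h0]; positivity
    rw [inv_mul_eq_div, le_div_iff₀ hc]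
    nlinarith

theorem commute_of_inverse {R : Type*} [Monoid R] {M D Y : R} (hDM : D * M = 1) (hMD : M * D = 1)
    (h : Commute Y M) : Commute Y D := by
  change Y * D = D * Y
  calc Y * D = D * M * Y * D := by rw [hDM, one_mul]
    _ = D * (Y * M) * D := by rw [h.eq, ← mul_assoc]
    _ = D * Y * (M * D) := by simp only [mul_assoc]
    _ = D * Y := by rw [hMD, mul_one]

end Inverse

variable {Γ : Type v} [Group Γ]

/-! ### The Γ-compact ideal, the Calkin norm and the Γ-trace. -/

section Compact

variable {H K L : HilbertModule.{u} Γ}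

theorem isEquivariant_of_mem_gammaCompact {A : H →L[ℂ] K} (hA : A ∈ gammaCompact H K) :
    IsEquivariant A :=
  closure_minimal (fun _ h => h.1) isClosed_isEquivariant hA

theorem mem_gammaCompact_of_isHilbertSchmidt {A : H →L[ℂ] H} (hA : IsHilbertSchmidt A) :
    A ∈ gammaCompact H H := by
  rw [gammaCompact_eq_closure]; exact subset_closure hA

theorem zero_mem_gammaCompact : (0 : H →L[ℂ] H) ∈ gammaCompact H H :=
  mem_gammaCompact_of_isHilbertSchmidt isHilbertSchmidt_zero

theorem add_mem_gammaCompact {A B : H →L[ℂ] H} (hA : A ∈ gammaCompact H H)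
    (hB : B ∈ gammaCompact H H) : A + B ∈ gammaCompact H H := by
  rw [gammaCompact_eq_closure] at *
  exact map_mem_closure₂ continuous_add hA hB fun _ ha _ hb => IsHilbertSchmidt.add ha hb

theorem smul_mem_gammaCompact {A : H →L[ℂ] H} (hA : A ∈ gammaCompact H H) (c : ℂ) :
    c • A ∈ gammaCompact H H := by
  rw [gammaCompact_eq_closure] at *
  exact map_mem_closure (continuous_const_smul c) hA fun _ ha => IsHilbertSchmidt.smul ha c

theorem neg_mem_gammaCompact {A : H →L[ℂ] H} (hA : A ∈ gammaCompact H H) :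
    -A ∈ gammaCompact H H := by
  simpa using smul_mem_gammaCompact hA (-1)

theorem sub_mem_gammaCompact {A B : H →L[ℂ] H} (hA : A ∈ gammaCompact H H)
    (hB : B ∈ gammaCompact H H) : A - B ∈ gammaCompact H H := by
  rw [sub_eq_add_neg]; exact add_mem_gammaCompact hA (neg_mem_gammaCompact hB)

theorem conj_mem_gammaCompact {A : H →L[ℂ] H} (hA : A ∈ gammaCompact H H) {V : H →L[ℂ] K}
    {U : K →L[ℂ] H} (hV : IsEquivariant V) (hU : IsEquivariant U) :
    V ∘L A ∘L U ∈ gammaCompact K K := by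
  rw [gammaCompact_eq_closure] at *
  exact map_mem_closure (f := fun B : H →L[ℂ] H => V ∘L B ∘L U)
    (continuous_const.clm_comp (continuous_id.clm_comp continuous_const)) hA
    fun _ ha => (IsHilbertSchmidt.comp_right ha hU).comp_left hV

theorem mul_mem_gammaCompact_left {A B : H →L[ℂ] H} (hB : IsEquivariant B)
    (hA : A ∈ gammaCompact H H) : B * A ∈ gammaCompact H H :=
  conj_mem_gammaCompact hA hB isEquivariant_one

theorem mul_mem_gammaCompact_right {A B : H →L[ℂ] H} (hB : IsEquivariant B)
    (hA : A ∈ gammaCompact H H) : A * B ∈ gammaCompact H H :=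
  conj_mem_gammaCompact hA isEquivariant_one hB

theorem star_mem_gammaCompact {A : H →L[ℂ] H} (hA : A ∈ gammaCompact H H) :
    star A ∈ gammaCompact H H := by
  rw [gammaCompact_eq_closure] at *
  exact map_mem_closure continuous_star hA fun _ ha => IsHilbertSchmidt.adjoint ha

theorem calkinNorm_lt_iff {A : H →L[ℂ] H} {c : ℝ} :
    calkinNorm A < c ↔ ∃ C K : H →L[ℂ] H, K ∈ gammaCompact H H ∧ A = C + K ∧ ‖C‖ < c := by
  rw [calkinNorm, Metric.infDist_lt_iff ⟨0, zero_mem_gammaCompact⟩]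
  constructor
  · rintro ⟨K, hK, h⟩
    exact ⟨A - K, K, hK, by abel, by rwa [← dist_eq_norm]⟩
  · rintro ⟨C, K, hK, rfl, h⟩
    refine ⟨K, hK, ?_⟩
    rwa [dist_eq_norm, add_sub_cancel_right]

theorem calkinNorm_nonneg (A : H →L[ℂ] H) : 0 ≤ calkinNorm A := Metric.infDist_nonneg

theorem calkinNorm_add_lt {A B : H →L[ℂ] H} {a b : ℝ} (hA : calkinNorm A < a)
    (hB : calkinNorm B < b) : calkinNorm (A + B) < a + b := by
  obtain ⟨C, K, hK, rfl, hC⟩ := calkinNorm_lt_iff.1 hA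
  obtain ⟨C', K', hK', rfl, hC'⟩ := calkinNorm_lt_iff.1 hB
  exact calkinNorm_lt_iff.2 ⟨C + C', K + K', add_mem_gammaCompact hK hK', by abel,
    (norm_add_le _ _).trans_lt (add_lt_add hC hC')⟩

theorem calkinNorm_neg_lt {A : H →L[ℂ] H} {a : ℝ} (hA : calkinNorm A < a) :
    calkinNorm (-A) < a := by
  obtain ⟨C, K, hK, rfl, hC⟩ := calkinNorm_lt_iff.1 hA
  exact calkinNorm_lt_iff.2 ⟨-C, -K, neg_mem_gammaCompact hK, by abel, by rwa [norm_neg]⟩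

theorem calkinNorm_sub_comm_lt {A B : H →L[ℂ] H} {a : ℝ} (h : calkinNorm (A - B) < a) :
    calkinNorm (B - A) < a := by
  rw [← neg_sub]; exact calkinNorm_neg_lt h

theorem calkinNorm_lt_of_norm_lt {A : H →L[ℂ] H} {a : ℝ} (h : ‖A‖ < a) : calkinNorm A < a :=
  calkinNorm_lt_iff.2 ⟨A, 0, zero_mem_gammaCompact, by rw [add_zero], h⟩

/-- The operators `∑ Xᵢ Yᵢ` with `Γ`-Hilbert–Schmidt operators `Xᵢ`, `Yᵢ`. -/
def traceClass (H : HilbertModule.{u} Γ) : Submodule ℂ (H →L[ℂ] H) :=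
  Submodule.span ℂ {A | ∃ X Y : H →L[ℂ] H, IsHilbertSchmidt X ∧ IsHilbertSchmidt Y ∧ A = X * Y}

/-- The `Γ`-trace. -/
def gammaTrace (A : H →L[ℂ] H) : ℂ := ∑' i, ⟪H.basisVec i, A (H.basisVec i)⟫_ℂ

theorem isEquivariant_of_mem_traceClass {A : H →L[ℂ] H} (hA : A ∈ H.traceClass) :
    IsEquivariant A := by
  induction hA using Submodule.span_induction with
  | mem A h => obtain ⟨X, Y, hX, hY, rfl⟩ := h; exact hX.1.mul hY.1
  | zero => exact isEquivariant_zero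
  | add A B _ _ hA hB => exact hA.add hB
  | smul c A _ hA => exact hA.smul c

theorem mem_gammaCompact_of_mem_traceClass {A : H →L[ℂ] H} (hA : A ∈ H.traceClass) :
    A ∈ gammaCompact H H := by
  induction hA using Submodule.span_induction with
  | mem A h =>
    obtain ⟨X, Y, hX, hY, rfl⟩ := h
    exact mem_gammaCompact_of_isHilbertSchmidt (hY.comp_left hX.1)
  | zero => exact zero_mem_gammaCompact
  | add A B _ _ hA hB => exact add_mem_gammaCompact hA hB
  | smul c A _ hA => exact smul_mem_gammaCompact hA c

theorem mul_mem_traceClass_left {A B : H →L[ℂ] H} (hB : IsEquivariant B)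
    (hA : A ∈ H.traceClass) : B * A ∈ H.traceClass := by
  induction hA using Submodule.span_induction with
  | mem A h =>
    obtain ⟨X, Y, hX, hY, rfl⟩ := h
    exact Submodule.subset_span ⟨B * X, Y, hX.comp_left hB, hY, by rw [mul_assoc]⟩
  | zero => rw [mul_zero]; exact zero_mem _
  | add A A' _ _ hA hA' => rw [mul_add]; exact add_mem hA hA'
  | smul c A _ hA => rw [mul_smul_comm]; exact Submodule.smul_mem _ c hA

theorem mul_mem_traceClass_right {A B : H →L[ℂ] H} (hB : IsEquivariant B)
    (hA : A ∈ H.traceClass) : A * B ∈ H.traceClass := by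
  induction hA using Submodule.span_induction with
  | mem A h =>
    obtain ⟨X, Y, hX, hY, rfl⟩ := h
    exact Submodule.subset_span ⟨X, Y * B, hX, hY.comp_right hB, by rw [mul_assoc]⟩
  | zero => rw [zero_mul]; exact zero_mem _
  | add A A' _ _ hA hA' => rw [add_mul]; exact add_mem hA hA'
  | smul c A _ hA => rw [smul_mul_assoc]; exact Submodule.smul_mem _ c hA

theorem inner_mul_apply (X Y : H →L[ℂ] H) (x y : H) :
    ⟪x, (X * Y) y⟫_ℂ = ⟪X.adjoint x, Y y⟫_ℂ := by
  rw [ContinuousLinearMap.adjoint_inner_left]; rfl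

theorem summable_gammaTrace {A : H →L[ℂ] H} (hA : A ∈ H.traceClass) :
    Summable fun i => ⟪H.basisVec i, A (H.basisVec i)⟫_ℂ := by
  induction hA using Submodule.span_induction with
  | mem A h =>
    obtain ⟨X, Y, hX, hY, rfl⟩ := h
    simp only [inner_mul_apply]
    exact Summable.of_norm_bounded (hX.adjoint.summable_inner hY)
      fun i => norm_inner_le_norm _ _
  | zero => simpa using summable_zero
  | add A B _ _ hA hB =>
    refine (hA.add hB).congr fun i => ?_
    rw [← inner_add_right]; rfl
  | smul c A _ hA =>
    refine (hA.mul_left c).congr fun i => ?_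
    rw [← inner_smul_right]; rfl

theorem gammaTrace_add {A B : H →L[ℂ] H} (hA : A ∈ H.traceClass) (hB : B ∈ H.traceClass) :
    gammaTrace (A + B) = gammaTrace A + gammaTrace B := by
  rw [gammaTrace, gammaTrace, gammaTrace,
    ← (summable_gammaTrace hA).tsum_add (summable_gammaTrace hB)]
  refine tsum_congr fun i => ?_
  rw [← inner_add_right]; rfl

theorem gammaTrace_smul (c : ℂ) (A : H →L[ℂ] H) : gammaTrace (c • A) = c * gammaTrace A := by
  rw [gammaTrace, gammaTrace, ← tsum_mul_left]
  refine tsum_congr fun i => ?_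
  rw [← inner_smul_right]; rfl

theorem gammaTrace_neg (A : H →L[ℂ] H) : gammaTrace (-A) = -gammaTrace A := by
  simpa using gammaTrace_smul (-1) A

theorem gammaTrace_sub {A B : H →L[ℂ] H} (hA : A ∈ H.traceClass) (hB : B ∈ H.traceClass) :
    gammaTrace (A - B) = gammaTrace A - gammaTrace B := by
  rw [sub_eq_add_neg, gammaTrace_add hA (neg_mem hB), gammaTrace_neg, sub_eq_add_neg]

theorem gammaTrace_mul_rotate {A X Y : H →L[ℂ] H} (hA : IsEquivariant A)
    (hX : IsHilbertSchmidt X) (hY : IsHilbertSchmidt Y) :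
    gammaTrace (A * (X * Y)) = gammaTrace (Y * (A * X)) := by
  have hAX : IsHilbertSchmidt (A * X) := hX.comp_left hA
  have := tsum_inner_adjoint hAX.adjoint hY
  rw [ContinuousLinearMap.adjoint_adjoint] at this
  simpa only [gammaTrace, inner_mul_apply, ← mul_assoc A X Y] using this

theorem gammaTrace_mul_comm {A R : H →L[ℂ] H} (hA : IsEquivariant A) (hR : R ∈ H.traceClass) :
    gammaTrace (A * R) = gammaTrace (R * A) := by
  induction hR using Submodule.span_induction with
  | mem R h =>
    obtain ⟨X, Y, hX, hY, rfl⟩ := h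
    have h := gammaTrace_mul_rotate (Y := Y * A) isEquivariant_one hX (hY.comp_right hA)
    rw [one_mul, one_mul] at h
    rw [gammaTrace_mul_rotate hA hX hY, ← mul_assoc Y A X, mul_assoc X Y A, h]
  | zero => rw [zero_mul, mul_zero]
  | add R R' h h' ih ih' =>
    rw [mul_add, add_mul, gammaTrace_add (mul_mem_traceClass_left hA h)
      (mul_mem_traceClass_left hA h'), gammaTrace_add (mul_mem_traceClass_right hA h)
      (mul_mem_traceClass_right hA h'), ih, ih']
  | smul c R h ih => rw [mul_smul_comm, smul_mul_assoc, gammaTrace_smul, gammaTrace_smul, ih]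

/-- Normality of the trace. For `R = X Y` rotate to `Y S_n X`, whose diagonal entries converge
termwise and are dominated by the summable products `‖Y* v_i‖ ‖X v_i‖` over the basis vectors `v_i`.
-/
theorem tendsto_gammaTrace {e : H →L[ℂ] H} (he : IsEquivariant e) {S : ℕ → H →L[ℂ] H}
    (hS : ∀ n, IsEquivariant (S n)) (hS1 : ∀ n, ‖S n‖ ≤ 1)
    (hlim : ∀ x, Filter.Tendsto (fun n => S n x) Filter.atTop (𝓝 (e x)))
    {R : H →L[ℂ] H} (hR : R ∈ H.traceClass) :
    Filter.Tendsto (fun n => gammaTrace (S n * R)) Filter.atTop (𝓝 (gammaTrace (e * R))) := by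
  induction hR using Submodule.span_induction with
  | mem R h =>
    obtain ⟨X, Y, hX, hY, rfl⟩ := h
    simp only [gammaTrace_mul_rotate (hS _) hX hY, gammaTrace_mul_rotate he hX hY]
    simp only [gammaTrace, inner_mul_apply Y]
    refine tendsto_tsum_of_dominated_convergence (hY.adjoint.summable_inner hX)
      (fun i => ?_) (Filter.Eventually.of_forall fun n i => ?_)
    · exact Filter.Tendsto.inner tendsto_const_nhds (hlim _)
    · refine (norm_inner_le_norm _ _).trans ?_
      gcongr
      exact ((S n).le_opNorm _).trans (mul_le_of_le_one_left (norm_nonneg _) (hS1 n))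
  | zero => simp only [mul_zero]; exact tendsto_const_nhds
  | add R R' h h' ih ih' =>
    simp only [mul_add, gammaTrace_add (mul_mem_traceClass_left (hS _) h)
      (mul_mem_traceClass_left (hS _) h'), gammaTrace_add (mul_mem_traceClass_left he h)
      (mul_mem_traceClass_left he h')]
    exact ih.add ih'
  | smul c R h ih =>
    simp only [mul_smul_comm, gammaTrace_smul]
    exact ih.const_mul c

theorem mem_traceClass_of_gammaDim_range_ne_top {F : H →L[ℂ] H} (hF : IsEquivariant F)
    (h : H.gammaDim F.range ≠ ⊤) : F ∈ H.traceClass := by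
  obtain ⟨e, he, h'⟩ := isHilbertSchmidt_of_gammaDim_range_ne_top hF h
  refine Submodule.subset_span ⟨e, F, he, ?_, h'⟩
  rw [h']
  exact he.comp_right hF

/-- Operators of finite Γ-rank are trace class and dense in the Γ-compact ones; the approximation
error fits into the strict inequality. Later remainders can thus be traced. -/
theorem exists_eq_add_traceClass_of_calkinNorm_lt {A : H →L[ℂ] H} (hA : IsEquivariant A) {c : ℝ}
    (h : calkinNorm A < c) :
    ∃ C F : H →L[ℂ] H, IsEquivariant C ∧ F ∈ H.traceClass ∧ A = C + F ∧ ‖C‖ < c := by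
  obtain ⟨C, K, hK, rfl, hC⟩ := calkinNorm_lt_iff.1 h
  obtain ⟨F, hF, hKF⟩ := Metric.mem_closure_iff.1 hK (c - ‖C‖) (sub_pos.2 hC)
  have hF' := mem_traceClass_of_gammaDim_range_ne_top hF.1 hF.2
  refine ⟨C + K - F, F, hA.sub hF.1, hF', by abel, ?_⟩
  rw [dist_eq_norm] at hKF
  calc ‖C + K - F‖ = ‖C + (K - F)‖ := by rw [add_sub_assoc]
    _ ≤ ‖C‖ + ‖K - F‖ := norm_add_le _ _
    _ < c := by linarith

end Compact

variable {Γ : Type v} [Group Γ]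

/-! ### The trace formula for the Γ-index and its consequences. -/

section Index

variable {H : HilbertModule.{u} Γ}

theorem star_proj_apply {e : H →L[ℂ] H} (he : IsStarProjection e) (x : H) :
    ⟪x, e x⟫_ℂ = ((‖e x‖ ^ 2 : ℝ) : ℂ) := by
  have h1 : e (e x) = e x := congrArg (fun A : H →L[ℂ] H => A x) he.isIdempotentElem
  rw [← h1, ← inner_apply_comm he.isSelfAdjoint, h1, inner_self_eq_norm_sq_to_K]
  simp

theorem gammaTrace_starProjection (V : Submodule ℂ H) :
    gammaTrace V.topologicalClosure.starProjection = ((H.gammaDim V).toReal : ℂ) := by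
  rw [gammaDim_eq, ENNReal.tsum_toReal_eq fun _ => ENNReal.ofReal_ne_top]
  simp only [ENNReal.toReal_ofReal (sq_nonneg _)]
  rw [Complex.ofReal_tsum, gammaTrace]
  exact tsum_congr fun i => star_proj_apply isStarProjection_starProjection _

/-- The spectral projections `ε (T + ε)⁻¹` of `T ≥ 0` converge to the projection onto `ker T`. -/
theorem exists_resolvents {T : H →L[ℂ] H} (hT : 0 ≤ T) (hTe : IsEquivariant T) :
    ∃ (D : ℕ → H →L[ℂ] H) (r : ℕ → ℂ), (∀ n, IsEquivariant (D n)) ∧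
      (∀ n, D n * (T + r n • 1) = 1) ∧ (∀ n, (T + r n • 1) * D n = 1) ∧
      (∀ n, ‖r n • D n‖ ≤ 1) ∧ Filter.Tendsto (fun n => ‖r n‖) Filter.atTop (𝓝 0) ∧
      ∀ n, r n = ((1 / ((n : ℝ) + 1) : ℝ) : ℂ) := by
  set r : ℕ → ℝ := fun n => 1 / ((n : ℝ) + 1) with hr
  have hrpos : ∀ n, 0 < r n := fun n => by positivity
  have hex : ∀ n, ∃ D : H →L[ℂ] H, D * (T + (r n : ℂ) • 1) = 1 ∧ (T + (r n : ℂ) • 1) * D = 1 ∧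
      IsSelfAdjoint D ∧ ‖D‖ ≤ (r n)⁻¹ := fun n => by
    refine exists_inverse_of_coercive (hT.isSelfAdjoint.add
      (IsSelfAdjoint.smul (by simp [isSelfAdjoint_iff]) (IsSelfAdjoint.one _))) (hrpos n)
      fun x => ?_
    have h1 : (T + (r n : ℂ) • (1 : H →L[ℂ] H)) x = T x + (r n : ℂ) • x := rfl
    have h2 : (⟪x, x⟫_ℂ).re = ‖x‖ ^ 2 := inner_self_eq_norm_sq (𝕜 := ℂ) x
    rw [h1, inner_add_left, inner_smul_left, Complex.conj_ofReal, Complex.add_re,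
      Complex.re_ofReal_mul, h2]
    linarith [re_inner_nonneg_of_nonneg hT x]
  choose D hDM hMD hDs hDn using hex
  refine ⟨D, fun n => (r n : ℂ), fun n => ?_, hDM, hMD, fun n => ?_, ?_, fun n => rfl⟩
  · exact isEquivariant_iff_commute.2 fun γ => commute_of_inverse (hDM n) (hMD n)
      (isEquivariant_iff_commute.1 (hTe.add (isEquivariant_one.smul _)) γ)
  · rw [norm_smul, Complex.norm_real, Real.norm_of_nonneg (hrpos n).le]
    calc r n * ‖D n‖ ≤ r n * (r n)⁻¹ := by gcongr; exact hDn n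
      _ = 1 := mul_inv_cancel₀ (hrpos n).ne'
  · have : (fun n => ‖(r n : ℂ)‖) = r := by
      funext n; rw [Complex.norm_real, Real.norm_of_nonneg (hrpos n).le]
    rw [this]
    exact tendsto_one_div_add_atTop_nhds_zero_nat

/-- `r D` is the identity on `ker T`, and on `ran T` it equals `r (y - r D y)` at `T y`, which tends
to 0. The uniform bound extends this to the closure of `ran T`, the orthogonal complement of the
kernel. -/
theorem tendsto_resolvent {T : H →L[ℂ] H} (hT : 0 ≤ T) {D : ℕ → H →L[ℂ] H} {r : ℕ → ℂ}
    (hDM : ∀ n, D n * (T + r n • 1) = 1) (hn : ∀ n, ‖r n • D n‖ ≤ 1)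
    (hr : Filter.Tendsto (fun n => ‖r n‖) Filter.atTop (𝓝 0)) (x : H) :
    Filter.Tendsto (fun n => (r n • D n) x) Filter.atTop
      (𝓝 (T.ker.topologicalClosure.starProjection x)) := by
  set e := T.ker.topologicalClosure.starProjection with he
  have hDx : ∀ n y, D n (T y) = y - (r n • D n) y := fun n y => by
    have h1 : D n (T y + r n • y) = y := congrArg (fun A : H →L[ℂ] H => A y) (hDM n)
    rw [map_add, map_smul] at h1
    rw [eq_sub_iff_add_eq]; exact h1
  have hker : T (e x) = 0 := by
    have : e x ∈ T.ker.topologicalClosure := Submodule.starProjection_apply_mem _ _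
    rwa [topologicalClosure_ker] at this
  have hEe : ∀ n, (r n • D n) (e x) = e x := fun n => by
    have := hDx n (e x)
    rw [hker, map_zero] at this
    exact (sub_eq_zero.1 this.symm).symm
  have horth : x - e x ∈ T.range.topologicalClosure := by
    have h1 : x - e x ∈ T.ker.topologicalClosureᗮ := Submodule.sub_starProjection_mem_orthogonal _
    rw [topologicalClosure_ker, ContinuousLinearMap.orthogonal_ker,
      hT.isSelfAdjoint.adjoint_eq] at h1
    exact h1
  rw [Metric.tendsto_atTop]
  intro δ hδ
  obtain ⟨_, ⟨y, rfl⟩, hy⟩ := Metric.mem_closure_iff.1 horth (δ / 2) (by positivity)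
  rw [dist_eq_norm] at hy
  obtain ⟨N, hN⟩ := (Metric.tendsto_atTop.1 hr) (δ / (4 * (‖y‖ + 1))) (by positivity)
  refine ⟨N, fun n hn' => ?_⟩
  have h1 := hN n hn'
  rw [Real.dist_eq, sub_zero, abs_norm] at h1
  have h2 : (r n • D n) x - e x = (r n • D n) (x - e x - T y) + r n • (y - (r n • D n) y) := by
    rw [← hDx n y, map_sub, map_sub, hEe]
    change _ = _ - r n • D n (T y) + r n • D n (T y)
    abel
  rw [dist_eq_norm, h2]
  have hE : ∀ z, ‖(r n • D n) z‖ ≤ ‖z‖ := fun z =>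
    ((r n • D n).le_opNorm z).trans (mul_le_of_le_one_left (norm_nonneg _) (hn n))
  have h3 : ‖r n • (y - (r n • D n) y)‖ ≤ δ / 2 := by
    rw [norm_smul]
    have h4 : ‖y - (r n • D n) y‖ ≤ 2 * ‖y‖ := by
      have := (norm_sub_le y ((r n • D n) y)).trans (add_le_add_right (hE y) _)
      linarith
    calc ‖r n‖ * ‖y - (r n • D n) y‖ ≤ δ / (4 * (‖y‖ + 1)) * (2 * ‖y‖) := by
          gcongr
      _ = δ / 2 * (‖y‖ / (‖y‖ + 1)) := by field_simp; ring
      _ ≤ δ / 2 * 1 := by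
        gcongr
        rw [div_le_one (by positivity)]; linarith
      _ = δ / 2 := mul_one _
  calc _ ≤ ‖(r n • D n) (x - e x - T y)‖ + ‖r n • (y - (r n • D n) y)‖ := norm_add_le _ _
    _ < δ / 2 + δ / 2 := add_lt_add_of_lt_of_le ((hE _).trans_lt hy) h3
    _ = δ := add_halves δ

/-- The `Γ`-index of an operator `A : ran Q → ran P`. -/
def cornerIndex (P Q A : H →L[ℂ] H) : ℝ :=
  (H.gammaDim (A.ker ⊓ Q.range)).toReal - (H.gammaDim (A.adjoint.ker ⊓ P.range)).toReal

/-- `B : ran P → ran Q` is an inverse modulo trace class operators of `A : ran Q → ran P`. -/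
structure IsParametrix (P Q A B : H →L[ℂ] H) : Prop where
  projL : IsStarProjection P
  projR : IsStarProjection Q
  equivL : IsEquivariant P
  equivR : IsEquivariant Q
  equivA : IsEquivariant A
  equivB : IsEquivariant B
  hPA : P * A = A
  hAQ : A * Q = A
  hQB : Q * B = B
  hBP : B * P = B
  left : Q - B * A ∈ H.traceClass
  right : P - A * B ∈ H.traceClass

theorem IsParametrix.symm {P Q A B : H →L[ℂ] H} (h : IsParametrix P Q A B) :
    IsParametrix Q P B A :=
  ⟨h.projR, h.projL, h.equivR, h.equivL, h.equivB, h.equivA, h.hQB, h.hBP, h.hPA, h.hAQ, h.right,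
    h.left⟩

/-- The quadratic form of the operator is `‖A x‖² + ‖x - Q x‖²`. Adding `1 - Q` lets the kernel of
the corner operator be computed on the whole space. -/
theorem ker_adjoint_mul_self_add {Q A : H →L[ℂ] H} (hQ : IsStarProjection Q) :
    (star A * A + (1 - Q)).ker = A.ker ⊓ Q.range := by
  have hQQ : ∀ x, Q (Q x) = Q x := fun x =>
    congrArg (fun A : H →L[ℂ] H => A x) hQ.isIdempotentElem
  ext x
  rw [Submodule.mem_inf]
  constructor
  · intro hx
    have h1 : star A (A x) + (x - Q x) = 0 := hx
    have h2 : ⟪star A (A x), x⟫_ℂ = ((‖A x‖ ^ 2 : ℝ) : ℂ) := by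
      rw [ContinuousLinearMap.star_eq_adjoint, ContinuousLinearMap.adjoint_inner_left,
        inner_self_eq_norm_sq_to_K]; simp
    have h3 : ⟪x - Q x, x⟫_ℂ = ((‖x - Q x‖ ^ 2 : ℝ) : ℂ) := by
      have := star_proj_apply hQ.one_sub x
      rw [← inner_apply_comm hQ.one_sub.isSelfAdjoint] at this
      exact this
    have h4 : ‖A x‖ ^ 2 + ‖x - Q x‖ ^ 2 = 0 := by
      have : ⟪star A (A x) + (x - Q x), x⟫_ℂ = 0 := by rw [h1, inner_zero_left]
      rw [inner_add_left, h2, h3] at this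
      exact_mod_cast this
    have h5 : ‖A x‖ = 0 := by nlinarith [sq_nonneg ‖A x‖, sq_nonneg ‖x - Q x‖]
    have h6 : ‖x - Q x‖ = 0 := by nlinarith [sq_nonneg ‖A x‖, sq_nonneg ‖x - Q x‖]
    exact ⟨norm_eq_zero.1 h5, x, (sub_eq_zero.1 (norm_eq_zero.1 h6)).symm⟩
  · rintro ⟨hx, y, rfl⟩
    have hx' : A (Q y) = 0 := hx
    change star A (A (Q y)) + (Q y - Q (Q y)) = 0
    rw [hx', map_zero, hQQ, sub_self, add_zero]

theorem adjoint_mul_self_add_nonneg {Q A : H →L[ℂ] H} (hQ : IsStarProjection Q) :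
    0 ≤ star A * A + (1 - Q) :=
  add_nonneg (star_mul_self_nonneg A) hQ.one_sub.nonneg

/-- The kernels are reached as strong limits of `r (T + r)⁻¹` and `r (T' + r)⁻¹`. Before the limit
the two traces differ from those of `R` and `R'` by the same amount; in the limit this yields `Tr R
- dim ker = Tr R' - dim coker`. No polar decomposition or closed range enters. -/
theorem IsParametrix.cornerIndex_eq {P Q A B : H →L[ℂ] H} (h : IsParametrix P Q A B) :
    (cornerIndex P Q A : ℂ) = gammaTrace (Q - B * A) - gammaTrace (P - A * B) := by
  have hQQ : Q * Q = Q := h.projR.isIdempotentElem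
  have hPP : P * P = P := h.projL.isIdempotentElem
  have hsA : IsEquivariant (star A) := h.equivA.star
  have hQA : Q * star A = star A := by
    have := congrArg star h.hAQ
    rwa [star_mul, h.projR.isSelfAdjoint.star_eq] at this
  have hAP : star A * P = star A := by
    have := congrArg star h.hPA
    rwa [star_mul, h.projL.isSelfAdjoint.star_eq] at this
  set R := Q - B * A with hR
  set R' := P - A * B with hR'
  have hQR : Q * R = R := by rw [hR, mul_sub, hQQ, ← mul_assoc, h.hQB]
  have hPR' : P * R' = R' := by rw [hR', mul_sub, hPP, ← mul_assoc, h.hPA]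
  set T := star A * A + (1 - Q) with hT
  set T' := A * star A + (1 - P) with hT'
  have hTpos : 0 ≤ T := adjoint_mul_self_add_nonneg h.projR
  have hT'pos : 0 ≤ T' := by
    have := adjoint_mul_self_add_nonneg (A := star A) h.projL
    rwa [star_star] at this
  have hTe : IsEquivariant T := (hsA.mul h.equivA).add (isEquivariant_one.sub h.equivR)
  have hT'e : IsEquivariant T' := (h.equivA.mul hsA).add (isEquivariant_one.sub h.equivL)
  obtain ⟨D, r, hDe, hDM, hMD, hDn, hr, hr'⟩ := exists_resolvents hTpos hTe
  obtain ⟨D', r₁, hDe', hDM', hMD', hDn', hr₁, hr₁'⟩ := exists_resolvents hT'pos hT'e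
  obtain rfl : r₁ = r := funext fun n => (hr₁' n).trans (hr' n).symm
  set e := T.ker.topologicalClosure.starProjection with he
  set e' := T'.ker.topologicalClosure.starProjection with he'
  have hker : T.ker = A.ker ⊓ Q.range := ker_adjoint_mul_self_add h.projR
  have hker' : T'.ker = A.adjoint.ker ⊓ P.range := by
    have := ker_adjoint_mul_self_add (A := star A) h.projL
    rwa [star_star] at this
  have hinv : ∀ {T : H →L[ℂ] H}, IsEquivariant T → ∀ (γ : Γ) (x : H), x ∈ T.ker →
      H.ρ γ x ∈ T.ker := fun {T} hT γ x hx => by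
    have hx' : T x = 0 := hx
    change T (H.ρ γ x) = 0
    rw [hT, hx', map_zero]
  have hee : IsEquivariant e :=
    isEquivariant_starProjection (topologicalClosure_invariant (hinv hTe))
  have hee' : IsEquivariant e' :=
    isEquivariant_starProjection (topologicalClosure_invariant (hinv hT'e))
  have hmem : ∀ x, e x ∈ A.ker ⊓ Q.range := fun x => by
    rw [← hker, ← topologicalClosure_ker]; exact Submodule.starProjection_apply_mem _ _
  have hmem' : ∀ x, e' x ∈ A.adjoint.ker ⊓ P.range := fun x => by
    rw [← hker', ← topologicalClosure_ker]; exact Submodule.starProjection_apply_mem _ _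
  have hAe : A * e = 0 := by ext x; exact (hmem x).1
  have hQe : Q * e = e := by
    ext x
    obtain ⟨y, hy⟩ := (hmem x).2
    change Q (e x) = e x
    rw [← hy]
    exact congrArg (fun A : H →L[ℂ] H => A y) hQQ
  have hAe' : star A * e' = 0 := by ext x; exact (hmem' x).1
  have hPe' : P * e' = e' := by
    ext x
    obtain ⟨y, hy⟩ := (hmem' x).2
    change P (e' x) = e' x
    rw [← hy]
    exact congrArg (fun A : H →L[ℂ] H => A y) hPP
  have hRe : R * e = e := by rw [hR, sub_mul, hQe, mul_assoc, hAe, mul_zero, sub_zero]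
  have heR' : e' * R' = e' := by
    have h1 : e' * A = 0 := by
      have := congrArg star hAe'
      rwa [star_mul, star_star, star_zero, isStarProjection_starProjection.isSelfAdjoint.star_eq]
        at this
    have h2 : e' * P = e' := by
      have := congrArg star hPe'
      rwa [star_mul, isStarProjection_starProjection.isSelfAdjoint.star_eq,
        h.projL.isSelfAdjoint.star_eq] at this
    rw [hR', mul_sub, h2, ← mul_assoc, h1, zero_mul, sub_zero]
  -- With `A R = R' A` and `A D = D' A`, the two sides are the traces of `D A* R' A` and of `A D A*
  -- R'`, equal by cyclicity.
  have key : ∀ n, gammaTrace R - gammaTrace ((r₁ n • D n) * R) =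
      gammaTrace R' - gammaTrace ((r₁ n • D' n) * R') := by
    intro n
    have hD : ∀ {T D : H →L[ℂ] H}, D * (T + r₁ n • 1) = 1 → 1 - r₁ n • D = D * T := by
      intro T D hD
      rw [mul_add, mul_smul_comm, mul_one] at hD
      rw [← hD]; abel
    have hAR : A * R = R' * A := by
      rw [hR, hR', mul_sub, sub_mul, h.hAQ, h.hPA, mul_assoc]
    have h1 : R - (r₁ n • D n) * R = D n * (star A * (R' * A)) := by
      have h2 : T * R = star A * (A * R) := by
        rw [hT, add_mul, sub_mul, one_mul, hQR, sub_self, add_zero, mul_assoc]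
      calc R - (r₁ n • D n) * R = (1 - r₁ n • D n) * R := by rw [sub_mul, one_mul]
        _ = D n * (T * R) := by rw [hD (hDM n), mul_assoc]
        _ = _ := by rw [h2, hAR]
    have hAD : A * D n = D' n * A := by
      have h3 : (T' + r₁ n • 1) * A = A * (T + r₁ n • 1) := by
        rw [hT, hT', add_mul, add_mul, mul_add, mul_add, sub_mul, mul_sub, h.hPA, h.hAQ, one_mul,
          mul_one, sub_self, smul_mul_assoc, mul_smul_comm, one_mul, mul_one, mul_assoc]
      calc A * D n = D' n * (T' + r₁ n • 1) * A * D n := by rw [hDM', one_mul]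
        _ = D' n * ((T' + r₁ n • 1) * A) * D n := by rw [mul_assoc (D' n)]
        _ = D' n * A * ((T + r₁ n • 1) * D n) := by rw [h3]; simp only [mul_assoc]
        _ = D' n * A := by rw [hMD, mul_one]
    have h1' : R' - (r₁ n • D' n) * R' = A * (D n * (star A * R')) := by
      have h2 : T' * R' = A * (star A * R') := by
        rw [hT', add_mul, sub_mul, one_mul, hPR', sub_self, add_zero, mul_assoc]
      calc R' - (r₁ n • D' n) * R' = (1 - r₁ n • D' n) * R' := by rw [sub_mul, one_mul]
        _ = D' n * (T' * R') := by rw [hD (hDM' n), mul_assoc]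
        _ = _ := by rw [h2, ← mul_assoc, ← hAD, mul_assoc]
    rw [← gammaTrace_sub h.left (mul_mem_traceClass_left ((hDe n).smul _) h.left),
      ← gammaTrace_sub h.right (mul_mem_traceClass_left ((hDe' n).smul _) h.right), h1, h1',
      gammaTrace_mul_comm h.equivA
        (mul_mem_traceClass_left (hDe n) (mul_mem_traceClass_left hsA h.right))]
    simp only [mul_assoc, hR']
  have hlim := tendsto_gammaTrace hee (fun n => (hDe n).smul (r₁ n)) hDn
    (tendsto_resolvent hTpos hDM hDn hr) h.left
  have hlim' := tendsto_gammaTrace hee' (fun n => (hDe' n).smul (r₁ n)) hDn'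
    (tendsto_resolvent hT'pos hDM' hDn' hr) h.right
  have hlim1 := hlim.const_sub (gammaTrace R)
  have hlim1' := hlim'.const_sub (gammaTrace R')
  rw [show (fun n => gammaTrace R' - gammaTrace ((r₁ n • D' n) * R')) =
    fun n => gammaTrace R - gammaTrace ((r₁ n • D n) * R) from
      funext fun n => (key n).symm] at hlim1'
  have heq := tendsto_nhds_unique hlim1 hlim1'
  -- The parametrix error is the identity on the kernel, `R e = e` and `e' R' = e'`, so the limit
  -- traces are the Γ-dimensions.
  rw [gammaTrace_mul_comm hee h.left, hRe, heR', gammaTrace_starProjection,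
    gammaTrace_starProjection, hker, hker'] at heq
  rw [cornerIndex, Complex.ofReal_sub]
  linear_combination -heq

theorem IsParametrix.cornerIndex_symm {P Q A B : H →L[ℂ] H} (h : IsParametrix P Q A B) :
    cornerIndex Q P B = -cornerIndex P Q A := by
  have h1 := h.cornerIndex_eq
  have h2 := h.symm.cornerIndex_eq
  have : (cornerIndex Q P B : ℂ) = -cornerIndex P Q A := by rw [h1, h2]; ring
  exact_mod_cast this

/-- Compared with the separate errors, the traces of the errors of `A A'` contain the extra terms
`Tr((Q - BA)(Q - A'B'))` and `Tr((Q - A'B')(Q - BA))`, which cancel by cyclicity. -/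
theorem IsParametrix.mul {P Q R A B A' B' : H →L[ℂ] H} (h : IsParametrix P Q A B)
    (h' : IsParametrix Q R A' B') :
    IsParametrix P R (A * A') (B' * B) ∧
      cornerIndex P R (A * A') = cornerIndex P Q A + cornerIndex Q R A' := by
  have hl : R - B' * B * (A * A') = (R - B' * A') + B' * (Q - B * A) * A' := by
    have : B' * Q * A' = B' * A' := by rw [h'.hBP]
    rw [mul_sub, sub_mul, this]
    simp only [mul_assoc]; abel
  have hr : P - A * A' * (B' * B) = (P - A * B) + A * (Q - A' * B') * B := by
    have : A * Q * B = A * B := by rw [h.hAQ]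
    rw [mul_sub, sub_mul, this]
    simp only [mul_assoc]; abel
  have hl1 := mul_mem_traceClass_left h'.equivB h.left
  have hl2 := mul_mem_traceClass_right h'.equivA hl1
  have hr1 := mul_mem_traceClass_left h.equivA h'.right
  have hr2 := mul_mem_traceClass_right h.equivB hr1
  have hpar : IsParametrix P R (A * A') (B' * B) := by
    refine ⟨h.projL, h'.projR, h.equivL, h'.equivR, h.equivA.mul h'.equivA,
      h'.equivB.mul h.equivB, ?_, ?_, ?_, ?_, ?_, ?_⟩
    · rw [← mul_assoc, h.hPA]
    · rw [mul_assoc, h'.hAQ]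
    · rw [← mul_assoc, h'.hQB]
    · rw [mul_assoc, h.hBP]
    · rw [hl]; exact add_mem h'.left hl2
    · rw [hr]; exact add_mem h.right hr2
  refine ⟨hpar, ?_⟩
  have e1 : gammaTrace (B' * (Q - B * A) * A') =
      gammaTrace (Q - B * A) - gammaTrace ((Q - B * A) * (Q - A' * B')) := by
    have hQ : (Q - B * A) * Q = Q - B * A := by
      rw [sub_mul, h.projR.isIdempotentElem, mul_assoc, h.hAQ]
    rw [mul_assoc, gammaTrace_mul_comm h'.equivB (mul_mem_traceClass_right h'.equivA h.left),
      ← gammaTrace_sub h.left (mul_mem_traceClass_left (isEquivariant_of_mem_traceClass h.left)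
        h'.right), mul_sub, hQ]
    congr 1
    rw [mul_assoc]; abel
  have e2 : gammaTrace (A * (Q - A' * B') * B) =
      gammaTrace (Q - A' * B') - gammaTrace ((Q - A' * B') * (Q - B * A)) := by
    have hQ : (Q - A' * B') * Q = Q - A' * B' := by
      rw [sub_mul, h.projR.isIdempotentElem, mul_assoc, h'.hBP]
    rw [mul_assoc, gammaTrace_mul_comm h.equivA (mul_mem_traceClass_right h.equivB h'.right),
      ← gammaTrace_sub h'.right (mul_mem_traceClass_left (isEquivariant_of_mem_traceClass h'.right)
        h.left), mul_sub, hQ]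
    congr 1
    rw [mul_assoc]; abel
  have e3 : gammaTrace ((Q - A' * B') * (Q - B * A)) = gammaTrace ((Q - B * A) * (Q - A' * B')) :=
    gammaTrace_mul_comm (isEquivariant_of_mem_traceClass h'.right) h.left
  have : (cornerIndex P R (A * A') : ℂ) = cornerIndex P Q A + cornerIndex Q R A' := by
    rw [hpar.cornerIndex_eq, h.cornerIndex_eq, h'.cornerIndex_eq, hl, hr,
      gammaTrace_add h'.left hl2, gammaTrace_add h.right hr2, e1, e2, e3]
    ring
  exact_mod_cast this

theorem exists_inverse_one_add {C : H →L[ℂ] H} (hC : IsEquivariant C) (h : ‖C‖ < 1) :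
    ∃ g : H →L[ℂ] H, g * (1 + C) = 1 ∧ (1 + C) * g = 1 ∧ IsEquivariant g ∧
      ‖g‖ ≤ (1 - ‖C‖)⁻¹ := by
  have hu : IsUnit (1 + C) := by
    rw [← sub_neg_eq_add]; exact isUnit_one_sub_of_norm_lt_one (by rwa [norm_neg])
  obtain ⟨g, h1, h2⟩ := isUnit_iff_exists.1 hu
  refine ⟨g, h2, h1, isEquivariant_iff_commute.2 fun γ => commute_of_inverse h2 h1
    (isEquivariant_iff_commute.1 (isEquivariant_one.add hC) γ), ?_⟩
  refine ContinuousLinearMap.opNorm_le_bound _ (inv_nonneg.2 (sub_nonneg.2 h.le)) fun x => ?_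
  rw [inv_mul_eq_div, le_div_iff₀ (sub_pos.2 h)]
  have h3 : g x + C (g x) = x := congrArg (fun A : H →L[ℂ] H => A x) h1
  have h4 : ‖g x‖ ≤ ‖x‖ + ‖C (g x)‖ := by
    calc ‖g x‖ = ‖x - C (g x)‖ := congrArg norm (eq_sub_of_add_eq h3)
      _ ≤ _ := norm_sub_le _ _
  have h5 := C.le_opNorm (g x)
  nlinarith

/-- The index is invariant under perturbations which are small modulo trace class operators. -/
theorem IsParametrix.cornerIndex_eq_of_near {P Q A B A' B' C F : H →L[ℂ] H}
    (h : IsParametrix P Q A B) (h' : IsParametrix P Q A' B') (hC : IsEquivariant C)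
    (hC1 : ‖C‖ < 1) (hF : F ∈ H.traceClass) (hBA : B * A' = Q + C + F) :
    cornerIndex P Q A' = cornerIndex P Q A := by
  have hQQ : Q * Q = Q := h.projR.isIdempotentElem
  set c := Q * C * Q with hc
  set f := Q * F * Q with hf
  have hQc : Q * c = c := by simp only [hc, ← mul_assoc, hQQ]
  have hcQ : c * Q = c := by simp only [hc, mul_assoc, hQQ]
  have hQf : Q * f = f := by simp only [hf, ← mul_assoc, hQQ]
  have hfQ : f * Q = f := by simp only [hf, mul_assoc, hQQ]
  have hBA' : B * A' = Q + c + f := by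
    calc B * A' = Q * (B * A') * Q := by rw [← mul_assoc, h.hQB, mul_assoc, h'.hAQ]
      _ = Q + c + f := by rw [hBA, mul_add, mul_add, add_mul, add_mul, hQQ, hQQ]
  have hce : IsEquivariant c := (h.equivR.mul hC).mul h.equivR
  have hfe : f ∈ H.traceClass :=
    mul_mem_traceClass_right h.equivR (mul_mem_traceClass_left h.equivR hF)
  have hQn : ‖Q‖ ≤ 1 := h.projR.norm_le
  have hc1 : ‖c‖ < 1 := by
    calc ‖c‖ ≤ ‖Q‖ * ‖C‖ * ‖Q‖ :=
          (norm_mul_le _ _).trans (by gcongr; exact norm_mul_le _ _)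
      _ ≤ 1 * ‖C‖ * 1 := by gcongr
      _ < 1 := by simpa using hC1
  obtain ⟨g, hg1, hg2, hge, -⟩ := exists_inverse_one_add hce hc1
  have hQg : Q * g = g * Q := by
    have : Commute Q (1 + c) := (Commute.one_right Q).add_right (by
      change Q * c = c * Q; rw [hQc, hcQ])
    exact commute_of_inverse hg1 hg2 this
  have hQ1c : Q + c = (1 + c) * Q := by rw [add_mul, one_mul, hcQ]
  have hQ1c' : Q + c = Q * (1 + c) := by rw [mul_add, mul_one, hQc]
  have hl : Q - g * Q * (B * A') = -(g * f) := by
    have : g * Q * (Q + c + f) = Q + g * f := by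
      rw [mul_add, mul_assoc g Q f, hQf, ← hQg, mul_assoc Q g, hQ1c, ← mul_assoc g, hg1, one_mul,
        hQQ]
    rw [hBA', this]; abel
  have hr : Q - B * A' * (g * Q) = -(f * g) := by
    have : (Q + c + f) * (g * Q) = Q + f * g := by
      rw [add_mul, ← hQg, ← mul_assoc f Q g, hfQ, hQ1c', hQg, ← mul_assoc, mul_assoc Q, hg2,
        mul_one, hQQ]
    rw [hBA', this]; abel
  -- `g` inverts `1 + c` exactly, leaving the errors `-g f` and `-f g`. They have the same trace, so
  -- `B A'` has index 0, and this index is `Ind A' - Ind A`.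
  have hpar : IsParametrix Q Q (B * A') (g * Q) := by
    refine ⟨h.projR, h.projR, h.equivR, h.equivR, h.equivB.mul h'.equivA, hge.mul h.equivR,
      ?_, ?_, ?_, ?_, ?_, ?_⟩
    · rw [← mul_assoc, h.hQB]
    · rw [mul_assoc, h'.hAQ]
    · rw [← mul_assoc, hQg, mul_assoc, hQQ]
    · rw [mul_assoc, hQQ]
    · rw [hl]; exact neg_mem (mul_mem_traceClass_left hge hfe)
    · rw [hr]; exact neg_mem (mul_mem_traceClass_right hge hfe)
  have h0 : (cornerIndex Q Q (B * A') : ℂ) = 0 := by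
    rw [hpar.cornerIndex_eq, hl, hr, gammaTrace_neg, gammaTrace_neg, gammaTrace_mul_comm hge hfe,
      sub_self]
  have h1 : cornerIndex Q Q (B * A') = 0 := by exact_mod_cast h0
  rw [(h.symm.mul h').2, h.cornerIndex_symm] at h1
  linarith

end Index

variable {Γ : Type v} [Group Γ]

/-! ### Relative indices of pairs of projections. -/

section Pair

variable {H : HilbertModule.{u} Γ}

/-- Orthogonal projections in `B_Γ(H)`. -/
structure IsEquivariantProj (P : H →L[ℂ] H) : Prop where
  proj : IsStarProjection P
  equiv : IsEquivariant P

theorem norm_compress_le {P C : H →L[ℂ] H} (hP : IsStarProjection P) : ‖P * C * P‖ ≤ ‖C‖ := by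
  have hn : ‖P‖ ≤ 1 := hP.norm_le
  calc ‖P * C * P‖ ≤ ‖P‖ * ‖C‖ * ‖P‖ :=
        (norm_mul_le _ _).trans (by gcongr; exact norm_mul_le _ _)
    _ ≤ 1 * ‖C‖ * 1 := by gcongr
    _ = ‖C‖ := by ring

/-- If `P - Q = C + F` with `‖C‖ < 1` and `F` of trace class, then `QP` has a left inverse modulo
trace class operators on `ran Q`. -/
theorem exists_left_parametrix {P Q C F : H →L[ℂ] H}
    (hQ : IsEquivariantProj Q) (hC : IsEquivariant C) (hF : F ∈ H.traceClass)
    (hPQ : P - Q = C + F) (hC1 : ‖C‖ < 1) :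
    ∃ D : H →L[ℂ] H, IsEquivariant D ∧ Commute Q D ∧ ‖D‖ ≤ (1 - ‖C‖)⁻¹ ∧
      Q - D * (Q * P * Q) ∈ H.traceClass ∧ Q - Q * P * Q * D ∈ H.traceClass := by
  have hQQ : Q * Q = Q := hQ.proj.isIdempotentElem
  have hc1 : ‖Q * C * Q‖ ≤ ‖C‖ := norm_compress_le hQ.proj
  have hce : IsEquivariant (Q * C * Q) := (hQ.equiv.mul hC).mul hQ.equiv
  obtain ⟨D, hD1, hD2, hDe, hDn⟩ := exists_inverse_one_add hce (hc1.trans_lt hC1)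
  have hcomm : Commute Q D := by
    refine commute_of_inverse hD1 hD2 ((Commute.one_right Q).add_right ?_)
    change Q * (Q * C * Q) = Q * C * Q * Q
    rw [mul_assoc (Q * C), hQQ, ← mul_assoc, ← mul_assoc, hQQ]
  have hQPQ : Q * P * Q = (1 + Q * C * Q) * Q + Q * F * Q := by
    have : P = Q + (C + F) := by rw [← hPQ]; abel
    rw [this, mul_add, mul_add, add_mul, add_mul, hQQ, hQQ, add_mul, one_mul, mul_assoc (Q * C),
      hQQ]
    abel
  have hQPQ' : Q * P * Q = Q * (1 + Q * C * Q) + Q * F * Q := by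
    have : Q * (1 + Q * C * Q) = (1 + Q * C * Q) * Q := by
      rw [mul_add, add_mul, mul_one, one_mul, ← mul_assoc, ← mul_assoc, hQQ, mul_assoc (Q * C), hQQ]
    rw [this, hQPQ]
  have hFt : Q * F * Q ∈ H.traceClass :=
    mul_mem_traceClass_right hQ.equiv (mul_mem_traceClass_left hQ.equiv hF)
  refine ⟨D, hDe, hcomm, hDn.trans ?_, ?_, ?_⟩
  · have : 0 < 1 - ‖C‖ := sub_pos.2 hC1
    gcongr
  · rw [hQPQ, mul_add, ← mul_assoc, hD1, one_mul, sub_add_cancel_left]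
    exact neg_mem (mul_mem_traceClass_left hDe hFt)
  · rw [hQPQ', add_mul, mul_assoc, hD2, mul_one, sub_add_cancel_left]
    exact neg_mem (mul_mem_traceClass_right hDe hFt)

theorem exists_isParametrix {P Q : H →L[ℂ] H} (hP : IsEquivariantProj P)
    (hQ : IsEquivariantProj Q) {c : ℝ} (hc : c < 1) (h : calkinNorm (P - Q) < c) :
    ∃ B, IsParametrix P Q (P * Q) B ∧ ‖B‖ ≤ (1 - c)⁻¹ := by
  have hQQ : Q * Q = Q := hQ.proj.isIdempotentElem
  have hPP : P * P = P := hP.proj.isIdempotentElem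
  obtain ⟨C, F, hCe, hF, hPQ, hCn⟩ :=
    exists_eq_add_traceClass_of_calkinNorm_lt (hP.equiv.sub hQ.equiv) h
  obtain ⟨D, hDe, hDQ, hDn, hDl, -⟩ :=
    exists_left_parametrix hQ hCe hF hPQ (hCn.trans hc)
  obtain ⟨D', hDe', hDP', -, -, hDr'⟩ :=
    exists_left_parametrix (C := -C) (F := -F) hP hCe.neg (neg_mem hF)
      (by rw [← neg_sub, hPQ]; abel) (by rw [norm_neg]; exact hCn.trans hc)
  set B := D * (Q * P) with hB
  set B' := Q * P * D' with hB'
  have hBe : IsEquivariant B := hDe.mul (hQ.equiv.mul hP.equiv)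
  have hBe' : IsEquivariant B' := (hQ.equiv.mul hP.equiv).mul hDe'
  have hAe : IsEquivariant (P * Q) := hP.equiv.mul hQ.equiv
  have hQB : Q * B = B := by
    rw [hB, ← mul_assoc, hDQ.eq, mul_assoc, ← mul_assoc Q Q, hQQ]
  have hBP : B * P = B := by rw [hB, mul_assoc, mul_assoc, hPP]
  have hQB' : Q * B' = B' := by rw [hB', ← mul_assoc, ← mul_assoc, hQQ]
  have hleft : Q - B * (P * Q) ∈ H.traceClass := by
    have : B * (P * Q) = D * (Q * P * Q) := by
      rw [← mul_assoc, hBP, hB, mul_assoc]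
    rwa [this]
  have hright' : P - P * Q * B' ∈ H.traceClass := by
    have : P * Q * B' = P * Q * P * D' := by
      rw [mul_assoc, hQB', hB']; simp only [mul_assoc]
    rwa [this]
  -- A left and a right inverse agree modulo the ideal, so the left parametrix is two-sided. `B`
  -- rather than `B'` is kept since its norm is controlled by that of `D`.
  have hdiff : B - B' ∈ H.traceClass := by
    have : B - B' = B * (P - P * Q * B') - (Q - B * (P * Q)) * B' := by
      rw [mul_sub, sub_mul, hBP, hQB', ← mul_assoc]; abel
    rw [this]
    exact sub_mem (mul_mem_traceClass_left hBe hright') (mul_mem_traceClass_right hBe' hleft)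
  have hright : P - P * Q * B ∈ H.traceClass := by
    have : P - P * Q * B = (P - P * Q * B') - P * Q * (B - B') := by
      rw [mul_sub]; abel
    rw [this]
    exact sub_mem hright' (mul_mem_traceClass_left hAe hdiff)
  refine ⟨B, ⟨hP.proj, hQ.proj, hP.equiv, hQ.equiv, hAe, hBe, by rw [← mul_assoc, hPP],
    by rw [mul_assoc, hQQ], hQB, hBP, hleft, hright⟩, ?_⟩
  have hPn : ‖P‖ ≤ 1 := hP.proj.norm_le
  have hQn : ‖Q‖ ≤ 1 := hQ.proj.norm_le
  have hc' : 0 < 1 - c := sub_pos.2 hc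
  have hC' : 0 < 1 - ‖C‖ := by linarith
  calc ‖B‖ ≤ ‖D‖ * (‖Q‖ * ‖P‖) := (norm_mul_le _ _).trans (by gcongr; exact norm_mul_le _ _)
    _ ≤ ‖D‖ * (1 * 1) := by gcongr
    _ = ‖D‖ := by ring
    _ ≤ (1 - ‖C‖)⁻¹ := hDn
    _ ≤ (1 - c)⁻¹ := by gcongr

theorem isFredholmPair_of_calkinNorm_lt_one {P Q : H →L[ℂ] H} (hP : IsEquivariantProj P)
    (hQ : IsEquivariantProj Q) (h : calkinNorm (P - Q) < 1) : IsFredholmPair P Q := by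
  obtain ⟨c, hc, hc1⟩ := exists_between h
  obtain ⟨B, hB, -⟩ := exists_isParametrix hP hQ hc1 hc
  refine ⟨hP.equiv, hQ.equiv, hP.proj, hQ.proj, B, hB.equivB, ?_, ?_, ?_⟩
  · rw [hB.hQB, hB.hBP]
  · rw [← neg_sub]; exact neg_mem_gammaCompact (mem_gammaCompact_of_mem_traceClass hB.left)
  · rw [← neg_sub]; exact neg_mem_gammaCompact (mem_gammaCompact_of_mem_traceClass hB.right)

theorem relIndex_eq_cornerIndex (P Q : H →L[ℂ] H) : relIndex P Q = cornerIndex P Q (P * Q) := rfl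

/-- Additivity of the relative index. -/
theorem relIndex_add {P Q R : H →L[ℂ] H} (hP : IsEquivariantProj P) (hQ : IsEquivariantProj Q)
    (hR : IsEquivariantProj R) {d δ : ℝ} (hd : d < 1) (hPQ : calkinNorm (P - Q) < d)
    (hQR : calkinNorm (Q - R) < δ) (hδ : δ ≤ (1 - d) / 2) :
    relIndex P R = relIndex P Q + relIndex Q R := by
  have hRR : R * R = R := hR.proj.isIdempotentElem
  have hQQ : Q * Q = Q := hQ.proj.isIdempotentElem
  have hd0 : 0 < d := (calkinNorm_nonneg _).trans_lt hPQ
  have hδ0 : 0 < δ := (calkinNorm_nonneg _).trans_lt hQR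
  have hδ1 : δ < 1 / 2 := by linarith
  have hPR : calkinNorm (P - R) < d + δ := by
    have := calkinNorm_add_lt hPQ hQR
    rwa [sub_add_sub_cancel] at this
  obtain ⟨B, hB, hBn⟩ := exists_isParametrix hP hQ hd hPQ
  obtain ⟨B', hB', hBn'⟩ := exists_isParametrix hQ hR (by linarith) hQR
  obtain ⟨B'', hB'', -⟩ := exists_isParametrix hP hR (by linarith) hPR
  obtain ⟨hmul, hadd⟩ := hB.mul hB'
  obtain ⟨C, F, hCe, hF, hCF, hCn⟩ :=
    exists_eq_add_traceClass_of_calkinNorm_lt (hQ.equiv.sub hR.equiv) hQR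
  rw [relIndex_eq_cornerIndex, relIndex_eq_cornerIndex, relIndex_eq_cornerIndex, ← hadd]
  set N := B' * B * (P * (1 - Q)) with hN
  have hNe : IsEquivariant N := (hB'.equivB.mul hB.equivB).mul
    (hP.equiv.mul (isEquivariant_one.sub hQ.equiv))
  -- `P Q · Q R` differs from `P R` by a multiple of `Q - R`, small modulo trace class. So `P R` has
  -- the index of the product, which is the sum of the indices.
  have hdecomp : P * R = P * Q * (Q * R) - P * (1 - Q) * (C + F) * R := by
    rw [← hCF]
    have h1 : P * (1 - Q) * (Q - R) * R = P * Q * R - P * R := by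
      have : (1 - Q) * (Q - R) = Q * R - R := by
        rw [sub_mul, one_mul, mul_sub, hQQ]; abel
      rw [mul_assoc P, this, mul_sub, sub_mul, mul_assoc P R R, hRR, mul_assoc P, mul_assoc Q R R,
        hRR, ← mul_assoc]
    rw [h1, ← mul_assoc, mul_assoc P Q Q, hQQ]; abel
  have hBA : B' * B * (P * R) = R + -(N * C * R) +
      (-(R - B' * B * (P * Q * (Q * R))) - N * F * R) := by
    rw [hdecomp, mul_sub, hN, mul_add, add_mul, mul_add]
    simp only [mul_assoc]
    abel
  have hPn : ‖P‖ ≤ 1 := hP.proj.norm_le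
  have hRn : ‖R‖ ≤ 1 := hR.proj.norm_le
  have hQn : ‖1 - Q‖ ≤ 1 := hQ.proj.one_sub.norm_le
  refine hmul.cornerIndex_eq_of_near hB'' ((hNe.mul hCe).mul hR.equiv).neg ?_ ?_ hBA
  · have h1 : 0 < 1 - d := by linarith
    have h2 : 0 < 1 - δ := by linarith
    have hNn : ‖N‖ ≤ (1 - δ)⁻¹ * (1 - d)⁻¹ := by
      calc ‖N‖ ≤ ‖B'‖ * ‖B‖ * (‖P‖ * ‖1 - Q‖) :=
            (norm_mul_le _ _).trans (by gcongr <;> exact norm_mul_le _ _)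
        _ ≤ (1 - δ)⁻¹ * (1 - d)⁻¹ * (1 * 1) := by gcongr
        _ = _ := by ring
    rw [norm_neg]
    calc ‖N * C * R‖ ≤ ‖N‖ * ‖C‖ * ‖R‖ :=
          (norm_mul_le _ _).trans (by gcongr; exact norm_mul_le _ _)
      _ ≤ ((1 - δ)⁻¹ * (1 - d)⁻¹) * δ * 1 := by gcongr
      -- `δ < 1/2` gives `(1 - δ)(1 - d) > (1 - d)/2 ≥ δ`; this is where the smallness required of
      -- `δ` comes from.
      _ < 1 := by
        rw [mul_one, ← mul_inv, inv_mul_eq_div, div_lt_one (by positivity)]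
        nlinarith
  · exact sub_mem (neg_mem hmul.left) (mul_mem_traceClass_right hR.equiv
      (mul_mem_traceClass_left hNe hF))

theorem gammaDim_bot : H.gammaDim ⊥ = 0 := by
  rw [gammaDim_eq]
  simp only [ENNReal.tsum_eq_zero, ENNReal.ofReal_eq_zero]
  intro i
  have h : (⊥ : Submodule ℂ H).topologicalClosure.starProjection (H.basisVec i) ∈
      (⊥ : Submodule ℂ H).topologicalClosure := Submodule.starProjection_apply_mem _ _
  have hcl : IsClosed ((⊥ : Submodule ℂ H) : Set H) := isClosed_singleton
  rw [(Submodule.mem_bot ℂ).1 (hcl.submodule_topologicalClosure_eq.le h)]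
  simp

/-- A nonzero `x` in `ran Q` with `P x = 0` would satisfy `‖(P - Q) x‖ = ‖x‖`. Thus both kernels are
trivial. -/
theorem relIndex_eq_zero_of_norm_sub_lt_one {P Q : H →L[ℂ] H} (hP : IsStarProjection P)
    (hQ : IsStarProjection Q) (h : ‖P - Q‖ < 1) : relIndex P Q = 0 := by
  have key : ∀ {P Q : H →L[ℂ] H}, IsStarProjection Q → ‖P - Q‖ < 1 →
      (P * Q).ker ⊓ Q.range = ⊥ := by
    intro P Q hQ h
    rw [eq_bot_iff]
    rintro _ ⟨hx, y, rfl⟩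
    have hQQ : Q (Q y) = Q y := congrArg (fun A : H →L[ℂ] H => A y) hQ.isIdempotentElem
    have h1 : P (Q (Q y)) = 0 := hx
    rw [hQQ] at h1
    have h2 : ‖Q y‖ ≤ ‖P - Q‖ * ‖Q y‖ := by
      calc ‖Q y‖ = ‖(P - Q) (Q y)‖ := by
            change _ = ‖P (Q y) - Q (Q y)‖
            rw [h1, hQQ, zero_sub, norm_neg]
        _ ≤ _ := (P - Q).le_opNorm _
    rw [Submodule.mem_bot]
    change Q y = 0
    by_contra hne
    have := norm_pos_iff.2 hne
    nlinarith
  have hadj : (P * Q).adjoint = Q * P := by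
    rw [← ContinuousLinearMap.star_eq_adjoint, star_mul, hP.isSelfAdjoint.star_eq,
      hQ.isSelfAdjoint.star_eq]
  rw [relIndex, hadj, key hQ h, key hP (by rwa [norm_sub_rev]), gammaDim_bot]
  simp

/-- Conjugation by a unitary in `B_Γ(H)`. -/
structure IsEquivariantUnitary (w : H →L[ℂ] H) : Prop where
  star_mul_self : star w * w = 1
  mul_star_self : w * star w = 1
  equiv : IsEquivariant w

theorem IsEquivariantUnitary.conj_mul {w : H →L[ℂ] H} (hw : IsEquivariantUnitary w)
    (A B : H →L[ℂ] H) : (star w * A * w) * (star w * B * w) = star w * (A * B) * w := by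
  have : (star w * A * w) * (star w * B * w) = star w * A * (w * star w) * B * w := by
    simp only [mul_assoc]
  rw [this, hw.mul_star_self, mul_one]
  simp only [mul_assoc]

theorem IsEquivariantUnitary.conj_sub {w : H →L[ℂ] H} (A B : H →L[ℂ] H) :
    star w * A * w - star w * B * w = star w * (A - B) * w := by
  rw [mul_sub, sub_mul]

theorem IsEquivariantUnitary.norm_le {w : H →L[ℂ] H} (hw : IsEquivariantUnitary w) : ‖w‖ ≤ 1 := by
  refine ContinuousLinearMap.opNorm_le_bound _ zero_le_one fun x => ?_
  rw [one_mul]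
  refine le_of_sq_le_sq (le_of_eq ?_) (norm_nonneg _)
  have h1 : ⟪w x, w x⟫_ℂ = ⟪x, x⟫_ℂ := by
    rw [← ContinuousLinearMap.adjoint_inner_right, ← ContinuousLinearMap.star_eq_adjoint]
    congr 1
    exact congrArg (fun A : H →L[ℂ] H => A x) hw.star_mul_self
  rw [← inner_self_eq_norm_sq (𝕜 := ℂ), h1, inner_self_eq_norm_sq (𝕜 := ℂ)]

theorem IsEquivariantUnitary.conj_proj {w P : H →L[ℂ] H} (hw : IsEquivariantUnitary w)
    (hP : IsEquivariantProj P) : IsEquivariantProj (star w * P * w) := by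
  refine ⟨⟨?_, ?_⟩, (hw.equiv.star.mul hP.equiv).mul hw.equiv⟩
  · change _ * _ = _
    rw [hw.conj_mul, hP.proj.isIdempotentElem.eq]
  · rw [isSelfAdjoint_iff, star_mul, star_mul, star_star, hP.proj.isSelfAdjoint.star_eq, mul_assoc]

theorem IsEquivariantUnitary.calkinNorm_conj_lt {w A : H →L[ℂ] H} (hw : IsEquivariantUnitary w)
    {c : ℝ} (h : calkinNorm A < c) : calkinNorm (star w * A * w) < c := by
  obtain ⟨C, K, hK, rfl, hC⟩ := calkinNorm_lt_iff.1 h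
  refine calkinNorm_lt_iff.2 ⟨star w * C * w, star w * K * w, mul_mem_gammaCompact_right hw.equiv
    (mul_mem_gammaCompact_left hw.equiv.star hK), by rw [mul_add, add_mul], lt_of_le_of_lt ?_ hC⟩
  have h1 := hw.norm_le
  calc ‖star w * C * w‖ ≤ ‖star w‖ * ‖C‖ * ‖w‖ :=
        (norm_mul_le _ _).trans (by gcongr; exact norm_mul_le _ _)
    _ ≤ 1 * ‖C‖ * 1 := by rw [norm_star]; gcongr
    _ = ‖C‖ := by ring

/-- Conjugating a parametrix conjugates both error terms, and the trace is invariant under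
conjugation by an equivariant unitary. -/
theorem IsEquivariantUnitary.relIndex_conj {w P Q : H →L[ℂ] H} (hw : IsEquivariantUnitary w)
    (hP : IsEquivariantProj P) (hQ : IsEquivariantProj Q) (h : calkinNorm (P - Q) < 1) :
    relIndex (star w * P * w) (star w * Q * w) = relIndex P Q := by
  obtain ⟨c, hc, hc1⟩ := exists_between h
  obtain ⟨B, hB, -⟩ := exists_isParametrix hP hQ hc1 hc
  have hP' := hw.conj_proj hP
  have hQ' := hw.conj_proj hQ
  have hmem : ∀ {A : H →L[ℂ] H}, A ∈ H.traceClass → star w * A * w ∈ H.traceClass := fun hA =>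
    mul_mem_traceClass_right hw.equiv (mul_mem_traceClass_left hw.equiv.star hA)
  have htr : ∀ {A : H →L[ℂ] H}, A ∈ H.traceClass →
      gammaTrace (star w * A * w) = gammaTrace A := fun {A} hA => by
    rw [mul_assoc, gammaTrace_mul_comm hw.equiv.star (mul_mem_traceClass_right hw.equiv hA),
      mul_assoc, hw.mul_star_self, mul_one]
  have hl : star w * Q * w - (star w * B * w) * (star w * (P * Q) * w) =
      star w * (Q - B * (P * Q)) * w := by rw [hw.conj_mul, conj_sub]
  have hr : star w * P * w - (star w * (P * Q) * w) * (star w * B * w) =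
      star w * (P - P * Q * B) * w := by rw [hw.conj_mul, conj_sub]
  have hpar : IsParametrix (star w * P * w) (star w * Q * w) (star w * (P * Q) * w)
      (star w * B * w) := by
    refine ⟨hP'.proj, hQ'.proj, hP'.equiv, hQ'.equiv, (hw.equiv.star.mul hB.equivA).mul hw.equiv,
      (hw.equiv.star.mul hB.equivB).mul hw.equiv, ?_, ?_, ?_, ?_, ?_, ?_⟩
    · rw [hw.conj_mul, hB.hPA]
    · rw [hw.conj_mul, hB.hAQ]
    · rw [hw.conj_mul, hB.hQB]
    · rw [hw.conj_mul, hB.hBP]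
    · rw [hl]; exact hmem hB.left
    · rw [hr]; exact hmem hB.right
  have h1 := hpar.cornerIndex_eq
  rw [hl, hr, htr hB.left, htr hB.right, ← hB.cornerIndex_eq] at h1
  rw [relIndex_eq_cornerIndex, relIndex_eq_cornerIndex, hw.conj_mul]
  exact_mod_cast h1

end Pair

/-! ### Self-adjoint operators through their graphs; comparison of spectral subspaces. -/

section Unbounded

variable {E : Type*} [NormedAddCommGroup E] [InnerProductSpace ℂ E] [CompleteSpace E]

/-- Self-adjointness of an unbounded operator, in terms of its graph. -/
structure IsSelfAdjointGraph (S : E →ₗ.[ℂ] E) : Prop where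
  symm : ∀ {x y x' y' : E}, (x, y) ∈ S.graph → (x', y') ∈ S.graph → ⟪y, x'⟫_ℂ = ⟪x, y'⟫_ℂ
  maximal : ∀ {u v : E}, (∀ x y : E, (x, y) ∈ S.graph → ⟪y, u⟫_ℂ = ⟪x, v⟫_ℂ) → (u, v) ∈ S.graph

theorem isSelfAdjointGraph_of_isSelfAdjoint {S : E →ₗ.[ℂ] E} (hd : Dense (S.domain : Set E))
    (hS : IsSelfAdjoint S) : IsSelfAdjointGraph S := by
  have hadj : S.adjoint = S := hS
  refine ⟨fun {x y x' y'} h h' => ?_, fun {u v} h => ?_⟩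
  · obtain ⟨a, rfl, rfl⟩ := (LinearPMap.mem_graph_iff S).1 h
    obtain ⟨b, rfl, rfl⟩ := (LinearPMap.mem_graph_iff S).1 h'
    have := LinearPMap.adjoint_isFormalAdjoint hd
    rw [hadj] at this
    exact this a b
  · have h1 : ∀ x : S.domain, ⟪v, (x : E)⟫_ℂ = ⟪u, S x⟫_ℂ := fun x => by
      have := h x (S x) ((LinearPMap.mem_graph_iff S).2 ⟨x, rfl, rfl⟩)
      rw [← inner_conj_symm, ← this, inner_conj_symm]
    have h2 : u ∈ S.adjoint.domain := LinearPMap.mem_adjoint_domain_of_exists u ⟨v, h1⟩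
    have h3 := LinearPMap.adjoint_apply_eq hd ⟨u, h2⟩ h1
    have h4 : (u, v) ∈ S.adjoint.graph := (LinearPMap.mem_graph_iff _).2 ⟨⟨u, h2⟩, rfl, h3⟩
    rwa [hadj] at h4

theorem IsSelfAdjointGraph.isClosed {S : E →ₗ.[ℂ] E} (hS : IsSelfAdjointGraph S) : S.IsClosed := by
  have : (S.graph : Set (E × E)) =
      ⋂ p ∈ S.graph, {q : E × E | ⟪p.2, q.1⟫_ℂ = ⟪p.1, q.2⟫_ℂ} := by
    ext ⟨u, v⟩
    simp only [SetLike.mem_coe, Set.mem_iInter, Set.mem_ofPred_eq]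
    exact ⟨fun h p hp => hS.symm hp h, fun h => hS.maximal fun x y hxy => h (x, y) hxy⟩
  change IsClosed (S.graph : Set (E × E))
  rw [this]
  refine isClosed_biInter fun p _ => isClosed_eq ?_ ?_
  · exact continuous_const.inner continuous_fst
  · exact continuous_const.inner continuous_snd

theorem graph_snd_eq {S : E →ₗ.[ℂ] E} {x y y' : E} (h : (x, y) ∈ S.graph)
    (h' : (x, y') ∈ S.graph) : y = y' :=
  LinearPMap.mem_graph_snd_inj _ h h' rfl

/-- `R = (1 + S²)⁻¹` and `G = S (1 + S²)⁻¹`. -/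
structure IsGapPair (S : E →ₗ.[ℂ] E) (R G : E →L[ℂ] E) : Prop where
  graph_R : ∀ y, (R y, G y) ∈ S.graph
  graph_G : ∀ y, (G y, y - R y) ∈ S.graph

namespace IsGapPair

variable {S : E →ₗ.[ℂ] E} {R G : E →L[ℂ] E}

theorem inner_R (hS : IsSelfAdjointGraph S) (h : IsGapPair S R G) (y z : E) :
    ⟪R y, z⟫_ℂ = ⟪R y, R z⟫_ℂ + ⟪G y, G z⟫_ℂ := by
  rw [hS.symm (h.graph_R y) (h.graph_G z), ← inner_add_right]
  congr 1; abel

theorem isSelfAdjoint_R (hS : IsSelfAdjointGraph S) (h : IsGapPair S R G) : IsSelfAdjoint R := by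
  rw [ContinuousLinearMap.isSelfAdjoint_iff_isSymmetric]
  intro y z
  change ⟪R y, z⟫_ℂ = ⟪y, R z⟫_ℂ
  rw [h.inner_R hS, ← inner_conj_symm y (R z), h.inner_R hS z y, map_add, inner_conj_symm,
    inner_conj_symm]

theorem isSelfAdjoint_G (hS : IsSelfAdjointGraph S) (h : IsGapPair S R G) : IsSelfAdjoint G := by
  rw [ContinuousLinearMap.isSelfAdjoint_iff_isSymmetric]
  intro y z
  change ⟪G y, z⟫_ℂ = ⟪y, G z⟫_ℂ
  have h1 : ⟪G y, R z⟫_ℂ = ⟪R y, G z⟫_ℂ := hS.symm (h.graph_R y) (h.graph_R z)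
  have h2 : ⟪y - R y, G z⟫_ℂ = ⟪G y, z - R z⟫_ℂ := hS.symm (h.graph_G y) (h.graph_G z)
  rw [inner_sub_left, inner_sub_right, h1] at h2
  linear_combination -h2

theorem apply_snd (hS : IsSelfAdjointGraph S) (h : IsGapPair S R G) {x y : E}
    (hxy : (x, y) ∈ S.graph) : R y = G x := by
  refine ext_inner_right ℂ fun z => ?_
  rw [inner_apply_comm (h.isSelfAdjoint_R hS), hS.symm hxy (h.graph_R z),
    inner_apply_comm (h.isSelfAdjoint_G hS)]

theorem apply_fst (hS : IsSelfAdjointGraph S) (h : IsGapPair S R G) {x y : E}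
    (hxy : (x, y) ∈ S.graph) : G y = x - R x := by
  refine ext_inner_right ℂ fun z => ?_
  rw [inner_apply_comm (h.isSelfAdjoint_G hS), hS.symm hxy (h.graph_G z), inner_sub_right,
    inner_sub_left, inner_apply_comm (h.isSelfAdjoint_R hS)]

theorem commute (hS : IsSelfAdjointGraph S) (h : IsGapPair S R G) : Commute R G := by
  ext y
  exact h.apply_snd hS (h.graph_R y)

theorem re_inner_R (hS : IsSelfAdjointGraph S) (h : IsGapPair S R G) (y : E) :
    (⟪R y, y⟫_ℂ).re = ‖R y‖ ^ 2 + ‖G y‖ ^ 2 := by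
  rw [h.inner_R hS, Complex.add_re]
  congr 1 <;> exact inner_self_eq_norm_sq (𝕜 := ℂ) _

theorem norm_R_le (hS : IsSelfAdjointGraph S) (h : IsGapPair S R G) (y : E) : ‖R y‖ ≤ ‖y‖ := by
  have h1 := h.re_inner_R hS y
  have h2 : (⟪R y, y⟫_ℂ).re ≤ ‖R y‖ * ‖y‖ := (Complex.re_le_norm _).trans (norm_inner_le_norm _ _)
  by_contra! hlt
  nlinarith [norm_nonneg y, norm_nonneg (R y), sq_nonneg ‖G y‖]

theorem norm_G_le (hS : IsSelfAdjointGraph S) (h : IsGapPair S R G) (y : E) : ‖G y‖ ≤ ‖y‖ := by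
  have h1 := h.re_inner_R hS y
  have h2 : (⟪R y, y⟫_ℂ).re ≤ ‖R y‖ * ‖y‖ := (Complex.re_le_norm _).trans (norm_inner_le_norm _ _)
  have h3 := h.norm_R_le hS y
  refine le_of_sq_le_sq ?_ (norm_nonneg _)
  nlinarith [norm_nonneg y, norm_nonneg (R y)]

theorem commute_of_graph_map (hS : IsSelfAdjointGraph S) (h : IsGapPair S R G) {Y : E →L[ℂ] E}
    (hY : ∀ x y, (x, y) ∈ S.graph → (Y x, Y y) ∈ S.graph) : Commute Y R ∧ Commute Y G := by
  have h1 := fun y => hY _ _ (h.graph_R y)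
  have h2 := fun y => hY _ _ (h.graph_G y)
  have hR : ∀ y, Y (R y) = R (Y y) := fun y => by
    have e1 := h.apply_fst hS (h1 y)
    have e2 := h.apply_snd hS (h2 y)
    rw [e1, map_sub, map_sub] at e2
    exact (sub_left_inj.1 e2).symm
  refine ⟨ContinuousLinearMap.ext hR, ContinuousLinearMap.ext fun y => ?_⟩
  have e1 := h.apply_snd hS (h1 y)
  have e2 := h.apply_fst hS (h2 y)
  rw [e1, map_sub, map_sub] at e2
  exact (sub_left_inj.1 e2).symm

theorem unique (hS : IsSelfAdjointGraph S) (h : IsGapPair S R G) {R' G' : E →L[ℂ] E}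
    (h' : IsGapPair S R' G') : G' = G := by
  ext y
  have h1 := h.apply_snd hS (h'.graph_G y)
  have h2 := h.apply_fst hS (h'.graph_R y)
  have h3 : G (G' y) = R' y - R (R' y) := h2
  have h4 : R y - R (R' y) = G (G' y) := by rw [← map_sub, h1]
  have h5 : R y = R' y := by
    have := h4.trans h3
    exact sub_left_inj.1 this
  have h6 := h.graph_R y
  rw [h5] at h6
  exact graph_snd_eq (h'.graph_R y) h6

end IsGapPair

/-- The spectral data of a self-adjoint operator `S` used for comparing spectral projections:
`P = χ_{≥ 0}(S)`, `e` is the spectral projection for a neighbourhood of `0`, and `σ` is the inverse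
of `S` on the range of `1 - e`. -/
structure IsSpectralCut (S : E →ₗ.[ℂ] E) (P e σ : E →L[ℂ] E) : Prop where
  projP : IsStarProjection P
  projE : IsStarProjection e
  commPE : Commute P e
  selfAdjoint : IsSelfAdjoint σ
  commP : Commute P σ
  mul_e : σ * e = 0
  graph : ∀ y, (σ y, y - e y) ∈ S.graph
  nonneg : ∀ v, P v = v → 0 ≤ (⟪σ v, v⟫_ℂ).re
  nonpos : ∀ v, P v = 0 → (⟪σ v, v⟫_ℂ).re ≤ 0

theorem IsSpectralCut.e_mul {S : E →ₗ.[ℂ] E} {P e σ : E →L[ℂ] E} (h : IsSpectralCut S P e σ) :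
    e * σ = 0 := by
  have := congrArg star h.mul_e
  rwa [star_mul, h.selfAdjoint.star_eq, h.projE.isSelfAdjoint.star_eq, star_zero] at this

/-- The composition of `S'` with a bounded operator into its domain, as a perturbation of a bounded
operator. -/
theorem exists_bounded_comp {S S' : E →ₗ.[ℂ] E} (hdom : S.domain = S'.domain) {σ T : E →L[ℂ] E}
    (hσ : ∀ v, (σ v, T v) ∈ S.graph) {ε : ℝ} (hε : 0 ≤ ε)
    (h : ∀ v y', (σ v, y') ∈ S'.graph → ‖y' - T v‖ ≤ ε * ‖v‖) :
    ∃ W : E →L[ℂ] E, (∀ v, (σ v, T v + W v) ∈ S'.graph) ∧ ‖W‖ ≤ ε := by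
  have hmem : ∀ v, σ v ∈ S'.domain := fun v => by
    rw [← hdom]; exact LinearPMap.mem_domain_of_mem_graph (hσ v)
  set A : E →ₗ[ℂ] E := S'.toFun ∘ₗ (σ.toLinearMap.codRestrict S'.domain hmem) with hA
  have hAg : ∀ v, (σ v, A v) ∈ S'.graph := fun v =>
    (LinearPMap.mem_graph_iff _).2 ⟨⟨σ v, hmem v⟩, rfl, rfl⟩
  refine ⟨(A - T.toLinearMap).mkContinuous ε fun v => h v _ (hAg v), fun v => ?_,
    LinearMap.mkContinuous_norm_le _ hε _⟩
  have : T v + ((A - T.toLinearMap).mkContinuous ε fun v => h v _ (hAg v)) v = A v := by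
    change T v + (A v - T v) = A v
    abel
  rw [this]; exact hAg v

/-- `S σ = 1 - e` holds by definition; taking adjoints gives `σ S = 1 - e` on the domain. -/
theorem IsSpectralCut.apply {S : E →ₗ.[ℂ] E} (hS : IsSelfAdjointGraph S) {P e σ : E →L[ℂ] E}
    (h : IsSpectralCut S P e σ) {x y : E} (hxy : (x, y) ∈ S.graph) : σ y = x - e x := by
  refine ext_inner_right ℂ fun z => ?_
  rw [inner_apply_comm h.selfAdjoint, hS.symm hxy (h.graph z), inner_sub_left, inner_sub_right,
    inner_apply_comm h.projE.isSelfAdjoint]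

/-- Spectral subspaces of two self-adjoint operators which are relatively close are nearly
orthogonal if they lie on different sides of a spectral gap. -/
theorem IsSpectralCut.norm_compression_le {S S' : E →ₗ.[ℂ] E} (hS : IsSelfAdjointGraph S)
    (hS' : IsSelfAdjointGraph S') (hdom : S.domain = S'.domain) {P e σ P' e' σ' : E →L[ℂ] E}
    (h : IsSpectralCut S P e σ) (h' : IsSpectralCut S' P' e' σ') {ε : ℝ} (hε : 0 ≤ ε)
    (hσ : ∀ v y', (σ v, y') ∈ S'.graph → ‖y' - (v - e v)‖ ≤ ε * ‖v‖)
    (hσ' : ∀ v y, (σ' v, y) ∈ S.graph → ‖y - (v - e' v)‖ ≤ ε * ‖v‖) :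
    ‖(1 - P') * (1 - e') * (P * (1 - e))‖ ≤ ε / 2 := by
  obtain ⟨W₁, hW₁, hW₁n⟩ := exists_bounded_comp (T := 1 - e) hdom h.graph hε hσ
  obtain ⟨W₂, hW₂, hW₂n⟩ := exists_bounded_comp (T := 1 - e') hdom.symm h'.graph hε hσ'
  -- Here `W₁ = S' σ - (1 - e)` is the bounded error of the perturbation, and `σ'` cancels `S'` up
  -- to `1 - e'`. Multiplying by `1 - P'` and `P` turns this resolvent-type identity into the
  -- Sylvester equation.
  have I₁ : σ' * (1 - e + W₁) = (1 - e') * σ := by ext v; exact h'.apply hS' (hW₁ v)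
  have I₂ : σ * (1 - e' + W₂) = (1 - e) * σ' := by ext v; exact h.apply hS (hW₂ v)
  have hPn : ‖P‖ ≤ 1 := h.projP.norm_le
  have hP'n : ‖1 - P'‖ ≤ 1 := h'.projP.one_sub.norm_le
  have he'n : ‖1 - e'‖ ≤ 1 := h'.projE.one_sub.norm_le
  have hPP : P * P = P := h.projP.isIdempotentElem
  have hqq : (1 - P') * (1 - P') = 1 - P' := h'.projP.one_sub.isIdempotentElem
  have hqσ : (1 - P') * σ' = σ' * (1 - P') := by
    rw [sub_mul, mul_sub, h'.commP.eq, one_mul, mul_one]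
  have hqe : (1 - P') * (1 - e') = (1 - e') * (1 - P') :=
    ((Commute.one_left _).sub_left ((Commute.one_right _).sub_right h'.commPE)).eq
  have hPe : P * (1 - e) = (1 - e) * P := ((Commute.one_right _).sub_right h.commPE).eq
  have hσe : σ * (1 - e) = σ := by rw [mul_sub, mul_one, h.mul_e, sub_zero]
  have heσ : (1 - e) * σ = σ := by rw [sub_mul, one_mul, h.e_mul, sub_zero]
  have hσe' : σ' * (1 - e') = σ' := by rw [mul_sub, mul_one, h'.mul_e, sub_zero]
  have heσ' : (1 - e') * σ' = σ' := by rw [sub_mul, one_mul, h'.e_mul, sub_zero]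
  set q := 1 - P' with hq
  set f := 1 - e with hf
  set f' := 1 - e' with hf'
  have hqs : star q = q := h'.projP.one_sub.isSelfAdjoint.star_eq
  have hfs : star f = f := h.projE.one_sub.isSelfAdjoint.star_eq
  have hfs' : star f' = f' := h'.projE.one_sub.isSelfAdjoint.star_eq
  have hPs : star P = P := h.projP.isSelfAdjoint.star_eq
  have hσs : star σ = σ := h.selfAdjoint.star_eq
  have hσs' : star σ' = σ' := h'.selfAdjoint.star_eq
  have ha : (0 : E →L[ℂ] E) ≤ -(q * σ') := by
    refine nonneg_of_forall_re_inner_nonneg ?_ fun v => ?_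
    · rw [isSelfAdjoint_iff, star_neg, star_mul, hqs, hσs', hqσ]
    · have h1 : (q * σ') v = q (σ' (q v)) := by
        have : q * σ' = q * (σ' * q) := by rw [← hqσ, ← mul_assoc, hqq]
        rw [this]; rfl
      have h2 : P' (q v) = 0 := by
        have : P' * q = 0 := by
          rw [hq, mul_sub, mul_one, h'.projP.isIdempotentElem.eq, sub_self]
        exact congrArg (fun A : E →L[ℂ] E => A v) this
      have h3 := h'.nonpos _ h2
      change 0 ≤ (⟪-((q * σ') v), v⟫_ℂ).re
      rw [h1, inner_neg_left, inner_apply_comm hqs, Complex.neg_re]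
      linarith
  have hb : (0 : E →L[ℂ] E) ≤ P * σ := by
    refine nonneg_of_forall_re_inner_nonneg ?_ fun v => ?_
    · rw [isSelfAdjoint_iff, star_mul, hPs, hσs, h.commP.eq]
    · have h1 : (P * σ) v = P (σ (P v)) := by
        have : P * σ = P * (σ * P) := by rw [← h.commP.eq, ← mul_assoc, hPP]
        rw [this]; rfl
      have h2 : P (P v) = P v := congrArg (fun A : E →L[ℂ] E => A v) hPP
      rw [h1, inner_apply_comm hPs]
      exact h.nonneg _ h2
  have e1 : -(q * σ') * (q * f' * (P * f)) = -(q * σ' * f * P) := by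
    have : q * σ' * (q * f' * (P * f)) = q * (σ' * q) * f' * (P * f) := by simp only [mul_assoc]
    rw [neg_mul, this, ← hqσ, ← mul_assoc q q σ', hqq, hPe]
    have h2 : q * σ' * f' * (f * P) = q * (σ' * f') * f * P := by simp only [mul_assoc]
    rw [h2, hσe']
  have e2 : q * f' * (P * f) * (P * σ) = q * f' * σ * P := by
    have : q * f' * (P * f) * (P * σ) = q * f' * (P * f * P * σ) := by simp only [mul_assoc]
    rw [this, hPe, mul_assoc f P P, hPP, mul_assoc f P σ, h.commP.eq, ← mul_assoc f, heσ]
    simp only [mul_assoc]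
  have e3 : -(q * σ') * -(q * f' * W₁ * P) = q * σ' * W₁ * P := by
    have : q * σ' * (q * f' * W₁ * P) = q * (σ' * q) * f' * W₁ * P := by simp only [mul_assoc]
    rw [neg_mul_neg, this, ← hqσ, ← mul_assoc q q σ', hqq, mul_assoc q σ' f', hσe']
  have hsyl : -(q * σ') * (q * f' * (P * f)) + q * f' * (P * f) * (P * σ) =
      -(q * σ') * -(q * f' * W₁ * P) := by
    have : q * f' * σ * P = q * σ' * f * P + q * σ' * W₁ * P := by
      rw [mul_assoc q f' σ, ← I₁, mul_add, mul_add, add_mul, mul_assoc q σ' f, mul_assoc q σ' W₁]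
    rw [e1, e2, e3, this, neg_add_cancel_left]
  -- The adjoint of `I₁` combined with `I₂` gives `W₁* σ' = -σ W₂`: the error is controlled by `σ'`
  -- from one side and by `σ` from the other, as the Sylvester bound demands.
  have hstar : star (-(q * σ') * -(q * f' * W₁ * P)) = P * σ * -(W₂ * q) := by
    have h1 : star W₁ * σ' = -(σ * W₂) := by
      have h2 := congrArg star I₁
      rw [star_mul, star_mul, star_add, hfs, hfs', hσs, hσs', add_mul] at h2
      have h3 := I₂
      rw [mul_add] at h3
      have : star W₁ * σ' = σ * f' - f * σ' := by rw [← h2]; abel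
      rw [this, ← h3]; abel
    rw [e3, star_mul, star_mul, star_mul, hqs, hσs', hPs]
    calc P * (star W₁ * (σ' * q)) = P * (star W₁ * σ') * q := by simp only [mul_assoc]
      _ = _ := by rw [h1]; simp only [mul_assoc, mul_neg, neg_mul]
  refine norm_le_of_sylvester ha hb hsyl hstar ?_ ?_ ?_ ?_
  · rw [norm_neg]
    calc ‖q * f' * W₁ * P‖ ≤ ‖q‖ * ‖f'‖ * ‖W₁‖ * ‖P‖ := by
          refine (norm_mul_le _ _).trans ?_
          gcongr
          refine (norm_mul_le _ _).trans ?_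
          gcongr
          exact norm_mul_le _ _
      _ ≤ 1 * 1 * ε * 1 := by gcongr
      _ = ε := by ring
  · rw [norm_neg]
    calc ‖W₂ * q‖ ≤ ‖W₂‖ * ‖q‖ := norm_mul_le _ _
      _ ≤ ε * 1 := by gcongr
      _ = ε := mul_one _
  -- A vector killed by `σ'` and fixed by `1 - e'` yields the graph point `(0, u)`, so it vanishes.
  · intro v hv
    set u := (q * f' * (P * f)) v with hu
    have hf'f' : f' * f' = f' := h'.projE.one_sub.isIdempotentElem
    have h1 : σ' u = 0 := by
      have h2 : (q * σ') u = 0 := by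
        have : -((q * σ') u) = 0 := hv
        simpa using this
      have h3 : (q * σ') u = σ' u := by
        have : q * σ' * (q * f' * (P * f)) = σ' * (q * f' * (P * f)) := by
          rw [hqσ, mul_assoc, ← mul_assoc q (q * f'), ← mul_assoc q q, hqq]
        exact congrArg (fun A : E →L[ℂ] E => A v) this
      rwa [h3] at h2
    have h4 : u - e' u = u := by
      have : f' * (q * f' * (P * f)) = q * f' * (P * f) := by
        rw [← mul_assoc f' (q * f'), ← mul_assoc f' q f', ← hqe, mul_assoc q f' f', hf'f']
      exact congrArg (fun A : E →L[ℂ] E => A v) this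
    have h5 := h'.graph u
    rw [h1, h4] at h5
    exact LinearPMap.graph_fst_eq_zero_snd _ h5 rfl
  · intro v hv
    have hff : f * f = f := h.projE.one_sub.isIdempotentElem
    have hX : star (q * f' * (P * f)) = f * P * (f' * q) := by
      rw [star_mul, star_mul, star_mul, hqs, hfs, hfs', hPs]
    rw [hX] at hv ⊢
    set u := (f * P * (f' * q)) v with hu
    have h1 : σ u = 0 := by
      have h3 : (P * σ) u = σ u := by
        have : P * σ * (f * P * (f' * q)) = σ * (f * P * (f' * q)) := by
          rw [h.commP.eq, mul_assoc, ← mul_assoc P (f * P), ← mul_assoc P f P, hPe, mul_assoc f P P,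
            hPP]
        exact congrArg (fun A : E →L[ℂ] E => A v) this
      rwa [h3] at hv
    have h4 : u - e u = u := by
      have : f * (f * P * (f' * q)) = f * P * (f' * q) := by
        rw [← mul_assoc f (f * P), ← mul_assoc f f P, hff]
      exact congrArg (fun A : E →L[ℂ] E => A v) this
    have h5 := h.graph u
    rw [h1, h4] at h5
    exact LinearPMap.graph_fst_eq_zero_snd _ h5 rfl

end Unbounded

/-! ### Construction of spectral cuts and norm estimates for spectral projections. -/

section Cut

variable {E : Type*} [NormedAddCommGroup E] [InnerProductSpace ℂ E] [CompleteSpace E]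

theorem one_sub_mul_mul_eq_zero_of_commute {p A : E →L[ℂ] E} (hp : IsStarProjection p)
    (h : Commute p A) : (1 - p) * (A * p) = 0 := by
  rw [← h.eq, ← mul_assoc, sub_mul, one_mul, hp.isIdempotentElem.eq, sub_self, zero_mul]

/-- Form bounds for a self-adjoint operator commuting with a projection can be checked on the two
complementary subspaces. -/
theorem le_re_inner_of_commute {M p : E →L[ℂ] E} (hp : IsStarProjection p)
    (hM : Commute p M) {c : ℝ} (h₁ : ∀ a, p a = a → c * ‖a‖ ^ 2 ≤ (⟪M a, a⟫_ℂ).re)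
    (h₂ : ∀ a, p a = 0 → c * ‖a‖ ^ 2 ≤ (⟪M a, a⟫_ℂ).re) (x : E) :
    c * ‖x‖ ^ 2 ≤ (⟪M x, x⟫_ℂ).re := by
  have hpp : ∀ y, p (p y) = p y := fun y =>
    congrArg (fun A : E →L[ℂ] E => A y) hp.isIdempotentElem.eq
  have hpM : ∀ y, p (M y) = M (p y) := fun y => congrArg (fun A : E →L[ℂ] E => A y) hM.eq
  set a := p x with ha
  set d := x - p x with hd
  have hx : x = a + d := by rw [ha, hd]; abel
  have hpa : p a = a := hpp x
  have hpd : p d = 0 := by rw [hd, map_sub, hpp, sub_self]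
  have o₁ : ∀ u, p u = 0 → ⟪a, u⟫_ℂ = 0 := fun u hu => by
    rw [← hpa, inner_apply_comm hp.isSelfAdjoint, hu, inner_zero_right]
  have o₂ : ⟪M a, d⟫_ℂ = 0 := by
    rw [← hpa, ← hpM, inner_apply_comm hp.isSelfAdjoint, hpd, inner_zero_right]
  have o₃ : ⟪M d, a⟫_ℂ = 0 := by
    rw [← hpa, ← inner_apply_comm hp.isSelfAdjoint, hpM, hpd, map_zero, inner_zero_left]
  have hn : ‖x‖ ^ 2 = ‖a‖ ^ 2 + ‖d‖ ^ 2 := by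
    rw [hx, sq, sq, sq, norm_add_sq_eq_norm_sq_add_norm_sq_of_inner_eq_zero _ _ (o₁ d hpd)]
  have hf : (⟪M x, x⟫_ℂ).re = (⟪M a, a⟫_ℂ).re + (⟪M d, d⟫_ℂ).re := by
    rw [hx, map_add, inner_add_left, inner_add_right, inner_add_right, o₂, o₃]
    simp
  rw [hn, hf, mul_add]
  exact add_le_add (h₁ a hpa) (h₂ d hpd)

/-- A spectral projection `e` of `R`, with inverses of `1 - R` off its range and of `R` on it. -/
theorem exists_spectralProj_inverse {R : E →L[ℂ] E} (hRs : IsSelfAdjoint R)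
    (hR0 : ∀ a, 0 ≤ (⟪R a, a⟫_ℂ).re) (hR1 : ∀ a, (⟪R a, a⟫_ℂ).re ≤ ‖a‖ ^ 2) {s : ℝ}
    (hs : 0 < s) (hs1 : s < 1) :
    ∃ e D D' : E →L[ℂ] E, IsStarProjection e ∧ IsSelfAdjoint D ∧ ‖D‖ ≤ (1 - s)⁻¹ ∧ ‖D'‖ ≤ s⁻¹ ∧
      (1 - R + e) * D = 1 ∧ (R + (1 - e)) * D' = 1 ∧
      ∀ Y : E →L[ℂ] E, Commute Y R → Commute Y e ∧ Commute Y D ∧ Commute Y D' := by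
  -- `e` is the spectral projection of `R` for `[s, ∞)`. Adding `e` to `1 - R`, respectively `1 - e`
  -- to `R`, makes these coercive on the whole space.
  set X : E →L[ℂ] E := R - (s : ℂ) • 1 with hX
  have hXs : IsSelfAdjoint X := by
    rw [isSelfAdjoint_iff, hX, star_sub, star_smul, star_one, hRs.star_eq]
    congr 2
    exact Complex.conj_ofReal s
  obtain ⟨e, he⟩ : ∃ e, e = spectralProj X := ⟨_, rfl⟩
  have hep : IsStarProjection e := he ▸ isStarProjection_spectralProj X
  have comm_e : ∀ Y : E →L[ℂ] E, Commute Y R → Commute Y e := fun Y hY =>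
    he ▸ commute_spectralProj (hY.sub_right ((Commute.one_right Y).smul_right _))
  have hRe := comm_e R (Commute.refl R)
  have hform : ∀ a, (⟪X a, a⟫_ℂ).re = (⟪R a, a⟫_ℂ).re - s * ‖a‖ ^ 2 := fun a => by
    have : X a = R a - (s : ℂ) • a := rfl
    rw [this, inner_sub_left, inner_smul_left, Complex.sub_re, Complex.conj_ofReal,
      Complex.re_ofReal_mul]
    congr 2
    exact inner_self_eq_norm_sq (𝕜 := ℂ) a
  have hin : ∀ a : E, (⟪a, a⟫_ℂ).re = ‖a‖ ^ 2 := fun a => inner_self_eq_norm_sq (𝕜 := ℂ) a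
  have hlow : ∀ a, e a = a → s * ‖a‖ ^ 2 ≤ (⟪R a, a⟫_ℂ).re := fun a ha => by
    have := re_inner_nonneg_spectralProj hXs (he ▸ ha)
    rw [hform] at this; linarith
  have hupp : ∀ a, e a = 0 → (⟪R a, a⟫_ℂ).re ≤ s * ‖a‖ ^ 2 := fun a ha => by
    have := re_inner_nonpos_spectralProj hXs (he ▸ ha)
    rw [hform] at this; linarith
  clear_value X
  have c1 : Commute e (1 - R + e) :=
    ((Commute.one_right _).sub_right hRe.symm).add_right (Commute.refl e)
  have c2 : Commute e (R + (1 - e)) :=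
    hRe.symm.add_right ((Commute.one_right _).sub_right (Commute.refl e))
  have b1 : ∀ x, (1 - s) * ‖x‖ ^ 2 ≤ (⟪(1 - R + e) x, x⟫_ℂ).re := by
    refine le_re_inner_of_commute hep c1 (fun a ha => ?_) (fun a ha => ?_)
    · have : (1 - R + e) a = a - R a + e a := rfl
      rw [this, ha, inner_add_left, inner_sub_left, Complex.add_re, Complex.sub_re, hin]
      nlinarith [hR1 a, sq_nonneg ‖a‖]
    · have : (1 - R + e) a = a - R a + e a := rfl
      rw [this, ha, add_zero, inner_sub_left, Complex.sub_re, hin]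
      linarith [hupp a ha]
  have b2 : ∀ x, s * ‖x‖ ^ 2 ≤ (⟪(R + (1 - e)) x, x⟫_ℂ).re := by
    refine le_re_inner_of_commute hep c2 (fun a ha => ?_) (fun a ha => ?_)
    · have : (R + (1 - e)) a = R a + (a - e a) := rfl
      rw [this, ha, sub_self, add_zero]
      exact hlow a ha
    · have : (R + (1 - e)) a = R a + (a - e a) := rfl
      rw [this, ha, sub_zero, inner_add_left, Complex.add_re, hin]
      nlinarith [hR0 a, sq_nonneg ‖a‖]
  obtain ⟨D, hDM, hMD, hDs, hDn⟩ := exists_inverse_of_coercive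
    (((IsSelfAdjoint.one _).sub hRs).add hep.isSelfAdjoint) (by linarith) b1
  obtain ⟨D', hDM', hMD', -, hDn'⟩ := exists_inverse_of_coercive
    (hRs.add ((IsSelfAdjoint.one _).sub hep.isSelfAdjoint)) hs b2
  exact ⟨e, D, D', hep, hDs, hDn, hDn', hMD, hMD', fun Y hY => ⟨comm_e Y hY,
    commute_of_inverse hDM hMD (((Commute.one_right Y).sub_right hY).add_right (comm_e Y hY)),
    commute_of_inverse hDM' hMD' (hY.add_right ((Commute.one_right Y).sub_right (comm_e Y hY)))⟩⟩

/-- Assembling a spectral cut from an inverse of `1 - R` off the range of `e`. -/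
theorem IsGapPair.isSpectralCut {S : E →ₗ.[ℂ] E} {R G : E →L[ℂ] E} (hS : IsSelfAdjointGraph S)
    (h : IsGapPair S R G) {e D : E →L[ℂ] E} (hep : IsStarProjection e) (hDs : IsSelfAdjoint D)
    (hMD : (1 - R + e) * D = 1) (comm_e : ∀ Y : E →L[ℂ] E, Commute Y R → Commute Y e)
    (comm_D : ∀ Y : E →L[ℂ] E, Commute Y R → Commute Y D) :
    IsSpectralCut S (spectralProj G) e (G * D * (1 - e)) := by
  have hRs := h.isSelfAdjoint_R hS
  have hGs := h.isSelfAdjoint_G hS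
  have hRG := h.commute hS
  have hee := hep.isIdempotentElem.eq
  have hRe := comm_e R (Commute.refl R)
  have hGe := comm_e G hRG.symm
  have hef : e * (1 - e) = 0 := by rw [mul_sub, mul_one, hee, sub_self]
  have hfe : (1 - e) * e = 0 := by rw [sub_mul, one_mul, hee, sub_self]
  have hGf : Commute G (1 - e) := (Commute.one_right _).sub_right hGe
  have hDf : Commute D (1 - e) := (Commute.one_right _).sub_right (comm_D e hRe.symm).symm
  have hGD : Commute G D := comm_D G hRG.symm
  obtain ⟨P, hP⟩ : ∃ P, P = spectralProj G := ⟨_, rfl⟩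
  have hPp : IsStarProjection P := hP ▸ isStarProjection_spectralProj G
  have comm_P : ∀ Y : E →L[ℂ] E, Commute Y G → Commute P Y := fun Y hY =>
    hP ▸ (commute_spectralProj hY).symm
  -- Formally `G = S (1 + S²)⁻¹` and `1 - R = S² (1 + S²)⁻¹`, so `G (1 - R)⁻¹` is `S⁻¹` off `ran e`.
  obtain ⟨σ, hσ⟩ : ∃ σ, σ = G * D * (1 - e) := ⟨_, rfl⟩
  have hPσ : Commute P σ := by
    have h1 := comm_P R hRG
    rw [hσ]
    exact ((comm_P G (Commute.refl G)).mul_right (comm_D P h1)).mul_right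
      ((Commute.one_right _).sub_right (comm_e P h1))
  have hσs : IsSelfAdjoint σ := by
    rw [isSelfAdjoint_iff, hσ, star_mul, star_mul, hGs.star_eq, hDs.star_eq,
      ((IsSelfAdjoint.one _).sub hep.isSelfAdjoint).star_eq, hGD.symm.eq]
    exact (hGf.mul_left hDf).symm.eq
  have hσe : σ * e = 0 := by rw [hσ, mul_assoc, hfe, mul_zero]
  have hgr : ∀ y, (σ y, y - e y) ∈ S.graph := fun y => by
    have h1 := h.graph_G (D ((1 - e) y))
    have h3 : (1 - R + e) * (D * (1 - e)) = 1 - e := by rw [← mul_assoc, hMD, one_mul]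
    have h4 : e * (D * (1 - e)) = 0 := by
      rw [← mul_assoc, (comm_D e hRe.symm).eq, mul_assoc, hef, mul_zero]
    have h5 : (1 - R) * (D * (1 - e)) = 1 - e := by
      rw [add_mul, h4, add_zero] at h3; exact h3
    have h2 : D ((1 - e) y) - R (D ((1 - e) y)) = y - e y :=
      congrArg (fun A : E →L[ℂ] E => A y) h5
    rw [h2] at h1
    rw [hσ]
    exact h1
  rw [← hP, ← hσ]
  -- The sign of `σ` is read off from that of `G` through `σ = R σ + G (1 - e)`, where `R σ v = G (v
  -- - e v)` and `G σ v = v - e v - R (v - e v)`-type graph relations move everything to the form of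
  -- `G`.
  have hkey : ∀ v, (⟪σ v, v⟫_ℂ).re =
      (⟪G (σ v), σ v⟫_ℂ).re + (⟪G (v - e v), v - e v⟫_ℂ).re := fun v => by
    have h1 := h.apply_fst hS (hgr v)
    have h2 := h.apply_snd hS (hgr v)
    have h3 : ⟪σ v, v⟫_ℂ = ⟪σ v, v - e v⟫_ℂ := by
      have h4 : ⟪σ v, e v⟫_ℂ = 0 := by
        rw [inner_apply_comm hσs]
        have : σ (e v) = 0 := congrArg (fun A : E →L[ℂ] E => A v) hσe
        rw [this, inner_zero_right]
      rw [inner_sub_right, h4, sub_zero]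
    have h5 : ⟪σ v, v - e v⟫_ℂ = ⟪R (σ v), v - e v⟫_ℂ + ⟪G (v - e v), v - e v⟫_ℂ := by
      rw [← inner_add_left, h1]; congr 1; abel
    rw [h3, h5, inner_apply_comm hRs, h2, ← inner_apply_comm hGs, Complex.add_re]
  have hPe : Commute P e := comm_e P (comm_P R hRG)
  have hPσ' : ∀ v, P (σ v) = σ (P v) := fun v => congrArg (fun A : E →L[ℂ] E => A v) hPσ.eq
  have hPe' : ∀ v, P (e v) = e (P v) := fun v => congrArg (fun A : E →L[ℂ] E => A v) hPe.eq
  refine ⟨hPp, hep, hPe, hσs, hPσ, hσe, hgr, fun v hv => ?_, fun v hv => ?_⟩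
  · rw [hkey]
    refine add_nonneg (re_inner_nonneg_spectralProj hGs ?_) (re_inner_nonneg_spectralProj hGs ?_)
    · rw [← hP, hPσ', hv]
    · rw [← hP, map_sub, hPe', hv]
  · rw [hkey]
    refine add_nonpos (re_inner_nonpos_spectralProj hGs ?_) (re_inner_nonpos_spectralProj hGs ?_)
    · rw [← hP, hPσ', hv, map_zero]
    · rw [← hP, map_sub, hPe', hv, map_zero, sub_zero]

/-- Cutting `R = (1 + S²)⁻¹` at level `s` cuts `S` at `|S|² = s⁻¹ - 1`. On `ran e` the inverse `D'`
of `R` yields `A = G D' e`, which is `S e`, and the form of `R` at `D' e v` is `‖e v‖² + ‖A v‖²`, at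
most `s⁻¹ ‖e v‖²`. -/
theorem exists_isSpectralCut {S : E →ₗ.[ℂ] E} {R G : E →L[ℂ] E} (hS : IsSelfAdjointGraph S)
    (h : IsGapPair S R G) {s : ℝ} (hs : 0 < s) (hs1 : s < 1) :
    ∃ e σ A : E →L[ℂ] E, IsSpectralCut S (spectralProj G) e σ ∧ ‖σ‖ ≤ (1 - s)⁻¹ ∧
      (∀ v, (e v, A v) ∈ S.graph) ∧ (∀ v, ‖A v‖ ^ 2 ≤ (s⁻¹ - 1) * ‖e v‖ ^ 2) ∧
      ∀ Y : E →L[ℂ] E, Commute Y R → Commute Y e := by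
  have hR1 : ∀ a, (⟪R a, a⟫_ℂ).re ≤ ‖a‖ ^ 2 := fun a => by
    have h1 : (⟪R a, a⟫_ℂ).re ≤ ‖R a‖ * ‖a‖ := (Complex.re_le_norm _).trans (norm_inner_le_norm _ _)
    nlinarith [h.norm_R_le hS a, norm_nonneg a]
  have hR0 : ∀ a, 0 ≤ (⟪R a, a⟫_ℂ).re := fun a => by
    rw [h.re_inner_R hS]; positivity
  obtain ⟨e, D, D', hep, hDs, hDn, hDn', hMD, hMD', hcomm⟩ :=
    exists_spectralProj_inverse (h.isSelfAdjoint_R hS) hR0 hR1 hs hs1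
  have hGn : ‖G‖ ≤ 1 := ContinuousLinearMap.opNorm_le_bound _ zero_le_one fun x => by
    rw [one_mul]; exact h.norm_G_le hS x
  have hz : ∀ v, R (D' (e v)) = e v := fun v => by
    have h3 : (R + (1 - e)) * (D' * e) = e := by rw [← mul_assoc, hMD', one_mul]
    have h4 : (1 - e) * (D' * e) = 0 :=
      one_sub_mul_mul_eq_zero_of_commute hep (hcomm e (hcomm R (Commute.refl R)).1.symm).2.2
    rw [add_mul, h4, add_zero] at h3
    exact congrArg (fun A : E →L[ℂ] E => A v) h3
  refine ⟨e, G * D * (1 - e), G * D' * e, h.isSpectralCut hS hep hDs hMD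
    (fun Y hY => (hcomm Y hY).1) (fun Y hY => (hcomm Y hY).2.1), ?_, fun v => ?_, fun v => ?_,
    fun Y hYR => (hcomm Y hYR).1⟩
  · have := hep.one_sub.norm_le
    calc _ ≤ ‖G‖ * ‖D‖ * ‖1 - e‖ := (norm_mul_le _ _).trans (by gcongr; exact norm_mul_le _ _)
      _ ≤ 1 * (1 - s)⁻¹ * 1 := by gcongr
      _ = _ := by ring
  · have h1 := h.graph_R (D' (e v))
    rwa [hz] at h1
  · have h1 := h.re_inner_R hS (D' (e v))
    rw [hz] at h1
    have h2 : (⟪e v, D' (e v)⟫_ℂ).re ≤ ‖e v‖ * ‖D' (e v)‖ :=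
      (Complex.re_le_norm _).trans (norm_inner_le_norm _ _)
    have h3 : ‖D' (e v)‖ ≤ s⁻¹ * ‖e v‖ := (D'.le_opNorm _).trans (by gcongr)
    change ‖G (D' (e v))‖ ^ 2 ≤ _
    nlinarith [norm_nonneg (e v)]

/-- Conjugated positive and negative parts satisfy the characterisation of the parts of the
conjugated operator. -/
theorem spectralProj_conj {w X : E →L[ℂ] E} (hw : star w * w = 1) (hw' : w * star w = 1)
    (hX : IsSelfAdjoint X) : spectralProj (star w * X * w) = star w * spectralProj X * w := by
  have hmul : ∀ A B : E →L[ℂ] E, (star w * A * w) * (star w * B * w) = star w * (A * B) * w :=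
    fun A B => by
      have : (star w * A * w) * (star w * B * w) = star w * A * (w * star w) * B * w := by
        simp only [mul_assoc]
      rw [this, hw', mul_one]
      simp only [mul_assoc]
  have hneg : (star w * X * w)⁻ = star w * X⁻ * w := by
    refine (CFC.posPart_negPart_unique (b := star w * X⁺ * w) ?_ ?_ ?_ ?_).2
    · rw [← sub_mul, ← mul_sub, CFC.posPart_sub_negPart X hX]
    · rw [hmul, CFC.posPart_mul_negPart, mul_zero, zero_mul]
    · exact star_left_conjugate_nonneg (CFC.posPart_nonneg X) w
    · exact star_left_conjugate_nonneg (CFC.negPart_nonneg X) w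
  have hwi : ∀ x, star w (w x) = x := fun x => congrArg (fun A : E →L[ℂ] E => A x) hw
  have hwi' : ∀ x, w (star w x) = x := fun x => congrArg (fun A : E →L[ℂ] E => A x) hw'
  ext x
  refine Submodule.eq_starProjection_of_mem_of_inner_eq_zero ?_ fun y hy => ?_
  · rw [topologicalClosure_ker, hneg]
    change star w ((X⁻ : E →L[ℂ] E) (w (star w (spectralProj X (w x))))) = 0
    rw [hwi']
    have : spectralProj X (w x) ∈ (X⁻ : E →L[ℂ] E).ker.topologicalClosure :=
      Submodule.starProjection_apply_mem _ _
    rw [topologicalClosure_ker] at this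
    rw [show (X⁻ : E →L[ℂ] E) (spectralProj X (w x)) = 0 from this, map_zero]
  · rw [topologicalClosure_ker, hneg] at hy
    have h1 : (X⁻ : E →L[ℂ] E) (w y) = 0 := by
      have : star w ((X⁻ : E →L[ℂ] E) (w y)) = 0 := hy
      rw [← hwi' ((X⁻ : E →L[ℂ] E) (w y)), this, map_zero]
    have h2 : w y ∈ (X⁻ : E →L[ℂ] E).ker.topologicalClosure := by
      rw [topologicalClosure_ker]; exact h1
    have h3 : x - (star w * spectralProj X * w) x = star w (w x - spectralProj X (w x)) := by
      rw [map_sub, hwi]; rfl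
    rw [h3, ContinuousLinearMap.star_eq_adjoint, ContinuousLinearMap.adjoint_inner_left]
    exact Submodule.starProjection_inner_eq_zero _ _ h2

theorem IsSelfAdjointGraph.conj {F : Type*} [NormedAddCommGroup F] [InnerProductSpace ℂ F]
    [CompleteSpace F] {S : F →ₗ.[ℂ] F} {S' : E →ₗ.[ℂ] E} (hS : IsSelfAdjointGraph S)
    (w : E ≃ₗᵢ[ℂ] F) (hg : ∀ x y, (x, y) ∈ S'.graph ↔ (w x, w y) ∈ S.graph) :
    IsSelfAdjointGraph S' := by
  refine ⟨fun {x y x' y'} h h' => ?_, fun {a c} h => (hg _ _).2 (hS.maximal fun x y hxy => ?_)⟩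
  · rw [← w.inner_map_map, ← w.inner_map_map x]
    exact hS.symm ((hg _ _).1 h) ((hg _ _).1 h')
  · have := h (w.symm x) (w.symm y) ((hg _ _).2 (by simpa using hxy))
    rwa [← w.inner_map_map, ← w.inner_map_map (w.symm x), w.apply_symm_apply,
      w.apply_symm_apply] at this

theorem IsGapPair.conj {S S' : E →ₗ.[ℂ] E} {R G w : E →L[ℂ] E} (h : IsGapPair S R G)
    (hw' : w * star w = 1)
    (hg : ∀ x y, (x, y) ∈ S'.graph ↔ (w x, w y) ∈ S.graph) :
    IsGapPair S' (star w * R * w) (star w * G * w) := by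
  have hwi' : ∀ x, w (star w x) = x := fun x => congrArg (fun A : E →L[ℂ] E => A x) hw'
  refine ⟨fun y => (hg _ _).2 ?_, fun y => (hg _ _).2 ?_⟩
  · change (w (star w (R (w y))), w (star w (G (w y)))) ∈ _
    rw [hwi', hwi']; exact h.graph_R _
  · change (w (star w (G (w y))), w (y - star w (R (w y)))) ∈ _
    rw [map_sub, hwi', hwi']; exact h.graph_G _

theorem IsSpectralCut.conj {S S' : E →ₗ.[ℂ] E} {P e σ w : E →L[ℂ] E} (h : IsSpectralCut S P e σ)
    (hw' : w * star w = 1)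
    (hg : ∀ x y, (x, y) ∈ S'.graph ↔ (w x, w y) ∈ S.graph) :
    IsSpectralCut S' (star w * P * w) (star w * e * w) (star w * σ * w) := by
  have hwi' : ∀ x, w (star w x) = x := fun x => congrArg (fun A : E →L[ℂ] E => A x) hw'
  have hmul : ∀ A B : E →L[ℂ] E, (star w * A * w) * (star w * B * w) = star w * (A * B) * w :=
    fun A B => by
      have : (star w * A * w) * (star w * B * w) = star w * A * (w * star w) * B * w := by
        simp only [mul_assoc]
      rw [this, hw', mul_one]
      simp only [mul_assoc]
  have hsa : ∀ {A : E →L[ℂ] E}, IsSelfAdjoint A → IsSelfAdjoint (star w * A * w) := fun {A} hA => by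
    rw [isSelfAdjoint_iff, star_mul, star_mul, star_star, hA.star_eq, mul_assoc]
  have hpr : ∀ {A : E →L[ℂ] E}, IsStarProjection A → IsStarProjection (star w * A * w) :=
    fun {A} hA => ⟨by change _ * _ = _; rw [hmul, hA.isIdempotentElem.eq], hsa hA.isSelfAdjoint⟩
  have hcm : ∀ {A B : E →L[ℂ] E}, Commute A B → Commute (star w * A * w) (star w * B * w) :=
    fun {A B} hAB => by change _ * _ = _ * _; rw [hmul, hmul, hAB.eq]
  have hP : ∀ v, w ((star w * P * w) v) = P (w v) := fun v => hwi' _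
  have hi : ∀ v, ⟪(star w * σ * w) v, v⟫_ℂ = ⟪σ (w v), w v⟫_ℂ := fun v => by
    change ⟪star w (σ (w v)), v⟫_ℂ = _
    rw [ContinuousLinearMap.star_eq_adjoint, ContinuousLinearMap.adjoint_inner_left]
  refine ⟨hpr h.projP, hpr h.projE, hcm h.commPE, hsa h.selfAdjoint, hcm h.commP, ?_, fun y => ?_,
    fun v hv => ?_, fun v hv => ?_⟩
  · rw [hmul, h.mul_e, mul_zero, zero_mul]
  · rw [hg]
    change (w (star w (σ (w y))), w (y - star w (e (w y)))) ∈ _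
    rw [map_sub, hwi', hwi']; exact h.graph _
  · rw [hi]
    exact h.nonneg _ (by rw [← hP, hv])
  · rw [hi]
    exact h.nonpos _ (by rw [← hP, hv, map_zero])

/-- `S'` is a relatively small perturbation of `S`. -/
def IsRelClose (S S' : E →ₗ.[ℂ] E) (ε : ℝ) : Prop :=
  S.domain = S'.domain ∧ ∀ x y y' : E, (x, y) ∈ S.graph → (x, y') ∈ S'.graph →
    ‖y' - y‖ ≤ ε * (‖x‖ + ‖y‖)

theorem IsRelClose.symm {S S' : E →ₗ.[ℂ] E} {ε : ℝ} (h : IsRelClose S S' ε) (hε : 0 ≤ ε)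
    (hε' : ε ≤ 1 / 2) : IsRelClose S' S (2 * ε) := by
  refine ⟨h.1.symm, fun x y' y hy' hy => ?_⟩
  have h1 := h.2 x y y' hy hy'
  have h2 : ‖y‖ ≤ ‖y'‖ + ‖y' - y‖ := by
    have := norm_sub_norm_le y y'
    rw [norm_sub_rev] at this; linarith
  have h3 : ‖x‖ + ‖y‖ ≤ 2 * (‖x‖ + ‖y'‖) := by
    nlinarith [norm_nonneg x, norm_nonneg y, norm_nonneg y']
  rw [norm_sub_rev]
  calc _ ≤ _ := h1
    _ ≤ ε * (2 * (‖x‖ + ‖y'‖)) := by gcongr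
    _ = _ := by ring

theorem IsRelClose.trans {S S' S'' : E →ₗ.[ℂ] E} {ε δ : ℝ} (h : IsRelClose S S' ε)
    (h' : IsRelClose S S'' δ) (hε : 0 ≤ ε) (hε' : ε ≤ 1 / 2) (hδ : 0 ≤ δ) :
    IsRelClose S' S'' (2 * (ε + δ)) := by
  refine ⟨h.1.symm.trans h'.1, fun x y' y'' hy' hy'' => ?_⟩
  obtain ⟨a, ha, ha'⟩ := (LinearPMap.mem_graph_iff _).1 hy'
  have hx : x ∈ S.domain := by
    rw [h.1]; exact LinearPMap.mem_domain_of_mem_graph hy'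
  have hy : (x, S ⟨x, hx⟩) ∈ S.graph := (LinearPMap.mem_graph_iff _).2 ⟨⟨x, hx⟩, rfl, rfl⟩
  set y := S ⟨x, hx⟩
  have h1 := (h.symm hε hε').2 x y' y hy' hy
  have h2 := h.2 x y y' hy hy'
  have h3 := h'.2 x y y'' hy hy''
  have h4 : ‖y‖ ≤ ‖y'‖ + ‖y' - y‖ := by
    have := norm_sub_norm_le y y'
    rw [norm_sub_rev] at this; linarith
  have h5 : ‖x‖ + ‖y‖ ≤ 2 * (‖x‖ + ‖y'‖) := by
    nlinarith [norm_nonneg x, norm_nonneg y, norm_nonneg y']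
  have h6 : ‖y'' - y'‖ ≤ ‖y'' - y‖ + ‖y' - y‖ := by
    have := norm_sub_le (y'' - y) (y' - y)
    rwa [sub_sub_sub_cancel_right] at this
  calc _ ≤ _ := h6
    _ ≤ (δ + ε) * (‖x‖ + ‖y‖) := by linarith
    _ ≤ (δ + ε) * (2 * (‖x‖ + ‖y'‖)) := by gcongr
    _ = _ := by ring

/-- Two closed operators with the same domain are relatively bounded with respect to each other. -/
theorem exists_relative_bound {S S' : E →ₗ.[ℂ] E} (hS : S.IsClosed) (hS' : S'.IsClosed)
    (hdom : S.domain = S'.domain) : ∃ C : ℝ, 0 ≤ C ∧ ∀ x y y' : E, (x, y) ∈ S.graph →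
      (x, y') ∈ S'.graph → ‖y'‖ ≤ C * (‖x‖ + ‖y‖) := by
  have hmem : ∀ p ∈ S.graph, p.1 ∈ S'.domain := fun p hp => by
    rw [← hdom]; exact LinearPMap.mem_domain_of_mem_graph (y := p.2) hp
  have : CompleteSpace S.graph := (show IsClosed (S.graph : Set (E × E)) from hS).completeSpace_coe
  set f : S.graph →ₗ[ℂ] E := S'.toFun ∘ₗ
    ((LinearMap.fst ℂ E E).restrict (p := S.graph) (q := S'.domain) hmem) with hf
  have hfg : ∀ p : S.graph, ((p : E × E).1, f p) ∈ S'.graph := fun p =>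
    (LinearPMap.mem_graph_iff _).2 ⟨⟨_, hmem _ p.2⟩, rfl, rfl⟩
  have hcont : Continuous f := f.continuous_of_seq_closed_graph fun u x y hu hfu => by
    have h1 : Filter.Tendsto (fun n => ((u n : E × E).1, f (u n))) Filter.atTop
        (𝓝 ((x : E × E).1, y)) :=
      ((continuous_fst.comp continuous_subtype_val).tendsto x |>.comp hu).prodMk_nhds hfu
    have h2 : ((x : E × E).1, y) ∈ (S'.graph : Set (E × E)) :=
      IsClosed.mem_of_tendsto hS' h1 (Filter.Eventually.of_forall fun n => hfg (u n))
    exact graph_snd_eq h2 (hfg x)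
  set F : S.graph →L[ℂ] E := ⟨f, hcont⟩
  refine ⟨‖F‖, norm_nonneg F, fun x y y' h h' => ?_⟩
  have h1 : y' = F ⟨(x, y), h⟩ := graph_snd_eq h' (hfg ⟨(x, y), h⟩)
  have h2 : ‖(⟨(x, y), h⟩ : S.graph)‖ ≤ ‖x‖ + ‖y‖ := by
    change max ‖x‖ ‖y‖ ≤ _
    exact max_le_add_of_nonneg (norm_nonneg _) (norm_nonneg _)
  rw [h1]
  exact (F.le_opNorm _).trans (by gcongr)

/-- At points `σ v` the relative bound becomes an absolute one, `2ε(c + 1)‖v‖`, the 2 coming from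
interchanging `S` and `S'`. The Sylvester estimate halves it. -/
theorem IsSpectralCut.norm_compression_le_of_isRelClose {S S' : E →ₗ.[ℂ] E}
    (hS : IsSelfAdjointGraph S) (hS' : IsSelfAdjointGraph S') {P e σ P' e' σ' : E →L[ℂ] E}
    (h : IsSpectralCut S P e σ) (h' : IsSpectralCut S' P' e' σ') {ε c : ℝ} (hε : 0 ≤ ε)
    (hε' : ε ≤ 1 / 2) (hc : ‖σ‖ ≤ c) (hc' : ‖σ'‖ ≤ c) (hcl : IsRelClose S S' ε) :
    ‖(1 - P') * (1 - e') * (P * (1 - e))‖ ≤ ε * (c + 1) ∧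
      ‖(1 - P) * (1 - e) * (P' * (1 - e'))‖ ≤ ε * (c + 1) := by
  have hcl' := hcl.symm hε hε'
  have key : ∀ {S S' : E →ₗ.[ℂ] E} {P e σ : E →L[ℂ] E}, IsSpectralCut S P e σ → ‖σ‖ ≤ c →
      IsRelClose S S' (2 * ε) → ∀ v y', (σ v, y') ∈ S'.graph →
        ‖y' - (v - e v)‖ ≤ 2 * ε * (c + 1) * ‖v‖ := by
    intro S S' P e σ h hc hcl v y' hy'
    have h1 := hcl.2 _ _ _ (h.graph v) hy'
    have h2 : ‖σ v‖ ≤ c * ‖v‖ := (σ.le_opNorm _).trans (by gcongr)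
    have h3 : ‖v - e v‖ ≤ 1 * ‖v‖ :=
      ((1 - e).le_opNorm v).trans (by gcongr; exact h.projE.one_sub.norm_le)
    calc _ ≤ _ := h1
      _ ≤ 2 * ε * (c * ‖v‖ + 1 * ‖v‖) := by gcongr
      _ = _ := by ring
  have hcl2 : IsRelClose S S' (2 * ε) := ⟨hcl.1, fun x y y' hy hy' => (hcl.2 x y y' hy hy').trans
    (by gcongr; linarith)⟩
  have hc0 : 0 ≤ c := (norm_nonneg _).trans hc
  have hpos : 0 ≤ 2 * ε * (c + 1) := by positivity
  have e1 : ε * (c + 1) = 2 * ε * (c + 1) / 2 := by ring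
  rw [e1]
  exact ⟨h.norm_compression_le hS hS' hcl.1 h' hpos (key h hc hcl2) (key h' hc' hcl'),
    h'.norm_compression_le hS' hS hcl'.1 h hpos (key h' hc' hcl') (key h hc hcl2)⟩

/-- Only the part of `(1 - P')P` away from 0 is covered by the Sylvester bound. The remainder
consists of three terms containing `e' - e` or `P'e' - Pe`, which accounts for `3κ`. -/
theorem norm_compression_le_of_near {P e P' e' : E →L[ℂ] E} (hP : IsStarProjection P)
    (hP' : IsStarProjection P') (he : IsStarProjection e)
    {κ δ : ℝ} (h : ‖(1 - P') * (1 - e') * (P * (1 - e))‖ ≤ δ) (h₁ : ‖e' - e‖ ≤ κ)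
    (h₂ : ‖P' * e' - P * e‖ ≤ κ) (hc : Commute P e) :
    ‖(1 - P') * P‖ ≤ δ + 3 * κ := by
  have e1 : (1 - P') * P = (1 - P') * (1 - e') * (P * (1 - e)) +
      (-((1 - P') * (P' * e' - P * e))) +
      ((e' - e) * (P * (1 - e)) - (P' * e' - P * e) * (P * (1 - e))) := by
    have z1 : (1 - P') * (P' * e') = 0 := by
      rw [← mul_assoc, sub_mul, one_mul, hP'.isIdempotentElem.eq, sub_self, zero_mul]
    have z2 : (e - P * e) * (P * (1 - e)) = 0 := by
      have : (e - P * e) * P = 0 := by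
        rw [sub_mul, hc.eq, mul_assoc, hP.isIdempotentElem.eq, sub_self]
      rw [← mul_assoc, this, zero_mul]
    have z3 : (1 - P') * e' * (P * (1 - e)) = (e' - P' * e') * (P * (1 - e)) := by
      rw [sub_mul 1 P', one_mul]
    have z4 : (1 - P') * P = (1 - P') * (1 - e') * (P * (1 - e)) + (1 - P') * e' * (P * (1 - e)) +
        (1 - P') * (P * e) := by noncomm_ring
    rw [z4, z3, mul_sub (1 - P') (P' * e'), z1, zero_sub, neg_neg, ← sub_mul]
    have z5 : (e' - e - (P' * e' - P * e)) * (P * (1 - e)) =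
        (e' - P' * e') * (P * (1 - e)) - (e - P * e) * (P * (1 - e)) := by
      rw [← sub_mul]; congr 1; abel
    rw [z5, z2, sub_zero]; abel
  have hq : ‖1 - P'‖ ≤ 1 := hP'.one_sub.norm_le
  have hPf : ‖P * (1 - e)‖ ≤ 1 := (norm_mul_le _ _).trans
    (mul_le_one₀ hP.norm_le (norm_nonneg _) he.one_sub.norm_le)
  have hκ : 0 ≤ κ := (norm_nonneg _).trans h₁
  have n1 : ‖-((1 - P') * (P' * e' - P * e))‖ ≤ κ := by
    rw [norm_neg]
    calc _ ≤ ‖1 - P'‖ * ‖P' * e' - P * e‖ := norm_mul_le _ _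
      _ ≤ 1 * κ := by gcongr
      _ = κ := one_mul κ
  have n2 : ‖(e' - e) * (P * (1 - e))‖ ≤ κ := by
    calc _ ≤ ‖e' - e‖ * ‖P * (1 - e)‖ := norm_mul_le _ _
      _ ≤ κ * 1 := by gcongr
      _ = κ := mul_one κ
  have n3 : ‖(P' * e' - P * e) * (P * (1 - e))‖ ≤ κ := by
    calc _ ≤ ‖P' * e' - P * e‖ * ‖P * (1 - e)‖ := norm_mul_le _ _
      _ ≤ κ * 1 := by gcongr
      _ = κ := mul_one κ
  rw [e1]
  have m1 := norm_add_le ((1 - P') * (1 - e') * (P * (1 - e)) +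
      (-((1 - P') * (P' * e' - P * e))))
      ((e' - e) * (P * (1 - e)) - (P' * e' - P * e) * (P * (1 - e)))
  have m2 := norm_add_le ((1 - P') * (1 - e') * (P * (1 - e))) (-((1 - P') * (P' * e' - P * e)))
  have m3 := norm_sub_le ((e' - e) * (P * (1 - e))) ((P' * e' - P * e) * (P * (1 - e)))
  linarith

/-- Norm continuity of the spectral projections, given norm continuity near `0`. -/
theorem IsSpectralCut.norm_sub_le {S S' : E →ₗ.[ℂ] E}
    (hS : IsSelfAdjointGraph S) (hS' : IsSelfAdjointGraph S') {P e σ P' e' σ' : E →L[ℂ] E}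
    (h : IsSpectralCut S P e σ) (h' : IsSpectralCut S' P' e' σ') {ε c κ : ℝ} (hε : 0 ≤ ε)
    (hε' : ε ≤ 1 / 2) (hc : ‖σ‖ ≤ c) (hc' : ‖σ'‖ ≤ c) (hcl : IsRelClose S S' ε)
    (h₁ : ‖e' - e‖ ≤ κ) (h₂ : ‖P' * e' - P * e‖ ≤ κ) :
    ‖P - P'‖ ≤ 2 * (ε * (c + 1) + 3 * κ) := by
  obtain ⟨k1, k2⟩ := h.norm_compression_le_of_isRelClose hS hS' h' hε hε' hc hc' hcl
  have l1 := norm_compression_le_of_near h.projP h'.projP h.projE k1 h₁ h₂ h.commPE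
  have l2 := norm_compression_le_of_near h'.projP h.projP h'.projE k2
    (κ := κ) (by rwa [norm_sub_rev e e']) (by rwa [norm_sub_rev (P * e)]) h'.commPE
  -- A difference of projections is controlled by the two mixed compressions.
  have e1 : P - P' = (1 - P') * P - star ((1 - P) * P') := by
    rw [star_mul, star_sub, star_one, h.projP.isSelfAdjoint.star_eq,
      h'.projP.isSelfAdjoint.star_eq]
    noncomm_ring
  rw [e1]
  have := _root_.norm_sub_le ((1 - P') * P) (star ((1 - P) * P'))
  rw [norm_star] at this
  linarith

end Cut

/-! ### Continuity of spectral projections of Γ-Fredholm operators. -/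

section Fredholm

variable {Γ : Type v} [Group Γ] {H K : HilbertModule.{u} Γ}

theorem exists_isGapPair {S : H →ₗ.[ℂ] H} (hS : IsSelfAdjointGraph S) :
    ∃ R, IsGapPair S R (gapTransform S) := by
  set g := (graphSubmodule S).topologicalClosure with hg
  have hgc : g = graphSubmodule S :=
    (isClosed_graphSubmodule hS.isClosed).submodule_topologicalClosure_eq
  refine ⟨(WithLp.fstL 2 ℂ H H) ∘L g.starProjection ∘L
    (WithLp.prodContinuousLinearEquiv 2 ℂ H H).symm.toContinuousLinearMap ∘L
      (ContinuousLinearMap.inl ℂ H H), fun y => ?_, fun y => hS.maximal fun x x' hx => ?_⟩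
  · have : g.starProjection (WithLp.toLp 2 (y, (0 : H))) ∈ g :=
      Submodule.starProjection_apply_mem _ _
    exact hgc.le this
  · set p := g.starProjection (WithLp.toLp 2 (y, (0 : H))) with hp
    have h1 : WithLp.toLp 2 (x, x') ∈ g := by rw [hgc]; exact hx
    have h2 := Submodule.starProjection_inner_eq_zero (K := g) (WithLp.toLp 2 (y, (0 : H))) _ h1
    rw [← hp, WithLp.prod_inner_apply] at h2
    have h3 : ⟪y - p.fst, x⟫_ℂ + ⟪0 - p.snd, x'⟫_ℂ = 0 := h2
    rw [zero_sub, inner_neg_left] at h3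
    change ⟪x', p.snd⟫_ℂ = ⟪x, y - p.fst⟫_ℂ
    rw [← inner_conj_symm, ← inner_conj_symm x, ← sub_eq_zero.1 ((sub_eq_add_neg _ _).trans h3)]

/-- A self-adjoint operator that commutes with `Γ` and has a left parametrix. -/
structure IsSelfAdjointFredholmGraph (S : H →ₗ.[ℂ] H) : Prop where
  selfAdjoint : IsSelfAdjointGraph S
  equiv : ∀ (γ : Γ) (x y : H), (x, y) ∈ S.graph → (H.ρ γ x, H.ρ γ y) ∈ S.graph
  parametrix : ∃ Y C : H →L[ℂ] H, IsEquivariant Y ∧ C ∈ gammaCompact H H ∧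
    ∀ x y, (x, y) ∈ S.graph → Y y = x + C x

/-- Only the right parametrix is used: `S b = 1 + C` on `H`, and taking adjoints gives `b* S = 1 +
C*` on the domain. Compactness on the domain module with its graph norm is thereby avoided. -/
theorem IsSelfAdjointGammaFredholm.isSelfAdjointFredholmGraph {S : H →ₗ.[ℂ] H}
    (hS : IsSelfAdjointGammaFredholm S) : IsSelfAdjointFredholmGraph S := by
  obtain ⟨hd, hsa, he, -, B, hB, -, hAB⟩ := hS
  have hsg := isSelfAdjointGraph_of_isSelfAdjoint hd hsa
  refine ⟨hsg, fun γ x y h => ?_, ?_⟩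
  · obtain ⟨a, rfl, rfl⟩ := (LinearPMap.mem_graph_iff S).1 h
    obtain ⟨h1, h2⟩ := he γ a
    exact (LinearPMap.mem_graph_iff S).2 ⟨⟨_, h1⟩, rfl, h2⟩
  · set b : H →L[ℂ] H := (WithLp.fstL 2 ℂ H H) ∘L (graphSubmodule S).subtypeL ∘L B with hb
    set C := ofDomain S hsa.isClosed he ∘L B - ContinuousLinearMap.id ℂ H with hC
    have hbe : IsEquivariant b := fun γ x => by
      exact congrArg (fun p => ((graphSubmodule S).subtypeL p).fst) (hB γ x)
    have hgr : ∀ u, (b u, u + C u) ∈ S.graph := fun u => by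
      have h1 : u + C u = ofDomain S hsa.isClosed he (B u) := by
        change u + (ofDomain S hsa.isClosed he (B u) - u) = _
        abel
      rw [h1]
      exact (B u).2
    refine ⟨star b, star C, hbe.star, star_mem_gammaCompact hAB, fun x y h => ?_⟩
    refine ext_inner_right ℂ fun u => ?_
    rw [ContinuousLinearMap.star_eq_adjoint, ContinuousLinearMap.star_eq_adjoint,
      ContinuousLinearMap.adjoint_inner_left, hsg.symm h (hgr u), inner_add_right, inner_add_left,
      ContinuousLinearMap.adjoint_inner_left]

theorem DomainIso.mem_graph_pullback {S : H →ₗ.[ℂ] H} {S' : K →ₗ.[ℂ] K} (Q : DomainIso S S')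
    (x y : H) : (x, y) ∈ Q.pullback.graph ↔ (Q.toIso x, Q.toIso y) ∈ S'.graph := by
  rw [LinearPMap.mem_graph_iff, LinearPMap.mem_graph_iff]
  constructor
  · rintro ⟨a, rfl, rfl⟩
    exact ⟨⟨Q.toIso a, (Q.mem_domain a).2 a.2⟩, rfl, (Q.toIso.apply_symm_apply _).symm⟩
  · rintro ⟨⟨a, ha⟩, h1, h2⟩
    have h1 : a = Q.toIso x := h1
    subst h1
    refine ⟨⟨x, (Q.mem_domain x).1 ha⟩, rfl, Q.toIso.injective ?_⟩
    exact (Q.toIso.apply_symm_apply _).trans h2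

/-- The unitary isomorphism underlying a `DomainIso`, as a bounded operator. -/
def DomainIso.toCLM {S : H →ₗ.[ℂ] H} {S' : K →ₗ.[ℂ] K} (Q : DomainIso S S') : H →L[ℂ] K :=
  Q.toIso.toContinuousLinearEquiv.toContinuousLinearMap

/-- The inverse of the unitary isomorphism underlying a `DomainIso`, as a bounded operator. -/
def DomainIso.symmCLM {S : H →ₗ.[ℂ] H} {S' : K →ₗ.[ℂ] K} (Q : DomainIso S S') : K →L[ℂ] H :=
  Q.toIso.symm.toContinuousLinearEquiv.toContinuousLinearMap

theorem DomainIso.isEquivariant_symmCLM {S : H →ₗ.[ℂ] H} {S' : K →ₗ.[ℂ] K} (Q : DomainIso S S') :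
    IsEquivariant Q.symmCLM := fun γ x => Q.toIso.injective <| by
  change Q.toIso (Q.toIso.symm (K.ρ γ x)) = Q.toIso (H.ρ γ (Q.toIso.symm x))
  rw [Q.equivariant, Q.toIso.apply_symm_apply, Q.toIso.apply_symm_apply]

theorem IsSelfAdjointFredholmGraph.pullback {S : H →ₗ.[ℂ] H} {S' : K →ₗ.[ℂ] K}
    (Q : DomainIso S S') (hS : IsSelfAdjointFredholmGraph S') :
    IsSelfAdjointFredholmGraph Q.pullback := by
  obtain ⟨Y, C, hY, hC, hYC⟩ := hS.parametrix
  refine ⟨hS.selfAdjoint.conj Q.toIso Q.mem_graph_pullback, fun γ x y h => ?_,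
    Q.symmCLM ∘L Y ∘L Q.toCLM, Q.symmCLM ∘L C ∘L Q.toCLM,
    Q.isEquivariant_symmCLM.comp (hY.comp Q.equivariant),
    conj_mem_gammaCompact hC Q.isEquivariant_symmCLM Q.equivariant, fun x y h => ?_⟩
  · rw [Q.mem_graph_pullback] at h ⊢
    rw [Q.equivariant, Q.equivariant]
    exact hS.equiv γ _ _ h
  · change Q.toIso.symm (Y (Q.toIso y)) = x + Q.toIso.symm (C (Q.toIso x))
    rw [hYC _ _ ((Q.mem_graph_pullback x y).1 h), map_add, Q.toIso.symm_apply_apply]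

variable {S : H →ₗ.[ℂ] H}

theorem exists_isEquivariant_isGapPair (hS : IsSelfAdjointGraph S)
    (he : ∀ (γ : Γ) (x y : H), (x, y) ∈ S.graph → (H.ρ γ x, H.ρ γ y) ∈ S.graph) :
    ∃ R, IsGapPair S R (gapTransform S) ∧ (∀ γ, Commute (H.ρL γ) R) ∧
      IsEquivariant (gapTransform S) := by
  obtain ⟨R, hR⟩ := exists_isGapPair hS
  exact ⟨R, hR, fun γ => (hR.commute_of_graph_map hS (he γ)).1,
    isEquivariant_iff_commute.2 fun γ => (hR.commute_of_graph_map hS (he γ)).2⟩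

theorem IsSelfAdjointFredholmGraph.isEquivariantProj (hS : IsSelfAdjointFredholmGraph S) :
    IsEquivariantProj (nonnegProjection S) := by
  obtain ⟨R, -, -, hG⟩ := exists_isEquivariant_isGapPair hS.selfAdjoint hS.equiv
  exact ⟨isStarProjection_spectralProj _, isEquivariant_spectralProj hG⟩

theorem exists_cut (hS : IsSelfAdjointGraph S)
    (he : ∀ (γ : Γ) (x y : H), (x, y) ∈ S.graph → (H.ρ γ x, H.ρ γ y) ∈ S.graph) {s : ℝ}
    (hs : 0 < s) (hs1 : s < 1) :
    ∃ e σ A : H →L[ℂ] H, IsSpectralCut S (nonnegProjection S) e σ ∧ IsEquivariant e ∧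
      ‖σ‖ ≤ (1 - s)⁻¹ ∧ (∀ v, (e v, A v) ∈ S.graph) ∧
      (∀ v, ‖A v‖ ^ 2 ≤ (s⁻¹ - 1) * ‖e v‖ ^ 2) := by
  obtain ⟨R, hR, hRe, -⟩ := exists_isEquivariant_isGapPair hS he
  obtain ⟨e, σ, A, h1, h2, h3, h4, h5⟩ := exists_isSpectralCut hS hR hs hs1
  exact ⟨e, σ, A, h1, isEquivariant_iff_commute.2 fun γ => h5 _ (hRe γ), h2, h3, h4⟩

/-- An equivariant projection onto a subspace on which an operator close to a `Γ`-Fredholm operator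
is small is `Γ`-compact. -/
theorem mem_gammaCompact_of_small {e C : H →L[ℂ] H} (he : IsStarProjection e)
    (hee : IsEquivariant e) (hC : C ∈ gammaCompact H H)
    (h : ‖e + C * e‖ < 1) : e ∈ gammaCompact H H := by
  have hCe := isEquivariant_of_mem_gammaCompact hC
  set X := e + C * e with hX
  have hXe : X * e = X := by
    rw [hX, add_mul, mul_assoc, he.isIdempotentElem.eq]
  have hXeq : IsEquivariant X := hee.add (hCe.mul hee)
  obtain ⟨g, hg, -, hge, -⟩ := exists_inverse_one_add hXeq.neg (by rwa [norm_neg])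
  -- `X e = X` gives `(1 - X) e = -C e`, and `1 - X` is invertible because `‖X‖ < 1`; so `e` is a
  -- multiple of the Γ-compact `C`.
  have h1 : (1 + -X) * e = -(C * e) := by
    rw [add_mul, one_mul, neg_mul, hXe, hX]; abel
  have h2 : e = g * -(C * e) := by
    rw [← h1, ← mul_assoc, hg, one_mul]
  rw [h2]
  exact mul_mem_gammaCompact_left hge (neg_mem_gammaCompact (mul_mem_gammaCompact_right hee hC))

theorem exists_compression_eq_add {P e P' e' : H →L[ℂ] H} (hP : IsEquivariant P)
    (hP' : IsEquivariant P') (he : IsEquivariant e) (hec : e ∈ gammaCompact H H)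
    (hec' : e' ∈ gammaCompact H H) : ∃ C ∈ gammaCompact H H,
      (1 - P') * P = (1 - P') * (1 - e') * (P * (1 - e)) + C := by
  have hq : IsEquivariant (1 - P') := isEquivariant_one.sub hP'
  refine ⟨(1 - P') * e' * (P * (1 - e)) + (1 - P') * (P * e), add_mem_gammaCompact ?_ ?_, ?_⟩
  · exact mul_mem_gammaCompact_right (hP.mul (isEquivariant_one.sub he))
      (mul_mem_gammaCompact_left hq hec')
  · exact mul_mem_gammaCompact_left hq (mul_mem_gammaCompact_left hP hec)
  · noncomm_ring

/-- The class of the spectral projection in the `Γ`-Calkin algebra depends continuously on a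
self-adjoint `Γ`-Fredholm operator, for relatively bounded perturbations. -/
theorem exists_calkinNorm_nonnegProjection_sub_lt (hS : IsSelfAdjointFredholmGraph S) {ε : ℝ}
    (hε : 0 < ε) : ∃ δ > 0, ∀ S' : H →ₗ.[ℂ] H, IsSelfAdjointFredholmGraph S' →
      IsRelClose S S' δ → calkinNorm (nonnegProjection S - nonnegProjection S') < ε := by
  obtain ⟨Y, C, hY, hC, hYC⟩ := hS.parametrix
  set m := ‖Y‖ + 1 with hm
  have hm0 : 1 ≤ m := by rw [hm]; linarith [norm_nonneg Y]
  have hYm : ‖Y‖ ≤ m := by rw [hm]; linarith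
  -- `κ` is the cut-off for `|S|`, and `s = (1 + κ²)⁻¹` the corresponding level of `(1 + S²)⁻¹`. It
  -- is so small that `Y S e` has norm at most `m κ = 1/4`.
  set κ := 1 / (4 * m) with hκ
  have hκ0 : 0 < κ := by positivity
  have hκm : m * κ = 1 / 4 := by rw [hκ]; field_simp
  set s := (1 + κ ^ 2)⁻¹ with hs
  have hs0 : 0 < s := by positivity
  have hs1 : s < 1 := inv_lt_one_of_one_lt₀ (by linarith [pow_pos hκ0 2])
  have hsκ : s⁻¹ - 1 = κ ^ 2 := by rw [hs, inv_inv]; ring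
  set c := (1 - s)⁻¹ with hc
  have hc0 : 0 < c := inv_pos.2 (by linarith)
  -- The first bound keeps `Y S e'` below norm 1/2 after the perturbation; the second makes each of
  -- the two compressions at most `ε/4`.
  set δ := min (1 / (20 * m)) (ε / (4 * (c + 1))) with hδ
  have hδ0 : 0 < δ := lt_min (by positivity) (by positivity)
  have hδm : m * δ ≤ 1 / 20 := by
    calc m * δ ≤ m * (1 / (20 * m)) := by gcongr; exact min_le_left _ _
      _ = 1 / 20 := by field_simp
  have hδε : δ * (c + 1) ≤ ε / 4 := by
    calc δ * (c + 1) ≤ ε / (4 * (c + 1)) * (c + 1) := by gcongr; exact min_le_right _ _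
      _ = ε / 4 := by field_simp
  have hδ2 : δ ≤ 1 / 20 := by nlinarith
  have hκ1 : κ ≤ 1 / 4 := by nlinarith
  -- On `ran e` the operator `T`, hence also `S`, is small, and `Y S e = e + C e` then forces `e` to
  -- be Γ-compact. This is applied to `S` and to `S'`.
  have key : ∀ T : H →ₗ.[ℂ] H, IsRelClose T S (2 * δ) → ∀ e A : H →L[ℂ] H, IsStarProjection e →
      IsEquivariant e → (∀ v, (e v, A v) ∈ T.graph) →
      (∀ v, ‖A v‖ ^ 2 ≤ (s⁻¹ - 1) * ‖e v‖ ^ 2) → e ∈ gammaCompact H H := by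
    intro T hT e A he hee hg hA
    refine mem_gammaCompact_of_small he hee hC (lt_of_le_of_lt
      (ContinuousLinearMap.opNorm_le_bound _ (by norm_num : (0 : ℝ) ≤ 1 / 2) fun v => ?_)
      (by norm_num : (1 / 2 : ℝ) < 1))
    have hx : e v ∈ S.domain := by
      rw [← hT.1]; exact LinearPMap.mem_domain_of_mem_graph (hg v)
    have hy : (e v, S ⟨e v, hx⟩) ∈ S.graph := (LinearPMap.mem_graph_iff _).2 ⟨⟨_, hx⟩, rfl, rfl⟩
    set y := S ⟨e v, hx⟩
    have h1 : (e + C * e) v = Y y := (hYC _ _ hy).symm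
    have h2 := hT.2 _ _ _ (hg v) hy
    have h3 : ‖A v‖ ≤ κ * ‖e v‖ := by
      refine le_of_sq_le_sq ?_ (by positivity)
      rw [mul_pow, ← hsκ]; exact hA v
    have h4 : ‖e v‖ ≤ ‖v‖ := by
      have := e.le_opNorm v
      have := he.norm_le
      nlinarith [norm_nonneg v]
    have h5 : ‖y‖ ≤ ‖A v‖ + ‖y - A v‖ := by
      have := norm_sub_norm_le y (A v); linarith
    have h6 : ‖y‖ ≤ (κ + 2 * δ * (1 + κ)) * ‖v‖ := by
      calc ‖y‖ ≤ κ * ‖e v‖ + 2 * δ * (‖e v‖ + κ * ‖e v‖) := by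
            refine h5.trans (add_le_add h3 (h2.trans ?_)); gcongr
        _ = (κ + 2 * δ * (1 + κ)) * ‖e v‖ := by ring
        _ ≤ _ := by gcongr
    rw [h1]
    have h7 : m * (κ + 2 * δ * (1 + κ)) ≤ 1 / 2 := by
      have : m * (κ + 2 * δ * (1 + κ)) = m * κ + 2 * (m * δ) * (1 + κ) := by ring
      rw [this, hκm]
      nlinarith
    calc ‖Y y‖ ≤ ‖Y‖ * ‖y‖ := Y.le_opNorm y
      _ ≤ m * ((κ + 2 * δ * (1 + κ)) * ‖v‖) := by gcongr
      _ = m * (κ + 2 * δ * (1 + κ)) * ‖v‖ := by ring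
      _ ≤ 1 / 2 * ‖v‖ := by gcongr
  refine ⟨δ, hδ0, fun S' hS' hcl => ?_⟩
  obtain ⟨e, σ, A, hcut, hee, hσ, hg, hA⟩ := exists_cut hS.selfAdjoint hS.equiv hs0 hs1
  obtain ⟨e', σ', A', hcut', hee', hσ', hg', hA'⟩ := exists_cut hS'.selfAdjoint hS'.equiv hs0 hs1
  have hec : e ∈ gammaCompact H H := key S ⟨rfl, fun x y y' h h' => by
    rw [graph_snd_eq h h', sub_self, norm_zero]; positivity⟩ e A hcut.projE hee hg hA
  have hec' : e' ∈ gammaCompact H H :=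
    key S' (hcl.symm hδ0.le (by linarith)) e' A' hcut'.projE hee' hg' hA'
  obtain ⟨k1, k2⟩ := hcut.norm_compression_le_of_isRelClose hS.selfAdjoint hS'.selfAdjoint hcut'
    hδ0.le (by linarith) hσ hσ' hcl
  have hP := hS.isEquivariantProj
  have hP' := hS'.isEquivariantProj
  set P := nonnegProjection S
  set P' := nonnegProjection S'
  obtain ⟨C₁, hC₁, e₁⟩ := exists_compression_eq_add hP.equiv hP'.equiv hee hec hec'
  obtain ⟨C₂, hC₂, e₂⟩ := exists_compression_eq_add hP'.equiv hP.equiv hee' hec' hec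
  have e3 : P - P' = (1 - P') * P - star ((1 - P) * P') := by
    rw [star_mul, star_sub, star_one, hP.proj.isSelfAdjoint.star_eq,
      hP'.proj.isSelfAdjoint.star_eq]
    noncomm_ring
  refine calkinNorm_lt_iff.2 ⟨(1 - P') * (1 - e') * (P * (1 - e)) -
    star ((1 - P) * (1 - e) * (P' * (1 - e'))), C₁ - star C₂,
    sub_mem_gammaCompact hC₁ (star_mem_gammaCompact hC₂), ?_, ?_⟩
  · rw [e3, e₁, e₂, star_add]; abel
  · have := _root_.norm_sub_le ((1 - P') * (1 - e') * (P * (1 - e)))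
      (star ((1 - P) * (1 - e) * (P' * (1 - e'))))
    rw [norm_star] at this
    linarith

theorem nonnegProjection_conj {S' : H →ₗ.[ℂ] H} (hS : IsSelfAdjointGraph S)
    (hS' : IsSelfAdjointGraph S') {w : H →L[ℂ] H} (hw : IsEquivariantUnitary w)
    (hg : ∀ x y, (x, y) ∈ S'.graph ↔ (w x, w y) ∈ S.graph) :
    nonnegProjection S' = star w * nonnegProjection S * w := by
  obtain ⟨R, hR⟩ := exists_isGapPair hS
  obtain ⟨R', hR'⟩ := exists_isGapPair hS'
  change spectralProj (gapTransform S') = star w * spectralProj (gapTransform S) * w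
  rw [← spectralProj_conj hw.star_mul_self hw.mul_star_self (hR.isSelfAdjoint_G hS),
    hR'.unique hS' (hR.conj hw.mul_star_self hg)]

/-- Continuity of the conjugates of a spectral projection under a path of unitary operators which is
continuous only on the domain. -/
theorem norm_conj_nonnegProjection_sub_le {S' S'' : H →ₗ.[ℂ] H} (hS : IsSelfAdjointFredholmGraph S)
    (hS' : IsSelfAdjointGraph S') (hS'' : IsSelfAdjointGraph S'') {w w' : H →L[ℂ] H}
    (hw : IsEquivariantUnitary w) (hw' : IsEquivariantUnitary w')
    (hg : ∀ x y, (x, y) ∈ S'.graph ↔ (w x, w y) ∈ S.graph)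
    (hg' : ∀ x y, (x, y) ∈ S''.graph ↔ (w' x, w' y) ∈ S.graph) {δ : ℝ} (hδ : 0 ≤ δ)
    (hδ' : δ ≤ 1 / 2) (hcl : IsRelClose S' S'' δ)
    (hd : ∀ x y, (x, y) ∈ S.graph → ‖star w' x - star w x‖ ≤ δ * (‖x‖ + ‖y‖)) :
    ‖star w * nonnegProjection S * w - star w' * nonnegProjection S * w'‖ ≤ 30 * δ := by
  obtain ⟨e, σ, A, hcut, hee, hσ, hgA, hA⟩ :=
    exists_cut hS.selfAdjoint hS.equiv (s := 1 / 2) (by norm_num) (by norm_num)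
  have hep := hcut.projE
  have hPp := hcut.projP
  set P := nonnegProjection S
  have hσn : ∀ {u : H →L[ℂ] H}, IsEquivariantUnitary u → ‖star u * σ * u‖ ≤ 2 := fun {u} hu => by
    have := hu.norm_le
    calc ‖star u * σ * u‖ ≤ ‖star u‖ * ‖σ‖ * ‖u‖ :=
          (norm_mul_le _ _).trans (by gcongr; exact norm_mul_le _ _)
      _ ≤ 1 * (1 - 1 / 2)⁻¹ * 1 := by rw [norm_star]; gcongr
      _ = 2 := by norm_num
  -- `ran e` lies in the domain and `‖S e v‖ ≤ ‖e v‖` for the level 1/2, so closeness of `w*` and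
  -- `w'*` on the domain becomes norm closeness after multiplication by `e`.
  have hde : ‖(star w' - star w) * e‖ ≤ 2 * δ := by
    refine ContinuousLinearMap.opNorm_le_bound _ (by positivity) fun v => ?_
    have h1 : ‖A v‖ ≤ ‖e v‖ := by
      refine le_of_sq_le_sq ((hA v).trans (le_of_eq ?_)) (norm_nonneg _)
      norm_num
    have h4 : ‖e v‖ ≤ ‖v‖ := by
      have := e.le_opNorm v
      have := hep.norm_le
      nlinarith [norm_nonneg v]
    calc _ ≤ δ * (‖e v‖ + ‖A v‖) := hd _ _ (hgA v)
      _ ≤ δ * (‖v‖ + ‖v‖) := by gcongr; exact h1.trans h4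
      _ = _ := by ring
  have hconj : ∀ f : H →L[ℂ] H, star f = f → e * f = f → ‖f‖ ≤ 1 →
      ‖star w' * f * w' - star w * f * w‖ ≤ 4 * δ := fun f hfs hef hfn => by
    have h1 : ‖(star w' - star w) * f‖ ≤ 2 * δ := by
      calc ‖(star w' - star w) * f‖ = ‖(star w' - star w) * e * f‖ := by rw [mul_assoc, hef]
        _ ≤ ‖(star w' - star w) * e‖ * ‖f‖ := norm_mul_le _ _
        _ ≤ 2 * δ * 1 := by gcongr
        _ = _ := mul_one _
    have h2 : star w' * f * w' - star w * f * w =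
        (star w' - star w) * f * w' + star w * star ((star w' - star w) * f) := by
      rw [star_mul, hfs, star_sub, star_star, star_star]
      noncomm_ring
    have n1 := hw.norm_le
    have n2 := hw'.norm_le
    calc _ ≤ ‖(star w' - star w) * f * w'‖ + ‖star w * star ((star w' - star w) * f)‖ := by
          rw [h2]; exact norm_add_le _ _
      _ ≤ ‖(star w' - star w) * f‖ * ‖w'‖ + ‖star w‖ * ‖star ((star w' - star w) * f)‖ :=
          add_le_add (norm_mul_le _ _) (norm_mul_le _ _)
      _ ≤ 2 * δ * 1 + 1 * (2 * δ) := by rw [norm_star, norm_star]; gcongr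
      _ = 4 * δ := by ring
  have k1 := hconj e hep.isSelfAdjoint.star_eq hep.isIdempotentElem.eq hep.norm_le
  have k2 := hconj (P * e)
    (by rw [star_mul, hep.isSelfAdjoint.star_eq, hPp.isSelfAdjoint.star_eq, hcut.commPE.eq])
    (by rw [hcut.commPE.eq, ← mul_assoc, hep.isIdempotentElem.eq])
    ((norm_mul_le _ _).trans (mul_le_one₀ hPp.norm_le (norm_nonneg _) hep.norm_le))
  -- With `c = 2` and `κ = 4δ` the bound is `2(3δ + 12δ) = 30δ`.
  have := (hcut.conj hw.mul_star_self hg).norm_sub_le hS' hS''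
    (hcut.conj hw'.mul_star_self hg') hδ hδ' (hσn hw) (hσn hw') hcl k1
    (by rw [hw.conj_mul, hw'.conj_mul]; exact k2)
  linarith

end Fredholm

/-! ### Spectral flow of Calkin-continuous paths of projections. -/

section CalkinPath

variable {Γ : Type v} [Group Γ] {H : HilbertModule.{u} Γ}

/-- A path of projections which is continuous in the `Γ`-Calkin algebra. -/
structure IsCalkinPath {X : Type*} [TopologicalSpace X] (P : X → H →L[ℂ] H) : Prop where
  proj : ∀ t, IsEquivariantProj (P t)
  cont : ∀ t₀, ∀ ε > (0 : ℝ), ∀ᶠ t in 𝓝 t₀, calkinNorm (P t₀ - P t) < ε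

/-- A function whose local increments are the relative indices of a path of projections. -/
def IsIndexPrimitive {X : Type*} [TopologicalSpace X] (P : X → H →L[ℂ] H) (F : X → ℝ) : Prop :=
  ∀ t₀, ∀ᶠ t in 𝓝 t₀, F t - F t₀ = relIndex (P t₀) (P t)

theorem IsCalkinPath.eventually_relIndex {X : Type*} [TopologicalSpace X] {P : X → H →L[ℂ] H}
    (hP : IsCalkinPath P) {s t : X} (h : calkinNorm (P s - P t) < 1) :
    ∀ᶠ t' in 𝓝 t, relIndex (P s) (P t') = relIndex (P s) (P t) + relIndex (P t) (P t') := by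
  obtain ⟨d, hd, hd1⟩ := exists_between h
  filter_upwards [hP.cont t ((1 - d) / 2) (by linarith)] with t' ht'
  exact relIndex_add (hP.proj s) (hP.proj t) (hP.proj t') hd1 hd ht' le_rfl

theorem relIndex_self {P : H →L[ℂ] H} (hP : IsStarProjection P) : relIndex P P = 0 :=
  relIndex_eq_zero_of_norm_sub_lt_one hP hP (by rw [sub_self, norm_zero]; exact zero_lt_one)

variable {t₁ t₂ : ℝ} {P : Set.Icc t₁ t₂ → H →L[ℂ] H}

theorem isPreconnected_Icc_subtype (s u : Set.Icc t₁ t₂) : IsPreconnected (Set.Icc s u) := by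
  rw [← Topology.IsInducing.subtypeVal.isPreconnected_image]
  have : Subtype.val '' Set.Icc s u = Set.Icc (s : ℝ) (u : ℝ) := by
    ext x
    constructor
    · rintro ⟨y, hy, rfl⟩; exact hy
    · intro hx
      exact ⟨⟨x, s.2.1.trans hx.1, hx.2.trans u.2.2⟩, hx, rfl⟩
  rw [this]
  exact isPreconnected_Icc

/-- By additivity `Ind(P_s|P_t)` and `F(t)` have the same local increments, so their difference is
locally constant on the connected interval. -/
theorem IsCalkinPath.relIndex_eq_sub (hP : IsCalkinPath P) {F : Set.Icc t₁ t₂ → ℝ}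
    (hF : IsIndexPrimitive P F) {s u : Set.Icc t₁ t₂} (hsu : s ≤ u)
    (h : ∀ t ∈ Set.Icc s u, calkinNorm (P s - P t) < 1) : relIndex (P s) (P u) = F u - F s := by
  have hloc : IsLocallyConstant (fun t : Set.Icc s u => relIndex (P s) (P t) - F t) := by
    rw [IsLocallyConstant.iff_eventually_eq]
    intro t
    have := (hP.eventually_relIndex (h t t.2)).and (hF t)
    filter_upwards [continuous_subtype_val.tendsto t this] with t' ht'
    have h1 := ht'.1
    have h2 := ht'.2
    change relIndex (P s) (P t') - F t' = relIndex (P s) (P t) - F t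
    linarith
  have := Subtype.preconnectedSpace (isPreconnected_Icc_subtype s u)
  have h1 := hloc.apply_eq_of_preconnectedSpace ⟨u, hsu, le_rfl⟩ ⟨s, le_rfl, hsu⟩
  have h2 : relIndex (P s) (P u) - F u = relIndex (P s) (P s) - F s := h1
  rw [relIndex_self (hP.proj s).proj] at h2
  linarith

/-- Equal steps shorter than a Lebesgue number of the cover by neighbourhoods of Calkin radius 1/2.
-/
theorem IsCalkinPath.exists_subdivision (ht : t₁ < t₂) (hP : IsCalkinPath P) :
    ∃ (N : ℕ) (τ : Fin (N + 1) → Set.Icc t₁ t₂), StrictMono τ ∧ (τ 0 : ℝ) = t₁ ∧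
      (τ (Fin.last N) : ℝ) = t₂ ∧ ∀ j : Fin N, ∀ t ∈ Set.Icc (τ j.castSucc) (τ j.succ),
        ∀ t' ∈ Set.Icc (τ j.castSucc) (τ j.succ), calkinNorm (P t - P t') < 1 := by
  obtain ⟨δ, hδ, hball⟩ := lebesgue_number_lemma_of_metric (s := (Set.univ : Set (Set.Icc t₁ t₂)))
    (c := fun t₀ => interior {t | calkinNorm (P t₀ - P t) < 1 / 2}) isCompact_univ
    (fun _ => isOpen_interior) fun t₀ _ => Set.mem_iUnion.2 ⟨t₀, mem_interior_iff_mem_nhds.2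
      (hP.cont t₀ (1 / 2) (by norm_num))⟩
  obtain ⟨n, hn⟩ := exists_nat_gt ((t₂ - t₁) / δ)
  have hn0 : (0 : ℝ) < n := (div_pos (by linarith) hδ).trans hn
  have hstep : (t₂ - t₁) / n < δ := by
    rw [div_lt_iff₀ hδ] at hn
    rw [div_lt_iff₀ hn0]; linarith
  have hstep0 : 0 < (t₂ - t₁) / n := div_pos (by linarith) hn0
  have htop : n * ((t₂ - t₁) / n) = t₂ - t₁ := by field_simp
  refine ⟨n, fun j => ⟨t₁ + j * ((t₂ - t₁) / n), ?_, ?_⟩, fun i j hij => ?_, ?_, ?_,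
    fun j t h t' h' => ?_⟩
  · have : 0 ≤ (j : ℝ) * ((t₂ - t₁) / n) := by positivity
    linarith
  · have h1 : (j : ℝ) ≤ n := by exact_mod_cast Nat.lt_succ_iff.1 j.2
    have := mul_le_mul_of_nonneg_right h1 hstep0.le
    linarith
  · have h1 : ((i : ℕ) : ℝ) < (j : ℕ) := by exact_mod_cast hij
    change t₁ + i * ((t₂ - t₁) / n) < t₁ + j * ((t₂ - t₁) / n)
    have := mul_lt_mul_of_pos_right h1 hstep0
    linarith
  · simp
  · simp only [Fin.val_last]
    linarith
  · have hj : t₁ + ((j : ℕ) : ℝ) * ((t₂ - t₁) / n) ∈ Set.Icc t₁ t₂ := by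
      have h0 : 0 ≤ ((j : ℕ) : ℝ) * ((t₂ - t₁) / n) := by positivity
      have h1 : ((j : ℕ) : ℝ) ≤ n := by exact_mod_cast j.2.le
      have := mul_le_mul_of_nonneg_right h1 hstep0.le
      constructor <;> linarith
    obtain ⟨i, hi⟩ := hball ⟨_, hj⟩ (Set.mem_univ _)
    have key : ∀ x : Set.Icc t₁ t₂, t₁ + (j : ℕ) * ((t₂ - t₁) / n) ≤ x →
        (x : ℝ) ≤ t₁ + ((j : ℕ) + 1 : ℝ) * ((t₂ - t₁) / n) → calkinNorm (P i - P x) < 1 / 2 := by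
      intro x hx hx'
      have h1 : x ∈ interior {t | calkinNorm (P i - P t) < 1 / 2} := hi (by
        rw [Metric.mem_ball, Subtype.dist_eq, Real.dist_eq, abs_lt]
        constructor <;> linarith)
      exact (interior_subset h1 : x ∈ {t | calkinNorm (P i - P t) < 1 / 2})
    have e1 := key t h.1 (by
      have h2 : (t : ℝ) ≤ t₁ + ((j.succ : ℕ) : ℝ) * ((t₂ - t₁) / n) := h.2
      rwa [Fin.val_succ, Nat.cast_add, Nat.cast_one] at h2)
    have e2 := key t' h'.1 (by
      have h2 : (t' : ℝ) ≤ t₁ + ((j.succ : ℕ) : ℝ) * ((t₂ - t₁) / n) := h'.2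
      rwa [Fin.val_succ, Nat.cast_add, Nat.cast_one] at h2)
    have e3 := calkinNorm_add_lt (calkinNorm_sub_comm_lt e1) e2
    have e4 : P t - P i + (P i - P t') = P t - P t' := by abel
    rw [e4] at e3
    linarith

theorem IsCalkinPath.exists_isIndexPrimitive (ht : t₁ < t₂) (hP : IsCalkinPath P) :
    ∃ F, IsIndexPrimitive P F := by
  obtain ⟨N, τ, hτ, h0, hN, hfine⟩ := hP.exists_subdivision ht
  have key : ∀ j : Fin (N + 1), ∃ F : Set.Icc t₁ t₂ → ℝ, ∀ t₀ ≤ τ j, ∀ᶠ t in 𝓝 t₀, t ≤ τ j →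
      F t - F t₀ = relIndex (P t₀) (P t) := by
    intro j
    induction j using Fin.induction with
    | zero =>
      refine ⟨fun _ => 0, fun t₀ _ => Filter.Eventually.of_forall fun t htj => ?_⟩
      have e1 : ∀ x : Set.Icc t₁ t₂, x ≤ τ 0 → x = τ 0 := fun x hx => le_antisymm hx (by
        change (τ 0 : ℝ) ≤ x
        rw [h0]; exact x.2.1)
      rw [e1 t htj, e1 t₀ ‹_›, relIndex_self (hP.proj _).proj, sub_self]
    | succ j ih =>
      obtain ⟨F, hF⟩ := ih
      set m := τ j.castSucc with hm
      have hmle : m ≤ τ j.succ := hτ.monotone (Fin.castSucc_le_succ j)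
      -- The primitive is continued past the node `m` by the relative index with `P_m`. At `m`
      -- itself the left side is covered by induction and the right side by definition.
      refine ⟨fun t => if t ≤ m then F t else F m + relIndex (P m) (P t), fun t₀ ht₀ => ?_⟩
      rcases lt_trichotomy t₀ m with hlt | rfl | hgt
      · filter_upwards [hF t₀ hlt.le, Iio_mem_nhds hlt] with t h1 h2 _
        have h2 : t < m := h2
        rw [if_pos h2.le, if_pos hlt.le]
        exact h1 h2.le
      · filter_upwards [hF m le_rfl] with t h1 _
        rw [if_pos le_rfl]
        split_ifs with h2
        · exact h1 h2
        · ring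
      · have h3 := hfine j m ⟨le_rfl, hmle⟩ t₀ ⟨hgt.le, ht₀⟩
        filter_upwards [hP.eventually_relIndex h3, Ioi_mem_nhds hgt] with t h1 h2 _
        have h2 : m < t := h2
        rw [if_neg h2.not_ge, if_neg hgt.not_ge, h1]
        ring
  obtain ⟨F, hF⟩ := key (Fin.last N)
  have hle : ∀ x : Set.Icc t₁ t₂, x ≤ τ (Fin.last N) := fun x => by
    change (x : ℝ) ≤ τ (Fin.last N)
    rw [hN]; exact x.2.2
  refine ⟨F, fun t₀ => ?_⟩
  filter_upwards [hF t₀ (hle t₀)] with t h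
  exact h (hle t)

theorem sum_fin_succ_sub_castSucc {N : ℕ} (f : Fin (N + 1) → ℝ) :
    ∑ j : Fin N, (f j.succ - f j.castSucc) = f (Fin.last N) - f 0 := by
  rw [Finset.sum_sub_distrib]
  have h1 := Fin.sum_univ_succ f
  have h2 := Fin.sum_univ_castSucc f
  linarith

/-- A path of operators has a spectral flow, given by the increment of an index primitive. -/
theorem hasSpectralFlow_of_isIndexPrimitive (ht : t₁ < t₂) {S : Set.Icc t₁ t₂ → H →ₗ.[ℂ] H}
    (hP : IsCalkinPath fun t => nonnegProjection (S t)) {F : Set.Icc t₁ t₂ → ℝ}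
    (hF : IsIndexPrimitive (fun t => nonnegProjection (S t)) F) :
    HasSpectralFlow S (F ⟨t₂, ht.le, le_rfl⟩ - F ⟨t₁, le_rfl, ht.le⟩) := by
  refine ⟨?_, fun N τ hτ => ?_⟩
  · obtain ⟨N, τ, h1, h2, h3, h4⟩ := hP.exists_subdivision ht
    exact ⟨N, τ, h1, h2, h3, h4⟩
  · have hle : ∀ j : Fin N, τ j.castSucc ≤ τ j.succ := fun j =>
      hτ.strictMono.monotone (Fin.castSucc_le_succ j)
    refine ⟨fun j => isFredholmPair_of_calkinNorm_lt_one (hP.proj _) (hP.proj _)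
      (hτ.fine j _ ⟨le_rfl, hle j⟩ _ ⟨hle j, le_rfl⟩), ?_⟩
    have h1 : ∀ j : Fin N, relIndex (nonnegProjection (S (τ j.castSucc)))
        (nonnegProjection (S (τ j.succ))) = F (τ j.succ) - F (τ j.castSucc) := fun j =>
      hP.relIndex_eq_sub hF (hle j) fun t h => hτ.fine j _ ⟨le_rfl, hle j⟩ t h
    rw [Finset.sum_congr rfl fun j _ => h1 j, sum_fin_succ_sub_castSucc fun j => F (τ j)]
    have e0 : τ 0 = ⟨t₁, le_rfl, ht.le⟩ := Subtype.ext hτ.first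
    have e1 : τ (Fin.last N) = ⟨t₂, ht.le, le_rfl⟩ := Subtype.ext hτ.last
    rw [e0, e1]

end CalkinPath

/-! ### Comparison of two evolutions. -/

section Evolution

variable {Γ : Type v} [Group Γ]

/-- A domain-preserving unitary is bounded for the graph norms, by the closed graph theorem applied
to the pulled-back operator. -/
theorem DomainIso.map_add_norm_le {K L : HilbertModule.{u} Γ} {S : K →ₗ.[ℂ] K} {S' : L →ₗ.[ℂ] L}
    (Q : DomainIso S S') (hS' : IsSelfAdjointGraph S') {S₀ : K →ₗ.[ℂ] K}
    (hS₀ : IsSelfAdjointGraph S₀) (hdom : S₀.domain = S.domain) :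
    ∃ C : ℝ, 0 ≤ C ∧ ∀ (x y : K) (z : L), (x, y) ∈ S₀.graph → (Q.toIso x, z) ∈ S'.graph →
      ‖Q.toIso x‖ + ‖z‖ ≤ C * (‖x‖ + ‖y‖) := by
  have hQ : IsSelfAdjointGraph Q.pullback := hS'.conj Q.toIso Q.mem_graph_pullback
  obtain ⟨C, hC, h⟩ := exists_relative_bound (S := S₀) (S' := Q.pullback) hS₀.isClosed hQ.isClosed
    hdom
  refine ⟨1 + C, by positivity, fun x y z hxy hz => ?_⟩
  have h1 := h x y (Q.toIso.symm z) hxy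
    ((Q.mem_graph_pullback _ _).2 (by rwa [Q.toIso.apply_symm_apply]))
  rw [Q.toIso.symm.norm_map] at h1
  rw [Q.toIso.norm_map]
  nlinarith [norm_nonneg y, norm_nonneg x]

/-- Composition of domain-preserving isomorphisms. -/
def DomainIso.trans {K L M : HilbertModule.{u} Γ} {S : K →ₗ.[ℂ] K} {S' : L →ₗ.[ℂ] L}
    {S'' : M →ₗ.[ℂ] M} (Q : DomainIso S S') (Q' : DomainIso S' S'') : DomainIso S S'' where
  toIso := Q.toIso.trans Q'.toIso
  equivariant γ x := by
    change Q'.toIso (Q.toIso (K.ρ γ x)) = M.ρ γ (Q'.toIso (Q.toIso x))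
    rw [Q.equivariant, Q'.equivariant]
  mem_domain x := (Q'.mem_domain _).trans (Q.mem_domain x)

variable {t₁ t₂ : ℝ} {H : Set.Icc t₁ t₂ → HilbertModule.{u} Γ} {S : ∀ t, H t →ₗ.[ℂ] H t}

theorem Evolution.isSelfAdjointFredholmGraph (hS : ∀ t, IsSelfAdjointGammaFredholm (S t))
    (E : Evolution S) (b t : Set.Icc t₁ t₂) : IsSelfAdjointFredholmGraph (E.evolved b t) :=
  (hS t).isSelfAdjointFredholmGraph.pullback _

theorem Evolution.eventually_isRelClose (hS : ∀ t, IsSelfAdjointGammaFredholm (S t))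
    (E : Evolution S) {b : Set.Icc t₁ t₂}
    (hE : ContinuousOnDomain (S b) (fun t => (E.evolved b t).toFun)) (t₀ : Set.Icc t₁ t₂) {δ : ℝ}
    (hδ : 0 < δ) : ∀ᶠ t in 𝓝 t₀, IsRelClose (E.evolved b t₀) (E.evolved b t) δ := by
  have hb := (hS b).isSelfAdjointFredholmGraph
  obtain ⟨C, hC, h⟩ := exists_relative_bound (S := E.evolved b t₀) (S' := S b)
    (E.isSelfAdjointFredholmGraph hS b t₀).selfAdjoint.isClosed hb.selfAdjoint.isClosed rfl
  filter_upwards [hE t₀ (δ / (1 + C)) (by positivity)] with t ht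
  refine ⟨rfl, fun x y y' hy hy' => ?_⟩
  have hx : x ∈ (E.evolved b t₀).domain := LinearPMap.mem_domain_of_mem_graph hy
  have hx : x ∈ (S b).domain := hx
  have hgr : ∀ s, (x, (E.evolved b s).toFun ⟨x, hx⟩) ∈ (E.evolved b s).graph := fun s =>
    (LinearPMap.mem_graph_iff (E.evolved b s)).2 ⟨⟨x, hx⟩, rfl, rfl⟩
  have h1 : (E.evolved b t₀).toFun ⟨x, hx⟩ = y := graph_snd_eq (hgr t₀) hy
  have h2 : (E.evolved b t).toFun ⟨x, hx⟩ = y' := graph_snd_eq (hgr t) hy'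
  have h3 := ht ⟨x, hx⟩
  have h4 := h x y (S b ⟨x, hx⟩) hy ((LinearPMap.mem_graph_iff _).2 ⟨⟨x, hx⟩, rfl, rfl⟩)
  have h5 : ‖x‖ + ‖S b ⟨x, hx⟩‖ ≤ (1 + C) * (‖x‖ + ‖y‖) := by
    nlinarith [norm_nonneg y]
  calc ‖y' - y‖ = ‖(E.evolved b t).toFun ⟨x, hx⟩ - (E.evolved b t₀).toFun ⟨x, hx⟩‖ := by
        rw [h1, h2]
    _ ≤ δ / (1 + C) * (‖x‖ + ‖S b ⟨x, hx⟩‖) := h3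
    _ ≤ δ / (1 + C) * ((1 + C) * (‖x‖ + ‖y‖)) := by gcongr
    _ = _ := by field_simp

theorem Evolution.isCalkinPath (hS : ∀ t, IsSelfAdjointGammaFredholm (S t))
    (E : Evolution S) {b : Set.Icc t₁ t₂}
    (hE : ContinuousOnDomain (S b) (fun t => (E.evolved b t).toFun)) :
    IsCalkinPath fun t => nonnegProjection (E.evolved b t) := by
  refine ⟨fun t => (E.isSelfAdjointFredholmGraph hS b t).isEquivariantProj, fun t₀ ε hε => ?_⟩
  obtain ⟨δ, hδ, h⟩ :=
    exists_calkinNorm_nonnegProjection_sub_lt (E.isSelfAdjointFredholmGraph hS b t₀) hε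
  filter_upwards [E.eventually_isRelClose hS hE t₀ hδ] with t ht
  exact h _ (E.isSelfAdjointFredholmGraph hS b t) ht

/-- The unitary operator `Q(t, b)⁻¹ Q'(t, b)` that compares two evolutions. -/
def Evolution.comparison (E E' : Evolution S) (b t : Set.Icc t₁ t₂) : H b →L[ℂ] H b :=
  (E.Q t b).symmCLM ∘L (E'.Q t b).toCLM

theorem Evolution.isEquivariantUnitary_comparison (E E' : Evolution S) (b t : Set.Icc t₁ t₂) :
    IsEquivariantUnitary (E.comparison E' b t) ∧
      ∀ x, star (E.comparison E' b t) x = (E'.Q b t).toIso ((E.Q t b).toIso x) := by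
  set w := (E'.Q t b).toIso.trans (E.Q t b).toIso.symm with hw
  have h1 : E.comparison E' b t = w.toContinuousLinearEquiv.toContinuousLinearMap := rfl
  have h2 : star (E.comparison E' b t) = w.symm.toContinuousLinearEquiv.toContinuousLinearMap := by
    rw [ContinuousLinearMap.star_eq_adjoint, eq_comm, ContinuousLinearMap.eq_adjoint_iff]
    intro x y
    rw [h1]
    change ⟪w.symm x, y⟫_ℂ = ⟪x, w y⟫_ℂ
    rw [← w.inner_map_map, w.apply_symm_apply]
  refine ⟨⟨?_, ?_, (E.Q t b).isEquivariant_symmCLM.comp (E'.Q t b).equivariant⟩, fun x => ?_⟩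
  · rw [h2, h1]; ext x; exact w.symm_apply_apply x
  · rw [h2, h1]; ext x; exact w.apply_symm_apply x
  · rw [h2, E'.symm t b]; rfl

theorem Evolution.mem_graph_evolved_iff (E E' : Evolution S) (b t : Set.Icc t₁ t₂) (x y : H b) :
    (x, y) ∈ (E'.evolved b t).graph ↔
      (E.comparison E' b t x, E.comparison E' b t y) ∈ (E.evolved b t).graph := by
  have h1 : ∀ z, (E.Q t b).toIso (E.comparison E' b t z) = (E'.Q t b).toIso z := fun z =>
    (E.Q t b).toIso.apply_symm_apply _
  rw [Evolution.evolved, Evolution.evolved, DomainIso.mem_graph_pullback,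
    DomainIso.mem_graph_pullback, h1, h1]

theorem Evolution.eventually_star_comparison_sub_le (hS : ∀ t, IsSelfAdjointGammaFredholm (S t))
    {b : Set.Icc t₁ t₂} (T : ∀ t, DomainIso (S t) (S b)) (E E' : Evolution S)
    (hE : ContinuousOnDomain (S b) (E.inTrivialisation T))
    (hE' : ContinuousOnDomain (S b) (E'.inTrivialisation T)) (t₀ : Set.Icc t₁ t₂) {δ : ℝ}
    (hδ : 0 < δ) : ∀ᶠ t in 𝓝 t₀, ∀ x y, (x, y) ∈ (E.evolved b t₀).graph →
      ‖star (E.comparison E' b t) x - star (E.comparison E' b t₀) x‖ ≤ δ * (‖x‖ + ‖y‖) := by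
  have hb := (hS b).isSelfAdjointFredholmGraph.selfAdjoint
  have h₀ := (E.isSelfAdjointFredholmGraph hS b t₀).selfAdjoint
  obtain ⟨C₁, hC₁, k₁⟩ := (T b).map_add_norm_le hb h₀ rfl
  obtain ⟨C₂, hC₂, k₂⟩ := ((E.Q t₀ b).trans (T t₀)).map_add_norm_le hb h₀ rfl
  set η := δ / (C₁ + C₂ + 1) with hη
  have hη0 : 0 < η := by positivity
  have c₁ : ContinuousAt (fun t => (t, b)) t₀ :=
    (continuous_id.prodMk continuous_const).continuousAt
  have c₂ : ContinuousAt (fun t => (b, t)) t₀ :=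
    (continuous_const.prodMk continuous_id).continuousAt
  filter_upwards [c₁.eventually (hE (t₀, b) η hη0), c₂.eventually (hE' (b, t₀) η hη0)]
    with t h₁ h₂ x y hxy
  have hx : x ∈ (E.evolved b t₀).domain := LinearPMap.mem_domain_of_mem_graph hxy
  have hx : x ∈ (S b).domain := hx
  have hz : (T b).toIso x ∈ (S b).domain := ((T b).mem_domain x).2 hx
  set u := (T t₀).toIso ((E.Q t₀ b).toIso x) with hu
  have hu' : u ∈ (S b).domain := (((E.Q t₀ b).trans (T t₀)).mem_domain x).2 hx
  have l₁ := h₁ ⟨_, hz⟩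
  have l₂ := h₂ ⟨_, hu'⟩
  have m₁ := k₁ x y _ hxy ((LinearPMap.mem_graph_iff _).2 ⟨⟨_, hz⟩, rfl, rfl⟩)
  have m₂ := k₂ x y (S b ⟨u, hu'⟩) hxy ((LinearPMap.mem_graph_iff _).2 ⟨⟨_, hu'⟩, rfl, rfl⟩)
  have v₁ : ∀ s, E.inTrivialisation T (s, b) ⟨_, hz⟩ =
      (T s).toIso ((E.Q s b).toIso x) := fun s => by
    change (T s).toIso ((E.Q s b).toIso ((T b).toIso.symm ((T b).toIso x))) = _
    rw [(T b).toIso.symm_apply_apply]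
  have v₂ : ∀ s, E'.inTrivialisation T (b, s) ⟨u, hu'⟩ =
      (T b).toIso ((E'.Q b s).toIso ((T s).toIso.symm u)) := fun s => rfl
  rw [v₁, v₁, ← hu] at l₁
  rw [v₂, v₂] at l₂
  rw [(E.isEquivariantUnitary_comparison E' b t).2,
    (E.isEquivariantUnitary_comparison E' b t₀).2]
  -- `p` is the vector `Q(t₀,b)x` carried to time `t` by the trivialisation. Comparing `Q(t,b)x`
  -- with `p` uses continuity of the first evolution; comparing the images of `p` and `Q(t₀,b)x`
  -- under `Q'(b,·)` uses continuity of the second, at the fixed domain vector `u`.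
  set p := (T t).toIso.symm u with hp
  have d₁ : ‖(E'.Q b t).toIso ((E.Q t b).toIso x) - (E'.Q b t).toIso p‖ ≤
      η * (C₁ * (‖x‖ + ‖y‖)) := by
    rw [← map_sub, (E'.Q b t).toIso.norm_map, ← (T t).toIso.norm_map, map_sub, hp,
      (T t).toIso.apply_symm_apply]
    exact l₁.trans (by gcongr; exact m₁)
  have d₂ : ‖(E'.Q b t).toIso p - (E'.Q b t₀).toIso ((E.Q t₀ b).toIso x)‖ ≤
      η * (C₂ * (‖x‖ + ‖y‖)) := by
    have e1 : (T t₀).toIso.symm u = (E.Q t₀ b).toIso x := (T t₀).toIso.symm_apply_apply _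
    rw [e1, ← map_sub, (T b).toIso.norm_map] at l₂
    exact l₂.trans (by gcongr; exact m₂)
  have := norm_add_le ((E'.Q b t).toIso ((E.Q t b).toIso x) - (E'.Q b t).toIso p)
    ((E'.Q b t).toIso p - (E'.Q b t₀).toIso ((E.Q t₀ b).toIso x))
  rw [sub_add_sub_cancel] at this
  have hηC : η * (C₁ + C₂) ≤ δ := by
    rw [hη, div_mul_eq_mul_div, div_le_iff₀ (by positivity)]
    nlinarith
  calc _ ≤ η * (C₁ * (‖x‖ + ‖y‖)) + η * (C₂ * (‖x‖ + ‖y‖)) := by linarith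
    _ = η * (C₁ + C₂) * (‖x‖ + ‖y‖) := by ring
    _ ≤ _ := by gcongr

/-- The relative indices of nearby spectral projections do not depend on the evolution. -/
theorem Evolution.eventually_relIndex_eq (hS : ∀ t, IsSelfAdjointGammaFredholm (S t))
    {b : Set.Icc t₁ t₂} (T : ∀ t, DomainIso (S t) (S b)) (E E' : Evolution S)
    (hE : ContinuousOnDomain (S b) (E.inTrivialisation T))
    (hE' : ContinuousOnDomain (S b) (E'.inTrivialisation T))
    (hEc : ContinuousOnDomain (S b) (fun t => (E.evolved b t).toFun))
    (hEc' : ContinuousOnDomain (S b) (fun t => (E'.evolved b t).toFun)) (t₀ : Set.Icc t₁ t₂) :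
    ∀ᶠ t in 𝓝 t₀,
      relIndex (nonnegProjection (E'.evolved b t₀)) (nonnegProjection (E'.evolved b t)) =
        relIndex (nonnegProjection (E.evolved b t₀)) (nonnegProjection (E.evolved b t)) := by
  have hF := E.isSelfAdjointFredholmGraph hS b
  have hF' := E'.isSelfAdjointFredholmGraph hS b
  -- The constants give `30/60 < 2/3` for the norm step, `2(2/480 + 2/480) = 1/60` for the relative
  -- closeness it needs, and `1/6 = (1 - 2/3)/2` for additivity.
  filter_upwards [E.eventually_star_comparison_sub_le hS T E' hE hE' t₀ (δ := 1 / 60) (by norm_num),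
    E.eventually_isRelClose hS hEc t₀ (δ := 1 / 480) (by norm_num),
    E'.eventually_isRelClose hS hEc' t₀ (δ := 1 / 480) (by norm_num),
    (E.isCalkinPath hS hEc).cont t₀ (1 / 6) (by norm_num)] with t h₁ h₂ h₃ h₄
  obtain ⟨hw, -⟩ := E.isEquivariantUnitary_comparison E' b t
  obtain ⟨hw₀, -⟩ := E.isEquivariantUnitary_comparison E' b t₀
  have hg := E.mem_graph_evolved_iff E' b t
  have hg₀ := E.mem_graph_evolved_iff E' b t₀
  -- `U.pullback` is the intermediate operator: the evolved operator at `t₀`, conjugated by the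
  -- comparison unitary at `t`.
  set U : DomainIso (S b) (E.evolved b t₀) :=
    { toIso := (E'.Q t b).toIso.trans (E.Q t b).toIso.symm
      equivariant := hw.equiv
      mem_domain := fun x => by
        change (E.Q t b).toIso.symm ((E'.Q t b).toIso x) ∈ (S b).domain ↔ _
        rw [← (E.Q t b).mem_domain, (E.Q t b).toIso.apply_symm_apply, (E'.Q t b).mem_domain] }
    with hU
  have hgU : ∀ x y, (x, y) ∈ U.pullback.graph ↔
      (E.comparison E' b t x, E.comparison E' b t y) ∈ (E.evolved b t₀).graph :=
    U.mem_graph_pullback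
  set w := E.comparison E' b t
  set w₀ := E.comparison E' b t₀
  have hUs := (hF t₀).pullback U
  have hnorm : ∀ x, ‖w x‖ = ‖x‖ := ((E'.Q t b).toIso.trans (E.Q t b).toIso.symm).norm_map
  have r₁ : IsRelClose (E'.evolved b t) U.pullback (2 * (1 / 480)) := by
    refine ⟨rfl, fun x y y' hy hy' => ?_⟩
    have := (h₂.symm (by norm_num) (by norm_num)).2 _ _ _ ((hg x y).1 hy) ((hgU x y').1 hy')
    rwa [← map_sub, hnorm, hnorm, hnorm] at this
  have r₂ : IsRelClose (E'.evolved b t₀) U.pullback (1 / 60) := by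
    have := (h₃.symm (by norm_num) (by norm_num)).trans r₁ (by norm_num) (by norm_num) (by norm_num)
    norm_num at this ⊢
    exact this
  have hn := norm_conj_nonnegProjection_sub_le (hF t₀) (hF' t₀).selfAdjoint hUs.selfAdjoint hw₀ hw
    hg₀ hgU (by norm_num) (by norm_num) r₂ h₁
  have e₀ := nonnegProjection_conj (hF t₀).selfAdjoint (hF' t₀).selfAdjoint hw₀ hg₀
  have e₁ := nonnegProjection_conj (hF t).selfAdjoint (hF' t).selfAdjoint hw hg
  have p₀ := (hF t₀).isEquivariantProj
  have p₁ := (hF t).isEquivariantProj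
  set P₀ := nonnegProjection (E.evolved b t₀)
  set P₁ := nonnegProjection (E.evolved b t)
  rw [e₀, e₁]
  have c₁ : calkinNorm (star w * P₀ * w - star w * P₁ * w) < 1 / 6 := by
    rw [IsEquivariantUnitary.conj_sub]
    exact hw.calkinNorm_conj_lt h₄
  have hn' : ‖star w₀ * P₀ * w₀ - star w * P₀ * w‖ < 2 / 3 := lt_of_le_of_lt hn (by norm_num)
  have hz := relIndex_eq_zero_of_norm_sub_lt_one (hw₀.conj_proj p₀).proj (hw.conj_proj p₀).proj
    (hn'.trans (by norm_num))
  -- The first leg, where only the unitary moves, has index 0; the second, where only the projection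
  -- moves, is a conjugate of the first evolution's pair.
  rw [relIndex_add (hw₀.conj_proj p₀) (hw.conj_proj p₀) (hw.conj_proj p₁) (by norm_num)
    (calkinNorm_lt_of_norm_lt hn') c₁ (by norm_num), hz, zero_add,
    hw.relIndex_conj p₀ p₁ (h₄.trans (by norm_num))]

end Evolution

end HilbertModule

theorem proposition3p6 {Γ : Type v} [Group Γ] {t₁ t₂ : ℝ} (ht : t₁ < t₂)
    (H : Set.Icc t₁ t₂ → HilbertModule.{u} Γ) (S : ∀ t, H t →ₗ.[ℂ] H t)
    (hS : ∀ t, HilbertModule.IsSelfAdjointGammaFredholm (S t))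
    (b : Set.Icc t₁ t₂) (hb : (b : ℝ) = t₁)
    (T : ∀ t, HilbertModule.DomainIso (S t) (S b)) :
    ∃ r : ℝ, ∀ E : HilbertModule.Evolution S,
      HilbertModule.ContinuousOnDomain (S b) (E.inTrivialisation T) →
      HilbertModule.ContinuousOnDomain (S b) (fun t => (E.evolved b t).toFun) →
      HilbertModule.HasSpectralFlow (E.evolved b) r := by
  -- `r` is the increment of a primitive for one admissible evolution, which is a primitive for all
  -- the others; if none exists the claim is vacuous.
  by_cases hex : ∃ E : HilbertModule.Evolution S,
      HilbertModule.ContinuousOnDomain (S b) (E.inTrivialisation T) ∧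
      HilbertModule.ContinuousOnDomain (S b) (fun t => (E.evolved b t).toFun)
  · obtain ⟨E₀, h₁, h₂⟩ := hex
    obtain ⟨F, hF⟩ := (E₀.isCalkinPath hS h₂).exists_isIndexPrimitive ht
    refine ⟨_, fun E h₃ h₄ => HilbertModule.hasSpectralFlow_of_isIndexPrimitive ht
      (E.isCalkinPath hS h₄) (F := F) fun t₀ => ?_⟩
    filter_upwards [hF t₀, E₀.eventually_relIndex_eq hS T E h₁ h₃ h₂ h₄ t₀] with t e₁ e₂
    exact e₁.trans e₂.symm
  · exact ⟨0, fun E h₁ h₂ => (hex ⟨E, h₁, h₂⟩).elim⟩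

end
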